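/- **Network model.** UEs form a homogeneous Poisson point process of intensity $\lambda>0$ in $\mathbb R^2$. Each UE is, independently, a potential D2D UE with probability $q\in[0,1]$ and a cellular UE otherwise; it has a D2D link length $L_d$ with density $2\pi\xi x e^{-\xi\pi x^2}$ ($x\ge 0$, $\xi>0$); a potential D2D UE is in D2D mode if $L_d\le\theta$ ($\theta\ge 0$), and all other UEs are in cellular mode, with intensity $\lambda_c=[(1-q)+q\,\mathrm P(L_d>\theta)]\lambda$. A D2D-mode UE transmits (ALOHA) with probability $\varepsilon\in[0,1]$. The cell of the typical base station is $\mathcal A=B(0,R)$, $R=(\pi\lambda_b)^{-1/2}$, $\lambda_b>0$; active cellular transmitters form an independent Poisson process of intensity $\lambda_b$, whose points outside $\mathcal A$ interfere, with link lengths $L_c$ of density $2x/R^2$ on $[0,R]$. Transmit powers are $L_d^{\tau_d}$, $L_c^{\tau_c}$ (channel inversion) with $\tau_c,\tau_d>2$, so the received power $W$ of the intended link is its fading coefficient. With fading coefficients $G_j$, independent of each other and of everything else, the interference at a receiver at the origin is $I_d=\sum_j L_{d,j}^{\tau_d}G_j\|X_j\|^{-\tau_d}$ over the transmitting D2D-mode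 UEs for the D2D link and $I_c=\sum_j L_{c,j}^{\tau_c}G_j\|X_j\|^{-\tau_c}$ over the active cellular transmitters outside $\mathcal A$ for the cellular link. The noise power is $N_0>0$, and $\mathrm{SINR}=W/(I+N_0)$. A fraction $\beta\in[0,1]$ of the spectrum is given to D2D and $1-\beta$ to cellular mode. The UEs in cellular mode in $\mathcal A$, whose number $N$ counts the typical UE as well, share the cellular spectrum equally: a cellular UE has rate $(1-\beta)\frac1N\log(1+\mathrm{SINR})$; a potential D2D UE in D2D mode has rate $\beta\log(1+\mathrm{SINR})$ when ALOHA lets it transmit and $0$ otherwise; a potential D2D UE has the latter rate if its link length is $L_d\le\theta$ and the former if $L_d>\theta$. Each fading coefficient $G$ has one of the following laws, with mean $\bar w>0$. * $\kappa$-$\mu$ ($\kappa,\mu>0$): density $\frac{\mu}{\kappa^{(\mu-1)/2}e^{\mu\kappa}}\left(\frac{1+\kappa}{\bar w}\right)^{\frac{\mu+1}2}x^{\frac{\mu-1}2}e^{-\mu(1+\kappa)x/\bar w}\,\mathrm I_{\mu-1}\!\left(2\mu\sqrt{\kappa(1+\kappa)x/\bar w}\right)$, $x>0$. * $\eta$-$\mu$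 ($\eta,\mu>0$): with $h=\frac{2+\eta^{-1}+\eta}4$, $H=\frac{\eta^{-1}-\eta}4$, density $\frac{2\sqrt\pi\mu^{\mu+1/2}h^\mu}{\Gamma(\mu)H^{\mu-1/2}\bar w^{\mu+1/2}}x^{\mu-1/2}e^{-2\mu hx/\bar w}\,\mathrm I_{\mu-1/2}(2\mu Hx/\bar w)$, $x>0$ (even in $H$; continued by its limit to $H=0$). The intended and the interfering channels of the two links may have different fading models. **Theorem 3.** $I_c$, $I_d$ and $N$ are almost surely finite, the rates are integrable, and the average rates $R_c$ of a cellular UE, $\hat R_d$ of a potential D2D UE in D2D mode and $R_d$ of a potential D2D UE are $$R_c=(1-\beta)\tfrac{\lambda_b}{\lambda_c}\left(1-e^{-\lambda_c/\lambda_b}\right)\mathbb E\!\left[\log\!\left(1+\tfrac{W}{I_c+N_0}\right)\right],\qquad \hat R_d=\beta\varepsilon\,\mathbb E\!\left[\log\!\left(1+\tfrac{W}{I_d+N_0}\right)\right],$$ $$R_d=R_c\,\mathrm P(L_d>\theta)+\hat R_d\,\mathrm P(L_d\le\theta),\qquad \mathrm P(L_d\le\theta)=1-e^{-\xi\pi\theta^2}.$$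 Let $I$ be $I_c$ or $I_d$, $\mathcal L_I(s)=\mathbb E[e^{-sI}]$ and $g_i(z)=\frac1z\left(1-\frac1{(1+z)^i}\right)$; for integers $i\ge1$ and $z>0$, $g_i(z)=\frac1{\Gamma(i)}\frac{d^i}{dz^i}\left(z^{i-1}\log(1+z)\right)$. Let $x_m$, $c_m$ ($1\le m\le M$) be the abscissae and weights of the Gauss-Laguerre quadrature of order $M$; the abscissae are distinct and positive. If $W$ is $\kappa$-$\mu$ distributed, then $$\mathbb E\!\left[\log\!\left(1+\tfrac{W}{I+N_0}\right)\right]=\frac{\bar w}{\mu(1+\kappa)N_0}\sum_{n\ge0}\frac{(\mu\kappa)^n}{n!\,e^{\mu\kappa}}\int_0^\infty g_{\mu+n}\!\left(\tfrac{\bar wx}{\mu(1+\kappa)N_0}\right)\mathcal L_I\!\left(\tfrac x{N_0}\right)e^{-x}dx$$ $$=\lim_{M\to\infty}\frac{\bar w}{\mu(1+\kappa)N_0}\sum_{m=1}^M\sum_{n\ge0}\frac{c_m(\mu\kappa)^n}{n!\,e^{\mu\kappa}}\,g_{\mu+n}\!\left(\tfrac{\bar wx_m}{\mu(1+\kappa)N_0}\right)\mathcal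 L_I\!\left(\tfrac{x_m}{N_0}\right),$$ and if $W$ is $\eta$-$\mu$ distributed, then, with $a_n=\binom{n+\mu-1}n\frac{H^{2n}}{h^{\mu+2n}}$, $$\mathbb E\!\left[\log\!\left(1+\tfrac{W}{I+N_0}\right)\right]=\frac{\bar w}{2\mu hN_0}\sum_{n\ge0}a_n\int_0^\infty g_{2\mu+2n}\!\left(\tfrac{\bar wx}{2\mu hN_0}\right)\mathcal L_I\!\left(\tfrac x{N_0}\right)e^{-x}dx$$ $$=\lim_{M\to\infty}\frac{\bar w}{2\mu hN_0}\sum_{m=1}^M\sum_{n\ge0}a_nc_m\,g_{2\mu+2n}\!\left(\tfrac{\bar wx_m}{2\mu hN_0}\right)\mathcal L_I\!\left(\tfrac{x_m}{N_0}\right).$$ All the integrals and series converge. For $s>0$ the Laplace transforms are as follows, where $\kappa,\mu$ (resp. $\eta,\mu,h,H$) and $\bar w$ now belong to the fading of the interfering channels. With $\delta_d=2/\tau_d$, $\hat\xi=\xi/\gamma(2,\xi\pi\theta^2)$ ($1/\hat\xi=0$ if $\theta=0$) and $\mathrm{sinc}(x)=\frac{\sin\pi x}{\pi x}$, $\mathcal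 L_{I_d}(s)=\exp(-c\,s^{\delta_d})$ where $$c=\frac{q\varepsilon\lambda}{\hat\xi e^{\mu\kappa}}\,\frac{{}_1F_1(\mu+\delta_d;\mu;\mu\kappa)}{\mathrm{sinc}(\delta_d)}\left(\frac{\bar w}{(1+\kappa)\mu}\right)^{\delta_d}\binom{\mu+\delta_d-1}{\delta_d}$$ for $\kappa$-$\mu$ and $$c=\frac{q\varepsilon\lambda}{\hat\xi h^{\mu}}\,\frac{{}_2F_1\!\left(\mu+\frac{\delta_d}2+\frac12,\mu+\frac{\delta_d}2;\mu+\frac12;\frac{H^2}{h^2}\right)}{\mathrm{sinc}(\delta_d)}\left(\frac{\bar w}{2\mu h}\right)^{\delta_d}\binom{2\mu+\delta_d-1}{\delta_d}$$ for $\eta$-$\mu$ fading. With $\delta_c=2/\tau_c$, $\mathcal L_{I_c}(s)=\exp\left(-2\pi\lambda_b\int_R^\infty(1-\varphi(r))\,r\,dr\right)$ where, with the Meijer function $G^{2,1}_{2,2}$, $$\varphi(r)=\frac{\pi\lambda_br^2\delta_c}{e^{\mu\kappa}}\left(\frac{\mu(1+\kappa)}{s\bar w}\right)^{\delta_c}\sum_{n\ge0}\frac{(\mu\kappa)^n}{n!\,\Gamma(\mu+n)}\,G^{2,1}_{2,2}\!\left(\frac{\mu(1+\kappa)(\pi\lambda_b)^{1/\delta_c}r^{\tau_c}}{s\bar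 w}\,\Big|\,{1-\delta_c,\,1\atop 0,\,n+\mu-\delta_c}\right)$$ for $\kappa$-$\mu$ and $$\varphi(r)=\frac{2\pi^{3/2}\lambda_br^2\delta_c}{\Gamma(\mu)h^\mu}\left(\frac{2\mu h}{s\bar w}\right)^{\delta_c}\sum_{n\ge0}\frac{2^{-2n-2\mu}}{n!\,\Gamma(\mu+n+\frac12)}\left(\frac Hh\right)^{2n}G^{2,1}_{2,2}\!\left(\frac{2\mu h(\pi\lambda_b)^{1/\delta_c}r^{\tau_c}}{s\bar w}\,\Big|\,{1-\delta_c,\,1\atop 0,\,2n+2\mu-\delta_c}\right)$$ for $\eta$-$\mu$ fading. -/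

import Mathlib

open MeasureTheory ProbabilityTheory Filter Topology Set
open scoped ENNReal NNReal

noncomputable section

namespace D2D

/-! ### Special functions -/

/-- The modified Bessel function of the first kind of order `ν` at `x > 0`. -/
def besselI (ν x : ℝ) : ℝ :=
  ∑' n : ℕ, 1 / ((n.factorial : ℝ) * Real.Gamma (n + ν + 1)) * (x / 2) ^ (2 * (n : ℝ) + ν)

/-- `y ^ (-ν) * I_ν (c * y)` for `c > 0`, written as the power series in `y` that it is, so that it
makes sense (as an even entire function of `y`) also for `y ≤ 0`; see `besselI_eq`. -/
def besselIQuot (ν c y : ℝ) : ℝ :=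
  ∑' n : ℕ, 1 / ((n.factorial : ℝ) * Real.Gamma (n + ν + 1)) *
    (c / 2) ^ (2 * (n : ℝ) + ν) * y ^ (2 * n)

theorem besselI_eq {ν c y : ℝ} (hc : 0 < c) (hy : 0 < y) :
    besselI ν (c * y) = y ^ ν * besselIQuot ν c y := by
  unfold besselI besselIQuot
  rw [← tsum_mul_left]
  refine tsum_congr fun n => ?_
  have h1 : c * y / 2 = (c / 2) * y := by ring
  have h2 : y ^ (2 * (n : ℝ) + ν) = y ^ (2 * n) * y ^ ν := by
    rw [Real.rpow_add hy]
    congr 1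
    rw [← Real.rpow_natCast]
    push_cast
    rfl
  rw [h1, Real.mul_rpow (by positivity) hy.le, h2]
  ring

/-- The lower incomplete Gamma function. -/
def lowerGamma (a x : ℝ) : ℝ := ∫ t in (0 : ℝ)..x, t ^ (a - 1) * Real.exp (-t)

/-- The binomial coefficient with real entries. -/
def genBinom (x y : ℝ) : ℝ :=
  Real.Gamma (x + 1) / (Real.Gamma (y + 1) * Real.Gamma (x - y + 1))

/-- The normalized cardinal sine `sin (π x) / (π x)`. -/
def nsinc (x : ℝ) : ℝ := Real.sin (Real.pi * x) / (Real.pi * x)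

/-- The confluent hypergeometric function `₁F₁(a; b; x)`. -/
def hyp1F1 (a b x : ℝ) : ℝ :=
  ∑' n : ℕ, (ascPochhammer ℝ n).eval a / (ascPochhammer ℝ n).eval b * x ^ n / (n.factorial : ℝ)

/-- The Meijer function `G^{2,1}_{2,2}(z | a₁, a₂; b₁, b₂)` for `z > 0` and
`a₁ - 1 < min b₁ b₂`, as its Mellin-Barnes integral
`(1 / 2πi) ∫ Γ(b₁ - s) Γ(b₂ - s) Γ(1 - a₁ + s) / Γ(a₂ - s) z ^ s ds`. The contour is the vertical
line through the midpoint between `a₁ - 1` and `min b₁ b₂`; it separates the poles of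
`Γ(1 - a₁ + s)` from those of `Γ(b₁ - s) Γ(b₂ - s)`. -/
def meijerG2122 (a₁ a₂ b₁ b₂ z : ℝ) : ℝ :=
  ((1 / (2 * Real.pi) : ℂ) * ∫ t : ℝ,
    let s : ℂ := (((a₁ - 1 + min b₁ b₂) / 2 : ℝ) : ℂ) + (t : ℂ) * Complex.I
    Complex.Gamma (b₁ - s) * Complex.Gamma (b₂ - s) * Complex.Gamma (1 - a₁ + s) /
      Complex.Gamma (a₂ - s) * (z : ℂ) ^ s).re

/-- The Laguerre polynomial of degree `M`. -/
def laguerre (M : ℕ) : Polynomial ℝ :=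
  ∑ k ∈ Finset.range (M + 1),
    Polynomial.C ((M.choose k : ℝ) * (-1) ^ k / (k.factorial : ℝ)) * Polynomial.X ^ k

/-- The abscissae of the Gauss-Laguerre quadrature of order `M`. -/
def laguerreNodes (M : ℕ) : Finset ℝ := (laguerre M).roots.toFinset

/-- The weight of the Gauss-Laguerre quadrature of order `M` at the abscissa `x`: the integral
against `exp (-t)` of the Lagrange basis polynomial of `x`. -/
def laguerreWeight (M : ℕ) (x : ℝ) : ℝ :=
  ∫ t in Ioi (0 : ℝ), (Lagrange.basis (laguerreNodes M) id x).eval t * Real.exp (-t)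

/-- `g_i(z) = (1 / z) (1 - (1 + z) ^ (-i))`, for real `i > 0`. -/
def gKer (i z : ℝ) : ℝ := 1 / z * (1 - 1 / (1 + z) ^ i)

/-! ### The two fading models -/

/-- A `κ-μ` or `η-μ` fading model for the power `G`, with mean power `w`. -/
inductive Fading where
  | kappaMu (κ μ w : ℝ) : Fading
  | etaMu (η μ w : ℝ) : Fading

/-- `h = (2 + η⁻¹ + η) / 4`. -/
def hPar (η : ℝ) : ℝ := (2 + η⁻¹ + η) / 4

/-- `H = (η⁻¹ - η) / 4`. -/
def HPar (η : ℝ) : ℝ := (η⁻¹ - η) / 4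

/-- The probability density of a `κ-μ` power at `x > 0`. -/
def kappaMuPDF (κ μ w x : ℝ) : ℝ :=
  μ / (κ ^ ((μ - 1) / 2) * Real.exp (μ * κ)) * ((1 + κ) / w) ^ ((μ + 1) / 2) * x ^ ((μ - 1) / 2) *
    Real.exp (-(μ * (1 + κ) / w * x)) *
    besselI (μ - 1) (2 * μ * Real.sqrt (κ * (1 + κ) / w * x))

/-- The probability density of an `η-μ` power at `x > 0`. The quotient
`I_{μ-1/2}(2 μ H x / w) / H ^ (μ - 1/2)` is even in `H` and has a removable singularity at `H = 0`
(that is `η = 1`), so `besselIQuot` is used for it; see `etaMuPDF_eq`. -/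
def etaMuPDF (η μ w x : ℝ) : ℝ :=
  2 * Real.sqrt Real.pi * μ ^ (μ + 1 / 2) * hPar η ^ μ / (Real.Gamma μ * w ^ (μ + 1 / 2)) *
    x ^ (μ - 1 / 2) * Real.exp (-(2 * μ * hPar η * x / w)) *
    besselIQuot (μ - 1 / 2) (2 * μ * x / w) (HPar η)

theorem etaMuPDF_eq {η μ w x : ℝ} (hη : 0 < η) (hη1 : η < 1) (hμ : 0 < μ) (hw : 0 < w)
    (hx : 0 < x) :
    etaMuPDF η μ w x =
      2 * Real.sqrt Real.pi * μ ^ (μ + 1 / 2) * hPar η ^ μ /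
          (Real.Gamma μ * HPar η ^ (μ - 1 / 2) * w ^ (μ + 1 / 2)) *
        x ^ (μ - 1 / 2) * Real.exp (-(2 * μ * hPar η * x / w)) *
        besselI (μ - 1 / 2) (2 * μ * HPar η * x / w) := by
  have hH : 0 < HPar η := by
    have h1 : 1 < η⁻¹ := (one_lt_inv₀ hη).2 hη1
    unfold HPar
    linarith
  have hc : 0 < 2 * μ * x / w := by positivity
  have e : 2 * μ * HPar η * x / w = (2 * μ * x / w) * HPar η := by ring
  have hp : HPar η ^ (μ - 1 / 2) ≠ 0 := (Real.rpow_pos_of_pos hH _).ne'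
  rw [e, besselI_eq hc hH]
  unfold etaMuPDF
  have hG : Real.Gamma μ ≠ 0 := (Real.Gamma_pos_of_pos hμ).ne'
  have hw' : w ^ (μ + 1 / 2) ≠ 0 := (Real.rpow_pos_of_pos hw _).ne'
  field_simp

namespace Fading

/-- All the parameters of the fading model are positive. -/
def Valid : Fading → Prop
  | kappaMu κ μ w => 0 < κ ∧ 0 < μ ∧ 0 < w
  | etaMu η μ w => 0 < η ∧ 0 < μ ∧ 0 < w

/-- The probability density of the power. -/
def pdf : Fading → ℝ → ℝ
  | kappaMu κ μ w => kappaMuPDF κ μ w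
  | etaMu η μ w => etaMuPDF η μ w

/-- The distribution of the power. -/
def law (F : Fading) : Measure ℝ :=
  (volume.restrict (Ioi 0)).withDensity fun x => ENNReal.ofReal (F.pdf x)

/-- The coefficients of the series for the mean: `(μκ)^n / (n! e^{μκ})` for `κ-μ` and
`a_n = binom(n+μ-1, n) H^{2n} / h^{μ+2n}` for `η-μ`. -/
def weight : Fading → ℕ → ℝ
  | kappaMu κ μ _, n => (μ * κ) ^ n / ((n.factorial : ℝ) * Real.exp (μ * κ))
  | etaMu η μ _, n =>
      genBinom (n + μ - 1) n * (HPar η ^ (2 * n) / hPar η ^ (μ + 2 * (n : ℝ)))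

/-- The indices of the kernels in the series: `μ + n` for `κ-μ` and `2μ + 2n` for `η-μ`. -/
def order : Fading → ℕ → ℝ
  | kappaMu _ μ _, n => μ + n
  | etaMu _ μ _, n => 2 * μ + 2 * n

/-- `w / (μ (1 + κ))` for `κ-μ` and `w / (2 μ h)` for `η-μ`. -/
def scale : Fading → ℝ
  | kappaMu κ μ w => w / (μ * (1 + κ))
  | etaMu η μ w => w / (2 * μ * hPar η)

end Fading

/-! ### The network model -/

/-- The plane in which the nodes live. -/
abbrev Plane := EuclideanSpace ℝ (Fin 2)

/-- The number of indices `i` with `X i ω ∈ B`. -/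
def count {Ω : Type*} (X : ℕ → Ω → Plane) (B : Set Plane) (ω : Ω) : ℝ≥0∞ :=
  ∑' i, B.indicator (fun _ => (1 : ℝ≥0∞)) (X i ω)

/-- The points `X 0, X 1, …` enumerate a homogeneous Poisson point process on the plane with
intensity `lam`. -/
structure IsPPP {Ω : Type*} [MeasurableSpace Ω] (P : Measure Ω) (X : ℕ → Ω → Plane)
    (lam : ℝ) : Prop where
  count_law : ∀ B : Set Plane, MeasurableSet B → volume B < ∞ →
    HasLaw (count X B)
      ((poissonMeasure (lam * (volume B).toReal).toNNReal).map (fun n : ℕ => (n : ℝ≥0∞))) P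
  count_indep : ∀ (n : ℕ) (B : Fin n → Set Plane), (∀ k, MeasurableSet (B k)) →
    Pairwise (fun k l => Disjoint (B k) (B l)) → iIndepFun (fun k => count X (B k)) P

/-- The parameters of the overlaid network: intensities `lamB` of the base stations and `lam` of
the UEs, probability `q` of being a potential D2D UE, D2D distance parameter `ξ`, mode selection
threshold `θ`, path-loss exponents `τc`, `τd`, ALOHA transmit probability `ε`, spectrum partition
factor `β`, noise power `N₀`, and the fading models of the intended (`fadC`, `fadD`) and the
interfering (`fadIC`, `fadID`) channels of the cellular and the D2D link. -/
structure Params where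
  (lamB lam q ξ θ τc τd ε β N₀ : ℝ)
  (fadC fadIC fadD fadID : Fading)

/-- The standing assumptions on the parameters. -/
structure Params.Valid (p : Params) : Prop where
  lamB_pos : 0 < p.lamB
  lam_pos : 0 < p.lam
  q_mem : p.q ∈ Icc (0 : ℝ) 1
  ξ_pos : 0 < p.ξ
  θ_nonneg : 0 ≤ p.θ
  τc_gt : 2 < p.τc
  τd_gt : 2 < p.τd
  ε_mem : p.ε ∈ Icc (0 : ℝ) 1
  β_mem : p.β ∈ Icc (0 : ℝ) 1
  N₀_pos : 0 < p.N₀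
  fadC_valid : p.fadC.Valid
  fadIC_valid : p.fadIC.Valid
  fadD_valid : p.fadD.Valid
  fadID_valid : p.fadID.Valid

/-- The distribution of the D2D link length, with density `2 π ξ x exp (-ξ π x²)` on `x ≥ 0`. -/
def lenLawD (ξ : ℝ) : Measure ℝ :=
  (volume.restrict (Ici 0)).withDensity fun x =>
    ENNReal.ofReal (2 * Real.pi * ξ * x * Real.exp (-(ξ * Real.pi * x ^ 2)))

/-- The cell radius `R = √(1 / (π λ_b))`. -/
def Params.R (p : Params) : ℝ := Real.sqrt (1 / (Real.pi * p.lamB))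

/-- The distribution of the cellular link length, with density `2 x / R²` on `[0, R]`. -/
def Params.lenLawC (p : Params) : Measure ℝ :=
  (volume.restrict (Icc 0 p.R)).withDensity fun x => ENNReal.ofReal (2 * x / p.R ^ 2)

/-- The intensity `λ_c = ((1 - q) + q P(L_d > θ)) λ` of the UEs operating in cellular mode. -/
def Params.lamC (p : Params) : ℝ :=
  ((1 - p.q) + p.q * (lenLawD p.ξ).real (Ioi p.θ)) * p.lam

/-- The random objects of the network, as seen by a typical receiver at the origin.

* `ueLoc i`, `ueD2D i`, `ueLen i`, `ueTx i`, `ueFad i`: location of the `i`-th UE, whether it is a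
  potential D2D UE, its D2D link length, whether ALOHA lets it transmit, and the fading of its
  channel to the typical D2D receiver;
* `cellLoc j`, `cellLen j`, `cellFad j`: location of the `j`-th active cellular transmitter (only
  those outside of the typical cell interfere), its link length, and the fading of its channel
  to the typical base station;
* `len0`, `tx0`, `W_c`, `W_d`: D2D link length of the typical potential D2D UE, whether ALOHA lets
  it transmit, and the received power of the intended link in cellular and in D2D mode (by channel
  inversion, the received power is the fading coefficient). -/
structure Network (Ω : Type*) where
  ueLoc : ℕ → Ω → Plane
  ueD2D : ℕ → Ω → Bool
  ueLen : ℕ → Ω → ℝ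
  ueTx : ℕ → Ω → Bool
  ueFad : ℕ → Ω → ℝ
  cellLoc : ℕ → Ω → Plane
  cellLen : ℕ → Ω → ℝ
  cellFad : ℕ → Ω → ℝ
  len0 : Ω → ℝ
  tx0 : Ω → Bool
  W_c : Ω → ℝ
  W_d : Ω → ℝ

/-- Labels for the independent sources of randomness. -/
inductive Source where
  | ueLoc | ueD2D (i : ℕ) | ueLen (i : ℕ) | ueTx (i : ℕ) | ueFad (i : ℕ)
  | cellLoc | cellLen (j : ℕ) | cellFad (j : ℕ)
  | len0 | tx0 | W_c | W_d

/-- The space in which a source takes its values. -/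
abbrev Source.Val : Source → Type
  | .ueLoc => ℕ → Plane
  | .cellLoc => ℕ → Plane
  | .ueD2D _ => Bool
  | .ueTx _ => Bool
  | .tx0 => Bool
  | .ueLen _ => ℝ
  | .ueFad _ => ℝ
  | .cellLen _ => ℝ
  | .cellFad _ => ℝ
  | .len0 => ℝ
  | .W_c => ℝ
  | .W_d => ℝ

instance Source.measurableSpaceVal : (s : Source) → MeasurableSpace s.Val
  | .ueLoc => inferInstanceAs (MeasurableSpace (ℕ → Plane))
  | .cellLoc => inferInstanceAs (MeasurableSpace (ℕ → Plane))
  | .ueD2D _ => inferInstanceAs (MeasurableSpace Bool)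
  | .ueTx _ => inferInstanceAs (MeasurableSpace Bool)
  | .tx0 => inferInstanceAs (MeasurableSpace Bool)
  | .ueLen _ => inferInstanceAs (MeasurableSpace ℝ)
  | .ueFad _ => inferInstanceAs (MeasurableSpace ℝ)
  | .cellLen _ => inferInstanceAs (MeasurableSpace ℝ)
  | .cellFad _ => inferInstanceAs (MeasurableSpace ℝ)
  | .len0 => inferInstanceAs (MeasurableSpace ℝ)
  | .W_c => inferInstanceAs (MeasurableSpace ℝ)
  | .W_d => inferInstanceAs (MeasurableSpace ℝ)

namespace Network

variable {Ω : Type*}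

/-- The sources of randomness of a network. -/
def source (S : Network Ω) : (s : Source) → Ω → s.Val
  | .ueLoc => fun ω i => S.ueLoc i ω
  | .cellLoc => fun ω j => S.cellLoc j ω
  | .ueD2D i => S.ueD2D i
  | .ueTx i => S.ueTx i
  | .tx0 => S.tx0
  | .ueLen i => S.ueLen i
  | .ueFad i => S.ueFad i
  | .cellLen j => S.cellLen j
  | .cellFad j => S.cellFad j
  | .len0 => S.len0
  | .W_c => S.W_c
  | .W_d => S.W_d

/-- The random objects have the distributions of the model: two independent Poisson processes
with independent marks, and an independent typical link. -/
structure IsModel [MeasurableSpace Ω] (S : Network Ω) (P : Measure Ω) (p : Params) : Prop where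
  measurable : ∀ s, Measurable (S.source s)
  indep : iIndepFun S.source P
  ueLoc_ppp : IsPPP P S.ueLoc p.lam
  ueD2D_prob : ∀ i, P {ω | S.ueD2D i ω = true} = ENNReal.ofReal p.q
  ueLen_law : ∀ i, HasLaw (S.ueLen i) (lenLawD p.ξ) P
  ueTx_prob : ∀ i, P {ω | S.ueTx i ω = true} = ENNReal.ofReal p.ε
  ueFad_law : ∀ i, HasLaw (S.ueFad i) p.fadID.law P
  cellLoc_ppp : IsPPP P S.cellLoc p.lamB
  cellLen_law : ∀ j, HasLaw (S.cellLen j) p.lenLawC P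
  cellFad_law : ∀ j, HasLaw (S.cellFad j) p.fadIC.law P
  len0_law : HasLaw S.len0 (lenLawD p.ξ) P
  tx0_prob : P {ω | S.tx0 ω = true} = ENNReal.ofReal p.ε
  W_c_law : HasLaw S.W_c p.fadC.law P
  W_d_law : HasLaw S.W_d p.fadD.law P

variable (S : Network Ω) (p : Params)

open Classical in
/-- The interference at the typical D2D receiver: it comes from the transmitting UEs in D2D mode
(potential D2D UEs with link length at most `θ`), with transmit power `L ^ τ_d`. -/
def interfD (ω : Ω) : ℝ≥0∞ :=
  ∑' i, if S.ueD2D i ω = true ∧ S.ueLen i ω ≤ p.θ ∧ S.ueTx i ω = true then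
    ENNReal.ofReal (S.ueLen i ω ^ p.τd * S.ueFad i ω * ‖S.ueLoc i ω‖ ^ (-p.τd)) else 0

open Classical in
/-- The interference at the typical base station: it comes from the active cellular transmitters
outside of the cell `B(0, R)`, with transmit power `L ^ τ_c`. -/
def interfC (ω : Ω) : ℝ≥0∞ :=
  ∑' j, if S.cellLoc j ω ∉ Metric.ball (0 : Plane) p.R then
    ENNReal.ofReal (S.cellLen j ω ^ p.τc * S.cellFad j ω * ‖S.cellLoc j ω‖ ^ (-p.τc)) else 0

/-- The other UEs in the typical cell that operate in cellular mode. -/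
def rivals (ω : Ω) : Set ℕ :=
  {i | S.ueLoc i ω ∈ Metric.ball (0 : Plane) p.R ∧ (S.ueD2D i ω = false ∨ p.θ < S.ueLen i ω)}

/-- The number of UEs in cellular mode in the typical cell, the typical UE included. -/
def numCell (ω : Ω) : ℕ := 1 + (S.rivals p ω).ncard

/-- The SINR of the cellular link. -/
def sinrC (ω : Ω) : ℝ := S.W_c ω / ((S.interfC p ω).toReal + p.N₀)

/-- The SINR of the D2D link. -/
def sinrD (ω : Ω) : ℝ := S.W_d ω / ((S.interfD p ω).toReal + p.N₀)

/-- The rate of a cellular UE: the `N` UEs in cellular mode share the fraction `1 - β` of the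
spectrum equally. -/
def rateC (ω : Ω) : ℝ := (1 - p.β) * (1 / (S.numCell p ω : ℝ)) * Real.log (1 + S.sinrC p ω)

/-- The rate of a potential D2D UE in D2D mode: it uses the fraction `β` of the spectrum when ALOHA
lets it transmit. -/
def rateDHat (ω : Ω) : ℝ :=
  p.β * (if S.tx0 ω = true then Real.log (1 + S.sinrD p ω) else 0)

open Classical in
/-- The rate of a potential D2D UE: it is in D2D mode if its link length is at most `θ`, and in
cellular mode otherwise. -/
def rateD (ω : Ω) : ℝ := if S.len0 ω ≤ p.θ then S.rateDHat p ω else S.rateC p ω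

end Network

/-! ### Laplace transforms and the evaluation of the mean -/

/-- The Laplace transform `E[exp (-s I)]` of the interference. -/
def laplace {Ω : Type*} [MeasurableSpace Ω] (P : Measure Ω) (I : Ω → ℝ≥0∞) (s : ℝ) : ℝ :=
  ∫ ω, Real.exp (-(s * (I ω).toReal)) ∂P

/-- The evaluation of `E[log (1 + W / (I + N₀))]` for an intended channel with fading model `F`:
exactly, as a series of integrals, and as the limit of the Gauss-Laguerre quadrature sums as their
order tends to infinity. -/
structure EvaluatesLogMean {Ω : Type*} [MeasurableSpace Ω] (P : Measure Ω) (W : Ω → ℝ)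
    (I : Ω → ℝ≥0∞) (N₀ : ℝ) (F : Fading) : Prop where
  integrable : Integrable (fun ω => Real.log (1 + W ω / ((I ω).toReal + N₀))) P
  integrableOn : ∀ n : ℕ, IntegrableOn
    (fun x => gKer (F.order n) (F.scale / N₀ * x) * laplace P I (x / N₀) * Real.exp (-x)) (Ioi 0)
  hasSum : HasSum
    (fun n : ℕ => F.scale / N₀ * (F.weight n * ∫ x in Ioi (0 : ℝ),
      gKer (F.order n) (F.scale / N₀ * x) * laplace P I (x / N₀) * Real.exp (-x)))
    (∫ ω, Real.log (1 + W ω / ((I ω).toReal + N₀)) ∂P)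
  summable : ∀ x : ℝ, 0 < x →
    Summable (fun n : ℕ => F.weight n * gKer (F.order n) (F.scale / N₀ * x))
  nodes_pos : ∀ (M : ℕ), (laguerreNodes M).card = M ∧ ∀ x ∈ laguerreNodes M, 0 < x
  quadrature : Tendsto
    (fun M : ℕ => F.scale / N₀ * ∑ x ∈ laguerreNodes M, ∑' n : ℕ,
      laguerreWeight M x * F.weight n * gKer (F.order n) (F.scale / N₀ * x) *
        laplace P I (x / N₀))
    atTop (𝓝 (∫ ω, Real.log (1 + W ω / ((I ω).toReal + N₀)) ∂P))

/-- The constant `c` in the Laplace transform `exp (-c s ^ δ_d)` of the interference at a D2D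
receiver, where `δ_d = 2 / τ_d` and `ξhat = ξ / γ(2, ξ π θ²)`. -/
def Params.cD (p : Params) : ℝ :=
  let δ := 2 / p.τd
  let ξhat := p.ξ / lowerGamma 2 (p.ξ * Real.pi * p.θ ^ 2)
  match p.fadID with
  | .kappaMu κ μ w =>
      p.q * p.ε * p.lam / (ξhat * Real.exp (μ * κ)) * (hyp1F1 (μ + δ) μ (μ * κ) / nsinc δ) *
        (w / ((1 + κ) * μ)) ^ δ * genBinom (μ + δ - 1) δ
  | .etaMu η μ w =>
      p.q * p.ε * p.lam / (ξhat * hPar η ^ μ) *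
        (ordinaryHypergeometric (μ + δ / 2 + 1 / 2) (μ + δ / 2) (μ + 1 / 2)
          ((HPar η / hPar η) ^ 2) / nsinc δ) *
        (w / (2 * μ * hPar η)) ^ δ * genBinom (2 * μ + δ - 1) δ

/-- The `n`-th term of the series in `φ(r)`, without the factor in front of the series, where
`δ_c = 2 / τ_c`. -/
def Params.φTerm (p : Params) (s r : ℝ) (n : ℕ) : ℝ :=
  let δ := 2 / p.τc
  match p.fadIC with
  | .kappaMu κ μ w =>
      (μ * κ) ^ n / ((n.factorial : ℝ) * Real.Gamma (μ + n)) *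
        meijerG2122 (1 - δ) 1 0 (n + μ - δ)
          (μ * (1 + κ) * (Real.pi * p.lamB) ^ (1 / δ) * r ^ p.τc / (s * w))
  | .etaMu η μ w =>
      (2 : ℝ) ^ (-2 * (n : ℝ) - 2 * μ) / ((n.factorial : ℝ) * Real.Gamma (μ + n + 1 / 2)) *
        (HPar η / hPar η) ^ (2 * n) *
        meijerG2122 (1 - δ) 1 0 (2 * n + 2 * μ - δ)
          (2 * μ * hPar η * (Real.pi * p.lamB) ^ (1 / δ) * r ^ p.τc / (s * w))

/-- The function `φ(r)` in the Laplace transform `exp (-2 π λ_b ∫_R^∞ (1 - φ(r)) r dr)`, at `s`, of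
the interference at a base station. -/
def Params.φ (p : Params) (s r : ℝ) : ℝ :=
  let δ := 2 / p.τc
  (match p.fadIC with
    | .kappaMu κ μ w =>
        Real.pi * p.lamB * r ^ 2 * δ / Real.exp (μ * κ) * (μ * (1 + κ) / (s * w)) ^ δ
    | .etaMu η μ w =>
        2 * Real.pi ^ (3 / 2 : ℝ) * p.lamB * r ^ 2 * δ / (Real.Gamma μ * hPar η ^ μ) *
          (2 * μ * hPar η / (s * w)) ^ δ) *
  ∑' n : ℕ, p.φTerm s r n

end D2D

end

/-! Three mechanisms carry the theorem.

Poisson sums. For a Poisson process with independent marks, `E exp(-∑ f(X_i, M_i)) = exp(-λ ∬ (1 -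
e^{-f}))` (`IsPPP.lintegral_negExp_tsum_mark`). This is proved in `[0, ∞]` with `e^{-∞} = 0`, so no
sum has to be known to converge beforehand. Taking `f` to be `s` times the contribution of one
transmitter gives the Laplace transforms of both interferences; taking `f` to be a multiple of the
indicator of a rival shows that `K = N - 1` has the transform of a Poisson variable with mean `λ_c /
λ_b`. Almost sure finiteness follows by `s → 0`, because `E e^{-sI} ≤ P(I < ∞)`. The factor of `R_c`
is `E[1 / (1 + K)]`, which is read off from `1 / (1 + K) = ∫ e^{-u} e^{-uK} du`; independence of the
sources of randomness factorises the rates.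

Fading. Expanding the Bessel function in its power series exhibits both densities as mixtures of
Gamma densities, with weights `Fading.weight` and shapes `Fading.order` (`Fading.Valid.hasSum_pdf`).
Hence `E e^{-uG}` and `E G^δ` are explicit series. The moment of order `δ = 2 / τ_d` sums to a
hypergeometric function and yields the constant `cD`. For `I_c` the average over the link length
turns `(1 + A l^τ)^{-k}` into an incomplete Beta function, and Mellin inversion identifies the
Meijer function with that Beta function (`meijerG2122_eq`).

The mean of the logarithm. Write `log(1 + W / (I + N₀)) = ∫_0^W dt / (t + I + N₀)`. On the region `0
< t ≤ W` with the measure `ρ = P ⊗ dt` and with `Y = (t + I) / N₀`, this says `N₀ E log = ∫ 1 / (1 +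
Y) dρ`, and `1 / (1 + Y) = ∫ e^{-xY} e^{-x} dx`. Since `W` and `I` are independent, `∫ e^{-xY} dρ`
is the series of the kernels `gKer` times `L_I(x / N₀)`. The exact formula is then Tonelli's
theorem. The quadrature sum of order `M` is the `ρ`-integral of the Gauss-Laguerre rule applied to
`x ↦ e^{-xY}`, so its limit follows by dominated convergence from two facts on the rule: it
converges for every decaying exponential (`tendsto_quadrature_exp`), and its weights are nonnegative
with sum at most `1`. -/

noncomputable section

namespace D2D

/-! ### The Laplace functional of a Poisson process, without and with marks. -/

section

/-- The function `y ↦ e^{-y}` on `[0, ∞]`, with `e^{-∞} = 0`. -/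
def negExp (y : ℝ≥0∞) : ℝ≥0∞ := EReal.exp (-(y : EReal))

lemma negExp_eq_inv (y : ℝ≥0∞) : negExp y = (EReal.exp (y : EReal))⁻¹ := EReal.exp_neg _

@[simp] lemma negExp_zero : negExp 0 = 1 := by simp [negExp]

@[simp] lemma negExp_top : negExp ∞ = 0 := by simp [negExp]

lemma negExp_ofReal {x : ℝ} (hx : 0 ≤ x) :
    negExp (ENNReal.ofReal x) = ENNReal.ofReal (Real.exp (-x)) := by
  rw [negExp, EReal.coe_ennreal_ofReal, max_eq_left hx, ← EReal.coe_neg, EReal.exp_coe]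

lemma negExp_le_one (y : ℝ≥0∞) : negExp y ≤ 1 := by
  rw [negExp, EReal.exp_le_one_iff, EReal.neg_le, neg_zero]
  exact EReal.coe_ennreal_nonneg y

lemma negExp_add (a b : ℝ≥0∞) : negExp (a + b) = negExp a * negExp b := by
  have h : ∀ c : ℝ≥0∞, EReal.exp (c : EReal) ≠ 0 := fun c => by simp
  rw [negExp_eq_inv, negExp_eq_inv, negExp_eq_inv, EReal.coe_ennreal_add, EReal.exp_add,
    ENNReal.mul_inv (Or.inl (h a)) (Or.inr (h b))]

lemma negExp_sum {ι : Type*} (s : Finset ι) (f : ι → ℝ≥0∞) :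
    negExp (∑ i ∈ s, f i) = ∏ i ∈ s, negExp (f i) := by
  classical
  induction s using Finset.induction_on with
  | empty => simp
  | insert a s ha ih => rw [Finset.sum_insert ha, Finset.prod_insert ha, negExp_add, ih]

lemma continuous_negExp : Continuous negExp :=
  ENNReal.continuous_exp.comp (continuous_neg.comp continuous_coe_ennreal_ereal)

lemma measurable_negExp : Measurable negExp := continuous_negExp.measurable

lemma antitone_negExp : Antitone negExp := fun a b h => by
  unfold negExp
  rw [EReal.exp_le_exp_iff, EReal.neg_le_neg_iff]
  exact_mod_cast h

/-- The inverse of `negExp` on `[0, 1]`. -/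
def negLog (v : ℝ≥0∞) : ℝ≥0∞ := (-(ENNReal.log v)).toENNReal

lemma negExp_negLog {v : ℝ≥0∞} (hv : v ≤ 1) : negExp (negLog v) = v := by
  have h : 0 ≤ -(ENNReal.log v) := by
    rw [EReal.neg_nonneg]
    simpa using hv
  rw [negExp, negLog, EReal.coe_toENNReal h, neg_neg, ENNReal.exp_log]

lemma measurable_negLog : Measurable negLog := by
  have := ENNReal.measurable_log
  unfold negLog
  fun_prop

lemma tendsto_prod_negExp (f : ℕ → ℝ≥0∞) :
    Tendsto (fun n => ∏ i ∈ Finset.range n, negExp (f i)) atTop (𝓝 (negExp (∑' i, f i))) := by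
  simp_rw [← negExp_sum]
  exact (continuous_negExp.tendsto _).comp ENNReal.summable.hasSum.tendsto_sum_nat

lemma lintegral_poissonMeasure (r : ℝ≥0) (f : ℕ → ℝ≥0∞) :
    ∫⁻ n, f n ∂(poissonMeasure r) =
      ∑' n, ENNReal.ofReal (Real.exp (-r) * r ^ n / (n.factorial : ℝ)) * f n := by
  rw [lintegral_countable']
  simp_rw [poissonMeasure_singleton, mul_comm]

/-- The Laplace transform of the Poisson distribution. -/
lemma lintegral_negExp_mul_poissonMeasure (r : ℝ≥0) {c : ℝ} (hc : 0 ≤ c) :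
    ∫⁻ n : ℕ, negExp (ENNReal.ofReal c * n) ∂(poissonMeasure r) =
      negExp (r * (1 - negExp (ENNReal.ofReal c))) := by
  rw [lintegral_poissonMeasure]
  have h1 : ∀ n : ℕ, ENNReal.ofReal (Real.exp (-r) * r ^ n / (n.factorial : ℝ)) *
      negExp (ENNReal.ofReal c * n) =
        ENNReal.ofReal (Real.exp (-r) * ((r * Real.exp (-c)) ^ n / (n.factorial : ℝ))) := by
    intro n
    rw [← ENNReal.ofReal_natCast, ← ENNReal.ofReal_mul hc, negExp_ofReal (by positivity),
      ← ENNReal.ofReal_mul (by positivity)]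
    congr 1
    rw [mul_pow, ← Real.exp_nat_mul]
    ring_nf
  have hs := (NormedSpace.expSeries_div_hasSum_exp (r * Real.exp (-c))).mul_left (Real.exp (-r))
  simp_rw [h1]
  rw [← ENNReal.ofReal_tsum_of_nonneg (fun n => by positivity) hs.summable, hs.tsum_eq,
    ← Real.exp_eq_exp_ℝ, negExp_ofReal hc, ← ENNReal.ofReal_one,
    ← ENNReal.ofReal_sub _ (Real.exp_nonneg _), ← ENNReal.ofReal_coe_nnreal,
    ← ENNReal.ofReal_mul r.coe_nonneg, negExp_ofReal, ← Real.exp_add]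
  · congr 2
    ring
  · exact mul_nonneg r.coe_nonneg (sub_nonneg.2 (Real.exp_le_one_iff.2 (neg_nonpos.2 hc)))


/-- `IsPPP` only speaks of counts; a simple function is the bridge from counts to sums over the
points. -/
lemma tsum_simpleFunc_eq_sum_count {Ω : Type*} {X : ℕ → Ω → Plane}
    (g : SimpleFunc Plane ℝ≥0∞) (ω : Ω) :
    ∑' i, g (X i ω) = ∑ c ∈ g.range, c * count X (g ⁻¹' {c}) ω := by
  classical
  have h : ∀ x, g x = ∑ c ∈ g.range, c * (g ⁻¹' {c}).indicator (fun _ => (1 : ℝ≥0∞)) x := by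
    intro x
    rw [Finset.sum_eq_single (g x)]
    · simp
    · intro c _ hc
      simp [indicator, hc.symm]
    · intro hx
      exact absurd (SimpleFunc.mem_range_self g x) hx
  simp_rw [h, count, ← ENNReal.tsum_mul_left]
  exact Summable.tsum_finsetSum fun _ _ => ENNReal.summable

variable {Ω : Type*} [MeasurableSpace Ω] {P : Measure Ω} {X : ℕ → Ω → Plane} {lam : ℝ}

lemma measurable_count (hX : ∀ i, Measurable (X i)) {B : Set Plane} (hB : MeasurableSet B) :
    Measurable (count X B) := by
  unfold count
  refine Measurable.tsum fun i => ?_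
  exact (measurable_const.indicator hB).comp (hX i)

lemma IsPPP.lintegral_negExp_mul_count (h : IsPPP P X lam) {B : Set Plane} (hB : MeasurableSet B)
    (hBv : volume B < ∞) (hlam : 0 ≤ lam) {c : ℝ≥0∞} (hc : c ≠ ∞) :
    ∫⁻ ω, negExp (c * count X B ω) ∂P =
      negExp (ENNReal.ofReal lam * ((1 - negExp c) * volume B)) := by
  have hm : Measurable fun y : ℝ≥0∞ => negExp (c * y) :=
    measurable_negExp.comp (measurable_const.mul measurable_id)
  have := (h.count_law B hB hBv).lintegral_comp hm.aemeasurable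
  rw [this, lintegral_map hm (by fun_prop)]
  conv_lhs => rw [← ENNReal.ofReal_toReal hc]
  rw [lintegral_negExp_mul_poissonMeasure _ ENNReal.toReal_nonneg, ENNReal.ofReal_toReal hc]
  congr 1
  change ENNReal.ofReal _ * _ = _
  rw [ENNReal.ofReal_mul hlam, ENNReal.ofReal_toReal hBv.ne]
  ring

/-- The level sets of `g` are disjoint, so their counts are independent Poisson variables and the
expectation of the exponential is a product of Poisson Laplace transforms. -/
lemma IsPPP.lintegral_negExp_tsum_simpleFunc (h : IsPPP P X lam) (hX : ∀ i, Measurable (X i))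
    (hlam : 0 ≤ lam) (g : SimpleFunc Plane ℝ≥0∞) (hg : ∀ x, g x ≠ ∞)
    (hgv : ∀ c, c ≠ 0 → volume (g ⁻¹' {c}) < ∞) :
    ∫⁻ ω, negExp (∑' i, g (X i ω)) ∂P =
      negExp (ENNReal.ofReal lam * ∫⁻ x, 1 - negExp (g x)) := by
  classical
  have hmB : ∀ c, MeasurableSet (g ⁻¹' {c}) := fun c => g.measurableSet_fiber c
  have hind : iIndepFun (fun c : g.range => count X (g ⁻¹' {(c : ℝ≥0∞)})) P := by
    have e := g.range.equivFin
    have := h.count_indep g.range.card (fun k => g ⁻¹' {((e.symm k : g.range) : ℝ≥0∞)})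
      (fun k => hmB _) (fun k l hkl => Disjoint.preimage _ (by
        simpa using fun h' => hkl (e.symm.injective (Subtype.ext h'))))
    have := this.precomp e.injective
    simpa using this
  have hind2 := hind.comp (fun c y => negExp ((c : ℝ≥0∞) * y))
    (fun c => measurable_negExp.comp (measurable_const.mul measurable_id))
  have hprod := lintegral_prod_eq_prod_lintegral_of_indepFun Finset.univ _ hind2
    (fun c => measurable_negExp.comp (measurable_const.mul (measurable_count hX (hmB _))))
  simp only [Function.comp_apply] at hprod
  simp_rw [tsum_simpleFunc_eq_sum_count, negExp_sum]
  rw [lintegral_congr fun ω => (Finset.prod_coe_sort g.range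
    (fun c => negExp (c * count X (g ⁻¹' {c}) ω))).symm, hprod,
    Finset.prod_coe_sort g.range (fun c => ∫⁻ ω, negExp (c * count X (g ⁻¹' {c}) ω) ∂P)]
  have hfac : ∀ c ∈ g.range, ∫⁻ ω, negExp (c * count X (g ⁻¹' {c}) ω) ∂P =
      negExp (ENNReal.ofReal lam * ((1 - negExp c) * volume (g ⁻¹' {c}))) := by
    intro c hc
    -- The level set of `0` may have infinite volume, but its factor is `1` on both sides because `0
    -- * ∞ = 0`.
    rcases eq_or_ne c 0 with rfl | h0
    · have : IsProbabilityMeasure P := hind.isProbabilityMeasure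
      simp
    · obtain ⟨x, rfl⟩ := SimpleFunc.mem_range.1 hc
      exact h.lintegral_negExp_mul_count (hmB _) (hgv _ h0) hlam (hg x)
  rw [Finset.prod_congr rfl hfac, ← negExp_sum, ← Finset.mul_sum,
    ← SimpleFunc.map_lintegral (fun c => 1 - negExp c) g, ← SimpleFunc.lintegral_eq_lintegral]
  rfl

/-- The Laplace functional of a Poisson point process. -/
theorem IsPPP.lintegral_negExp_tsum [IsProbabilityMeasure P] (h : IsPPP P X lam)
    (hX : ∀ i, Measurable (X i)) (hlam : 0 ≤ lam) {f : Plane → ℝ≥0∞} (hf : Measurable f) :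
    ∫⁻ ω, negExp (∑' i, f (X i ω)) ∂P =
      negExp (ENNReal.ofReal lam * ∫⁻ x, 1 - negExp (f x)) := by
  -- The approximations are cut off to growing balls, which makes the nonzero level sets finite in
  -- volume and keeps the sequence increasing to `f`.
  let g : ℕ → SimpleFunc Plane ℝ≥0∞ := fun n =>
    (SimpleFunc.eapprox f n).restrict (Metric.closedBall 0 n)
  have hgx : ∀ n x, g n x = (Metric.closedBall (0 : Plane) n).indicator
      (SimpleFunc.eapprox f n) x := fun n x =>
    congrFun (SimpleFunc.coe_restrict _ Metric.isClosed_closedBall.measurableSet) x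
  have hmono : ∀ x, Monotone fun n => g n x := by
    intro x n m hnm
    simp only [hgx]
    refine (indicator_le_indicator (SimpleFunc.monotone_eapprox f hnm x)).trans ?_
    exact indicator_le_indicator_of_subset
      (Metric.closedBall_subset_closedBall (by exact_mod_cast hnm)) (fun _ => zero_le) x
  have hlim : ∀ x, Tendsto (fun n => g n x) atTop (𝓝 (f x)) := by
    intro x
    refine (SimpleFunc.tendsto_eapprox hf x).congr' ?_
    obtain ⟨N, hN⟩ := exists_nat_ge ‖x‖
    filter_upwards [eventually_ge_atTop N] with n hn
    rw [hgx, indicator_of_mem]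
    simpa using hN.trans (by exact_mod_cast hn)
  have hfin : ∀ n x, g n x ≠ ∞ := by
    intro n x
    rw [hgx]
    by_cases hx : x ∈ Metric.closedBall (0 : Plane) n
    · rw [indicator_of_mem hx]
      exact (SimpleFunc.eapprox_lt_top f n x).ne
    · simp [indicator_of_notMem hx]
  have hvol : ∀ n c, c ≠ 0 → volume (g n ⁻¹' {c}) < ∞ := by
    intro n c hc
    refine (measure_mono fun x hx => ?_).trans_lt
      (measure_closedBall_lt_top (x := (0 : Plane)) (r := n))
    by_contra hx'
    have : g n x = c := hx
    rw [hgx, indicator_of_notMem hx'] at this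
    exact hc this.symm
  have heq := fun n => h.lintegral_negExp_tsum_simpleFunc hX hlam (g n) (hfin n) (hvol n)
  have hsum : ∀ ω, Tendsto (fun n => ∑' i, g n (X i ω)) atTop (𝓝 (∑' i, f (X i ω))) := by
    intro ω
    -- A sum over the points is an integral against the counting measure, so monotone convergence
    -- applies to it.
    have := lintegral_tendsto_of_tendsto_of_monotone (μ := Measure.count)
      (f := fun n i => g n (X i ω)) (F := fun i => f (X i ω))
      (fun n => (measurable_of_countable _).aemeasurable)
      (Eventually.of_forall fun i => hmono _) (Eventually.of_forall fun i => hlim _)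
    simpa [lintegral_count] using this
  have hL : Tendsto (fun n => ∫⁻ ω, negExp (∑' i, g n (X i ω)) ∂P) atTop
      (𝓝 (∫⁻ ω, negExp (∑' i, f (X i ω)) ∂P)) := by
    refine tendsto_lintegral_of_dominated_convergence (fun _ => 1) (fun n => ?_)
      (fun n => Eventually.of_forall fun ω => negExp_le_one _) (by simp)
      (Eventually.of_forall fun ω => (continuous_negExp.tendsto _).comp (hsum ω))
    exact measurable_negExp.comp (Measurable.tsum fun i => (g n).measurable.comp (hX i))
  -- Monotone rather than dominated convergence, since the limit integral may be infinite.
  have hR : Tendsto (fun n => ∫⁻ x, 1 - negExp (g n x)) atTop (𝓝 (∫⁻ x, 1 - negExp (f x))) := by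
    refine lintegral_tendsto_of_tendsto_of_monotone
      (fun n => ((measurable_const.sub (measurable_negExp.comp (g n).measurable))).aemeasurable)
      (Eventually.of_forall fun x n m hnm => tsub_le_tsub_left (antitone_negExp (hmono x hnm)) _)
      (Eventually.of_forall fun x => ?_)
    exact ENNReal.Tendsto.sub tendsto_const_nhds ((continuous_negExp.tendsto _).comp (hlim x))
      (Or.inl ENNReal.one_ne_top)
  refine tendsto_nhds_unique hL ?_
  simp_rw [heq]
  exact (continuous_negExp.tendsto _).comp
    (ENNReal.Tendsto.const_mul hR (Or.inr ENNReal.ofReal_ne_top))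

/-- The probability generating functional of a Poisson point process. -/
theorem IsPPP.lintegral_pgfl [IsProbabilityMeasure P] (h : IsPPP P X lam)
    (hX : ∀ i, Measurable (X i)) (hlam : 0 ≤ lam) {v : Plane → ℝ≥0∞} (hv : Measurable v)
    (hv1 : ∀ x, v x ≤ 1) :
    Tendsto (fun n => ∫⁻ ω, ∏ i ∈ Finset.range n, v (X i ω) ∂P) atTop
      (𝓝 (negExp (ENNReal.ofReal lam * ∫⁻ x, 1 - v x))) := by
  -- Every `v ≤ 1` is `e^{-f}` with `f = negLog v`, where `f = ∞` at the zeros of `v`.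
  have hf : Measurable fun x => negLog (v x) := measurable_negLog.comp hv
  have key := h.lintegral_negExp_tsum hX hlam hf
  simp only [negExp_negLog (hv1 _)] at key
  rw [← key]
  refine tendsto_lintegral_of_dominated_convergence (fun _ => 1) (fun n => ?_)
    (fun n => Eventually.of_forall fun ω => Finset.prod_le_one' fun i _ => hv1 _) (by simp)
    (Eventually.of_forall fun ω => ?_)
  · exact Finset.measurable_prod _ fun i _ => hv.comp (hX i)
  · have := tendsto_prod_negExp fun i => negLog (v (X i ω))
    simpa only [negExp_negLog (hv1 _)] using this

/-- The Laplace functional of a Poisson point process with independent marks. -/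
theorem IsPPP.lintegral_negExp_tsum_mark [IsProbabilityMeasure P] (h : IsPPP P X lam)
    (hX : ∀ i, Measurable (X i)) (hlam : 0 ≤ lam) {E : Type*} [MeasurableSpace E]
    {ν : Measure E} [IsProbabilityMeasure ν] {M : ℕ → Ω → E} (hM : ∀ i, HasLaw (M i) ν P)
    (hMm : ∀ i, Measurable (M i))
    (𝓕 : ℕ → MeasurableSpace Ω) (hXF : ∀ n i, Measurable[𝓕 n] (X i))
    (hMF : ∀ n, ∀ i < n, Measurable[𝓕 n] (M i))
    (hind : ∀ n, Indep (𝓕 n) (MeasurableSpace.comap (M n) inferInstance) P)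
    {f : Plane × E → ℝ≥0∞} (hf : Measurable f) :
    ∫⁻ ω, negExp (∑' i, f (X i ω, M i ω)) ∂P =
      negExp (ENNReal.ofReal lam * ∫⁻ m, ∫⁻ x, 1 - negExp (f (x, m)) ∂volume ∂ν) := by
  let e : Plane × E → ℝ≥0∞ := fun z => negExp (f z)
  have he : Measurable e := measurable_negExp.comp hf
  have he1 : ∀ z, e z ≤ 1 := fun z => negExp_le_one _
  let v : Plane → ℝ≥0∞ := fun x => ∫⁻ m, e (x, m) ∂ν
  have hv : Measurable v := he.lintegral_prod_right'
  have hv1 : ∀ x, v x ≤ 1 := fun x => (lintegral_mono fun m => he1 (x, m)).trans (by simp)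
  -- The marks are integrated out from the last one downwards: `M n` is independent of `𝓕 n`, which
  -- holds all locations and the earlier marks. The weight `w` of the locations absorbs each factor
  -- `v (X n)` that this produces, so the induction must range over all `w`.
  have step : ∀ n, ∀ w : (ℕ → Plane) → ℝ≥0∞, Measurable w →
      ∫⁻ ω, (∏ i ∈ Finset.range n, e (X i ω, M i ω)) * w (fun i => X i ω) ∂P =
        ∫⁻ ω, (∏ i ∈ Finset.range n, v (X i ω)) * w (fun i => X i ω) ∂P := by
    intro n
    induction n with
    | zero => intro w _; simp
    | succ n ih =>
      intro w hw
      -- `U` gathers all that multiplies the factor of `M n`; it is measurable for `𝓕 n` and hence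
      -- independent of that mark.
      let U : Ω → Plane × ℝ≥0∞ := fun ω =>
        (X n ω, (∏ i ∈ Finset.range n, e (X i ω, M i ω)) * w (fun i => X i ω))
      have hUF : Measurable[𝓕 n] U := by
        refine (hXF n n).prodMk (Measurable.mul ?_
          (hw.comp ((@measurable_pi_iff Ω ℕ (fun _ => Plane) (𝓕 n) _ _).2 (hXF n))))
        exact Finset.measurable_prod _ fun i hi =>
          he.comp ((hXF n i).prodMk (hMF n i (Finset.mem_range.1 hi)))
      have hU : Measurable U := by
        refine (hX n).prodMk (Measurable.mul ?_ (hw.comp (measurable_pi_lambda _ hX)))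
        exact Finset.measurable_prod _ fun i hi => he.comp ((hX i).prodMk (hMm i))
      have hi : IndepFun U (M n) P := by
        rw [IndepFun_iff_Indep]
        exact indep_of_indep_of_le_left (hind n) hUF.comap_le
      have hlaw := (indepFun_iff_map_prod_eq_prod_map_map hU.aemeasurable
        (hMm n).aemeasurable).1 hi
      have hF : Measurable fun z : (Plane × ℝ≥0∞) × E => z.1.2 * e (z.1.1, z.2) := by fun_prop
      have hPU : IsProbabilityMeasure (P.map U) := Measure.isProbabilityMeasure_map hU.aemeasurable
      have h1 : ∫⁻ ω, (U ω).2 * e ((U ω).1, M n ω) ∂P = ∫⁻ ω, (U ω).2 * v (U ω).1 ∂P := by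
        have := lintegral_map (μ := P) hF (hU.prodMk (hMm n))
        rw [← this, hlaw, (hM n).map_eq, lintegral_prod _ hF.aemeasurable]
        simp only
        have h2 : ∀ u : Plane × ℝ≥0∞, ∫⁻ m, u.2 * e (u.1, m) ∂ν = u.2 * v u.1 := fun u =>
          lintegral_const_mul _ (he.comp measurable_prodMk_left)
        simp_rw [h2]
        exact lintegral_map (by fun_prop) hU
      calc _ = ∫⁻ ω, (U ω).2 * e ((U ω).1, M n ω) ∂P := by
            refine lintegral_congr fun ω => ?_
            rw [Finset.prod_range_succ]
            ring
        _ = ∫⁻ ω, (∏ i ∈ Finset.range n, e (X i ω, M i ω)) *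
              (w (fun i => X i ω) * v (X n ω)) ∂P := by
            rw [h1]
            refine lintegral_congr fun ω => ?_
            simp only [U]
            ring
        _ = _ := by
            rw [ih (fun x => w x * v (x n)) (hw.mul (hv.comp (measurable_pi_apply n)))]
            refine lintegral_congr fun ω => ?_
            rw [Finset.prod_range_succ]
            ring
  have step1 : ∀ n, ∫⁻ ω, ∏ i ∈ Finset.range n, e (X i ω, M i ω) ∂P =
      ∫⁻ ω, ∏ i ∈ Finset.range n, v (X i ω) ∂P := by
    intro n
    simpa using step n (fun _ => 1) measurable_const
  have hlim := h.lintegral_pgfl hX hlam hv hv1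
  simp_rw [← step1] at hlim
  have hlim2 : Tendsto (fun n => ∫⁻ ω, ∏ i ∈ Finset.range n, e (X i ω, M i ω) ∂P) atTop
      (𝓝 (∫⁻ ω, negExp (∑' i, f (X i ω, M i ω)) ∂P)) := by
    refine tendsto_lintegral_of_dominated_convergence (fun _ => 1) (fun n => ?_)
      (fun n => Eventually.of_forall fun ω => Finset.prod_le_one' fun i _ => he1 _) (by simp)
      (Eventually.of_forall fun ω => tendsto_prod_negExp fun i => f (X i ω, M i ω))
    exact Finset.measurable_prod _ fun i _ => he.comp ((hX i).prodMk (hMm i))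
  rw [tendsto_nhds_unique hlim2 hlim]
  -- As `ν` has mass `1`, the difference `1 - v` is the mean of `1 - e`, and Tonelli exchanges marks
  -- and space.
  have h1v : ∀ x, 1 - v x = ∫⁻ m, 1 - e (x, m) ∂ν := by
    intro x
    have hm : Measurable fun m => e (x, m) := he.comp measurable_prodMk_left
    rw [lintegral_sub hm ((hv1 x).trans_lt ENNReal.one_lt_top).ne
      (Eventually.of_forall fun m => he1 (x, m))]
    simp [v]
  simp_rw [h1v]
  rw [lintegral_lintegral_swap (measurable_const.sub he).aemeasurable]

end

/-! ### The fading laws as mixtures of Gamma laws. -/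

section

lemma Gamma_add_natCast {a : ℝ} (ha : 0 < a) (n : ℕ) :
    Real.Gamma (a + n) = (ascPochhammer ℝ n).eval a * Real.Gamma a := by
  induction n with
  | zero => simp
  | succ n ih =>
    rw [ascPochhammer_succ_right, Polynomial.eval_mul]
    push_cast
    rw [← add_assoc, Real.Gamma_add_one (by positivity), ih]
    simp
    ring

lemma Gamma_natCast_add_pos {a : ℝ} (ha : 0 < a) (n : ℕ) : 0 < Real.Gamma (n + a) :=
  Real.Gamma_pos_of_pos (by positivity)

lemma tendsto_natCast_add_atTop (a : ℝ) : Tendsto (fun n : ℕ => (n : ℝ) + a) atTop atTop :=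
  tendsto_atTop_add_const_right _ _ tendsto_natCast_atTop_atTop

lemma tendsto_natCast_add_div (a b : ℝ) :
    Tendsto (fun n : ℕ => ((n : ℝ) + a) / (n + b)) atTop (𝓝 1) := by
  have h : Tendsto (fun n : ℕ => 1 + (a - b) / ((n : ℝ) + b)) atTop (𝓝 (1 + 0)) :=
    tendsto_const_nhds.add ((tendsto_natCast_add_atTop b).const_div_atTop _)
  rw [add_zero] at h
  refine h.congr' ?_
  filter_upwards [(tendsto_natCast_add_atTop b).eventually_gt_atTop 0] with n hn
  field_simp
  ring

lemma summable_besselI_coeff {a : ℝ} (ha : 0 < a) {y : ℝ} (hy : 0 < y) :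
    Summable fun n : ℕ => 1 / ((n.factorial : ℝ) * Real.Gamma (n + a)) * y ^ n := by
  have hpos : ∀ n : ℕ, 0 < 1 / ((n.factorial : ℝ) * Real.Gamma (n + a)) * y ^ n := fun n => by
    have := Gamma_natCast_add_pos ha n
    positivity
  refine summable_of_ratio_test_tendsto_lt_one zero_lt_one
    (Eventually.of_forall fun n => (hpos n).ne') ?_
  have h : Tendsto (fun n : ℕ => y / ((n : ℝ) + 1) * (1 / ((n : ℝ) + a))) atTop (𝓝 (0 * 0)) :=
    ((tendsto_natCast_add_atTop 1).const_div_atTop y).mul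
      ((tendsto_natCast_add_atTop a).const_div_atTop 1)
  rw [mul_zero] at h
  refine h.congr fun n => ?_
  rw [Real.norm_of_nonneg (hpos _).le, Real.norm_of_nonneg (hpos _).le]
  have hG := Gamma_natCast_add_pos ha n
  have hna : (0 : ℝ) < n + a := by positivity
  have e : Real.Gamma (((n + 1 : ℕ) : ℝ) + a) = (n + a) * Real.Gamma (n + a) := by
    rw [← Real.Gamma_add_one hna.ne']
    congr 1
    push_cast
    ring
  rw [e, Nat.factorial_succ, pow_succ]
  push_cast
  field_simp

lemma lintegral_rpow_mul_exp_neg_mul_Ioi {a b : ℝ} (ha : 0 < a) (hb : 0 < b) :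
    ∫⁻ x in Ioi (0 : ℝ), ENNReal.ofReal (x ^ (a - 1) * Real.exp (-(b * x))) =
      ENNReal.ofReal ((1 / b) ^ a * Real.Gamma a) := by
  have h := Real.integral_rpow_mul_exp_neg_mul_Ioi ha hb
  have hpos : (0 : ℝ) < (1 / b) ^ a * Real.Gamma a := by
    have := Real.Gamma_pos_of_pos ha
    positivity
  rw [← h, ofReal_integral_eq_lintegral_ofReal]
  · refine Integrable.of_integral_ne_zero ?_
    rw [h]
    exact hpos.ne'
  · filter_upwards [ae_restrict_mem measurableSet_Ioi] with x hx
    have : (0 : ℝ) < x := hx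
    positivity

/-- Integration against the Gamma distribution with shape `a` and rate `r`. -/
def gammaLIntegral (a r : ℝ) (g : ℝ → ℝ≥0∞) : ℝ≥0∞ :=
  ∫⁻ x in Ioi (0 : ℝ), ENNReal.ofReal (gammaPDFReal a r x) * g x

lemma gammaPDFReal_of_pos {a r x : ℝ} (hx : 0 < x) :
    gammaPDFReal a r x = r ^ a / Real.Gamma a * x ^ (a - 1) * Real.exp (-(r * x)) := by
  simp [gammaPDFReal, hx.le]

lemma gammaLIntegral_rpow {a r δ : ℝ} (ha : 0 < a) (hr : 0 < r) (hδ : 0 ≤ δ) :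
    gammaLIntegral a r (fun x => ENNReal.ofReal (x ^ δ)) =
      ENNReal.ofReal ((1 / r) ^ δ * (Real.Gamma (a + δ) / Real.Gamma a)) := by
  have hG := Real.Gamma_pos_of_pos ha
  have hG' := Real.Gamma_pos_of_pos (show 0 < a + δ by positivity)
  have e : ∀ x ∈ Ioi (0 : ℝ), ENNReal.ofReal (gammaPDFReal a r x) * ENNReal.ofReal (x ^ δ) =
      ENNReal.ofReal (r ^ a / Real.Gamma a) *
        ENNReal.ofReal (x ^ (a + δ - 1) * Real.exp (-(r * x))) := by
    intro x hx
    have hx : 0 < x := hx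
    rw [gammaPDFReal_of_pos hx, ← ENNReal.ofReal_mul (by positivity),
      ← ENNReal.ofReal_mul (by positivity)]
    congr 1
    rw [show a + δ - 1 = (a - 1) + δ by ring, Real.rpow_add hx]
    ring
  rw [gammaLIntegral, setLIntegral_congr_fun measurableSet_Ioi e,
    lintegral_const_mul _ (by fun_prop), lintegral_rpow_mul_exp_neg_mul_Ioi (by positivity) hr,
    ← ENNReal.ofReal_mul (by positivity)]
  congr 1
  rw [Real.rpow_add (by positivity), one_div, Real.inv_rpow hr.le, Real.inv_rpow hr.le]
  have := Real.rpow_pos_of_pos hr a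
  field_simp

lemma gammaLIntegral_exp {a r u : ℝ} (ha : 0 < a) (hr : 0 < r) (hu : 0 ≤ u) :
    gammaLIntegral a r (fun x => ENNReal.ofReal (Real.exp (-(u * x)))) =
      ENNReal.ofReal ((1 + 1 / r * u) ^ (-a)) := by
  have hG := Real.Gamma_pos_of_pos ha
  have e : ∀ x ∈ Ioi (0 : ℝ),
      ENNReal.ofReal (gammaPDFReal a r x) * ENNReal.ofReal (Real.exp (-(u * x))) =
      ENNReal.ofReal (r ^ a / Real.Gamma a) *
        ENNReal.ofReal (x ^ (a - 1) * Real.exp (-((r + u) * x))) := by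
    intro x hx
    have hx : 0 < x := hx
    rw [gammaPDFReal_of_pos hx, ← ENNReal.ofReal_mul (by positivity),
      ← ENNReal.ofReal_mul (by positivity)]
    congr 1
    rw [show -((r + u) * x) = -(r * x) + -(u * x) by ring, Real.exp_add]
    ring
  rw [gammaLIntegral, setLIntegral_congr_fun measurableSet_Ioi e,
    lintegral_const_mul _ (by fun_prop), lintegral_rpow_mul_exp_neg_mul_Ioi ha (by positivity),
    ← ENNReal.ofReal_mul (by positivity)]
  congr 1
  rw [show (1 : ℝ) + 1 / r * u = (r + u) / r by field_simp, Real.rpow_neg (by positivity),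
    Real.div_rpow (by positivity) hr.le, Real.div_rpow (by positivity) (by positivity),
    Real.one_rpow]
  have := Real.rpow_pos_of_pos hr a
  have := Real.rpow_pos_of_pos (show 0 < r + u by positivity) a
  field_simp

lemma hPar_pos {η : ℝ} (hη : 0 < η) : 0 < hPar η := by
  unfold hPar
  positivity

/-- The identity `h² - H² = h` gives it. This quotient is the limiting ratio of successive `η-μ`
weights when `H ≠ 0`. -/
lemma HPar_div_hPar_sq_lt_one {η : ℝ} (hη : 0 < η) : (HPar η / hPar η) ^ 2 < 1 := by
  have h := hPar_pos hη
  rw [div_pow, div_lt_one (by positivity)]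
  have : hPar η ^ 2 - HPar η ^ 2 = hPar η := by
    unfold hPar HPar
    field_simp
    ring
  linarith

lemma genBinom_natCast {μ : ℝ} (n : ℕ) :
    genBinom (n + μ - 1) n = Real.Gamma (n + μ) / ((n.factorial : ℝ) * Real.Gamma μ) := by
  unfold genBinom
  rw [Real.Gamma_nat_eq_factorial]
  ring_nf

namespace Fading

variable {F : Fading}

lemma Valid.order_pos (hF : F.Valid) (n : ℕ) : 0 < F.order n := by
  cases F with
  | kappaMu κ μ w =>
    obtain ⟨h1, h2, h3⟩ := hF
    simp only [order]
    positivity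
  | etaMu η μ w =>
    obtain ⟨h1, h2, h3⟩ := hF
    simp only [order]
    positivity

lemma Valid.scale_pos (hF : F.Valid) : 0 < F.scale := by
  cases F with
  | kappaMu κ μ w =>
    obtain ⟨h1, h2, h3⟩ := hF
    simp only [scale]
    positivity
  | etaMu η μ w =>
    obtain ⟨h1, h2, h3⟩ := hF
    have := hPar_pos h1
    simp only [scale]
    positivity

lemma weight_etaMu {η μ w : ℝ} (hη : 0 < η) (n : ℕ) :
    (etaMu η μ w).weight n = Real.Gamma (n + μ) / ((n.factorial : ℝ) * Real.Gamma μ) *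
      ((HPar η / hPar η) ^ 2) ^ n * hPar η ^ (-μ) := by
  have h := hPar_pos hη
  simp only [weight]
  rw [genBinom_natCast, Real.rpow_add h, ← pow_mul, div_pow, Real.rpow_neg h.le,
    show hPar η ^ (2 * (n : ℝ)) = hPar η ^ (2 * n) by
      rw [← Real.rpow_natCast]; push_cast; rfl]
  have := Real.rpow_pos_of_pos h μ
  field_simp

lemma Valid.weight_nonneg (hF : F.Valid) (n : ℕ) : 0 ≤ F.weight n := by
  cases F with
  | kappaMu κ μ w =>
    obtain ⟨h1, h2, h3⟩ := hF
    simp only [weight]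
    positivity
  | etaMu η μ w =>
    obtain ⟨h1, h2, h3⟩ := hF
    have := hPar_pos h1
    have := Gamma_natCast_add_pos h2 n
    have := Real.Gamma_pos_of_pos h2
    rw [weight_etaMu h1]
    positivity

/-- The `n`-th term of the Bessel series contributes the power `x ^ (μ + n - 1)`. With the
exponential factor it is a Gamma density of shape `μ + n`, and the remaining constants are Poisson
probabilities with mean `μκ`. -/
lemma kappaMu_hasSum_pdf {κ μ w x : ℝ} (hκ : 0 < κ) (hμ : 0 < μ) (hw : 0 < w) (hx : 0 < x) :
    HasSum (fun n : ℕ => (kappaMu κ μ w).weight n *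
      gammaPDFReal ((kappaMu κ μ w).order n) (1 / (kappaMu κ μ w).scale) x)
      (kappaMuPDF κ μ w x) := by
  have hs : 0 < κ * (1 + κ) / w * x := by positivity
  have hterm : ∀ n : ℕ, 1 / ((n.factorial : ℝ) * Real.Gamma (n + (μ - 1) + 1)) *
      (2 * μ * Real.sqrt (κ * (1 + κ) / w * x) / 2) ^ (2 * (n : ℝ) + (μ - 1)) =
      (μ * Real.sqrt (κ * (1 + κ) / w * x)) ^ (μ - 1) *
      (1 / ((n.factorial : ℝ) * Real.Gamma (n + μ)) * (μ ^ 2 * (κ * (1 + κ) / w * x)) ^ n) := by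
    intro n
    rw [show 2 * μ * Real.sqrt (κ * (1 + κ) / w * x) / 2 = μ * Real.sqrt (κ * (1 + κ) / w * x) by
      ring, Real.rpow_add (by positivity), show (n : ℝ) + (μ - 1) + 1 = n + μ by ring,
      show (2 : ℝ) * (n : ℝ) = ((2 * n : ℕ) : ℝ) by push_cast; rfl, Real.rpow_natCast, pow_mul,
      mul_pow, Real.sq_sqrt hs.le]
    ring
  have hsum := ((summable_besselI_coeff hμ (show 0 < μ ^ 2 * (κ * (1 + κ) / w * x) by
    positivity)).mul_left ((μ * Real.sqrt (κ * (1 + κ) / w * x)) ^ (μ - 1))).congr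
      fun n => (hterm n).symm
  have := hsum.hasSum.mul_left (μ / (κ ^ ((μ - 1) / 2) * Real.exp (μ * κ)) *
    ((1 + κ) / w) ^ ((μ + 1) / 2) * x ^ ((μ - 1) / 2) * Real.exp (-(μ * (1 + κ) / w * x)))
  refine this.congr_fun fun n => ?_
  rw [hterm, gammaPDFReal_of_pos hx]
  simp only [weight, order, scale]
  have hG := Gamma_natCast_add_pos hμ n
  rw [show μ + (n : ℝ) = n + μ by ring, show 1 / (w / (μ * (1 + κ))) = μ * (1 + κ) / w by
    field_simp, Real.mul_rpow hμ.le (Real.sqrt_nonneg _), Real.sqrt_eq_rpow,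
    ← Real.rpow_mul hs.le, show κ * (1 + κ) / w * x = κ * ((1 + κ) / w) * x by ring,
    show μ * (1 + κ) / w = μ * ((1 + κ) / w) by ring]
  generalize hb : (1 + κ) / w = b
  have hb : 0 < b := by rw [← hb]; positivity
  have e1 : (κ * b * x) ^ (1 / 2 * (μ - 1)) =
      κ ^ ((μ - 1) / 2) * b ^ ((μ - 1) / 2) * x ^ ((μ - 1) / 2) := by
    rw [Real.mul_rpow (by positivity) hx.le, Real.mul_rpow hκ.le hb.le]
    ring_nf
  have e2 : b ^ ((μ + 1) / 2) = b ^ ((μ - 1) / 2) * b := by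
    rw [← Real.rpow_add_one hb.ne']
    ring_nf
  have e3 : x ^ ((n : ℝ) + μ - 1) = x ^ n * (x ^ ((μ - 1) / 2) * x ^ ((μ - 1) / 2)) := by
    rw [← Real.rpow_natCast, ← Real.rpow_add hx, ← Real.rpow_add hx]
    ring_nf
  have e4 : (μ * b) ^ ((n : ℝ) + μ) = (μ * b) ^ n * (μ ^ (μ - 1) * μ *
      (b ^ ((μ - 1) / 2) * b ^ ((μ - 1) / 2) * b)) := by
    rw [← Real.rpow_add_one hμ.ne', ← Real.rpow_add hb, ← Real.rpow_add_one hb.ne',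
      Real.rpow_add (by positivity), Real.rpow_natCast, Real.mul_rpow hμ.le hb.le]
    ring_nf
  rw [e1, e2, e3, e4]
  have := Real.rpow_pos_of_pos hκ ((μ - 1) / 2)
  field_simp
  simp only [← mul_pow]
  ring_nf

/-- The Bessel series again supplies Gamma densities, now of shapes `2μ + 2n`. Its coefficients
carry `Γ(n + μ + 1/2)`, and the duplication formula exchanges this for the normalisation `Γ(2μ +
2n)`. -/
lemma etaMu_hasSum_pdf {η μ w x : ℝ} (hη : 0 < η) (hμ : 0 < μ) (hw : 0 < w) (hx : 0 < x) :
    HasSum (fun n : ℕ => (etaMu η μ w).weight n *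
      gammaPDFReal ((etaMu η μ w).order n) (1 / (etaMu η μ w).scale) x)
      (etaMuPDF η μ w x) := by
  have hh := hPar_pos hη
  have hc : 0 < μ * x / w := by positivity
  have hterm : ∀ n : ℕ, 1 / ((n.factorial : ℝ) * Real.Gamma (n + (μ - 1 / 2) + 1)) *
      (2 * μ * x / w / 2) ^ (2 * (n : ℝ) + (μ - 1 / 2)) * HPar η ^ (2 * n) =
      (μ * x / w) ^ (μ - 1 / 2) *
      (1 / ((n.factorial : ℝ) * Real.Gamma (n + (μ + 1 / 2))) *
        ((μ * x / w * HPar η) ^ 2) ^ n) := by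
    intro n
    rw [show 2 * μ * x / w / 2 = μ * x / w by ring, Real.rpow_add hc,
      show (n : ℝ) + (μ - 1 / 2) + 1 = n + (μ + 1 / 2) by ring,
      show (2 : ℝ) * (n : ℝ) = ((2 * n : ℕ) : ℝ) by push_cast; rfl, Real.rpow_natCast, pow_mul,
      pow_mul, mul_pow (μ * x / w), mul_pow]
    ring
  have hsum0 : Summable fun n : ℕ => 1 / ((n.factorial : ℝ) * Real.Gamma (n + (μ + 1 / 2))) *
      ((μ * x / w * HPar η) ^ 2) ^ n := by
    -- For `η = 1` the argument vanishes; adding `1` gives a positive argument whose series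
    -- dominates.
    have h1 : 0 < (μ * x / w * HPar η) ^ 2 + 1 := by positivity
    refine (summable_besselI_coeff (show 0 < μ + 1 / 2 by positivity) h1).of_nonneg_of_le
      (fun n => ?_) (fun n => ?_) <;>
    have := Gamma_natCast_add_pos (show 0 < μ + 1 / 2 by positivity) n
    · positivity
    · gcongr
      linarith
  have hsum := (hsum0.mul_left ((μ * x / w) ^ (μ - 1 / 2))).congr fun n => (hterm n).symm
  have := hsum.hasSum.mul_left (2 * Real.sqrt Real.pi * μ ^ (μ + 1 / 2) * hPar η ^ μ /
    (Real.Gamma μ * w ^ (μ + 1 / 2)) * x ^ (μ - 1 / 2) * Real.exp (-(2 * μ * hPar η * x / w)))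
  refine this.congr_fun fun n => ?_
  rw [hterm, gammaPDFReal_of_pos hx, weight_etaMu hη]
  simp only [order, scale]
  have hG := Gamma_natCast_add_pos hμ n
  have hG1 := Gamma_natCast_add_pos (show 0 < μ + 1 / 2 by positivity) n
  have hGμ := Real.Gamma_pos_of_pos hμ
  have hdup := Real.Gamma_mul_Gamma_add_half (n + μ)
  rw [show 2 * μ + 2 * (n : ℝ) = 2 * (n + μ) by ring,
    show 1 / (w / (2 * μ * hPar η)) = 2 * ((μ / w) * hPar η) by field_simp,
    show 2 * ((μ / w) * hPar η) * x = 2 * μ * hPar η * x / w by ring,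
    show μ * x / w = (μ / w) * x by ring]
  rw [add_assoc] at hdup
  generalize hb : μ / w = b
  have hb0 : 0 < b := by rw [← hb]; positivity
  have hμw : μ ^ (μ + 1 / 2) / w ^ (μ + 1 / 2) = b ^ (μ + 1 / 2) := by
    rw [← hb, Real.div_rpow hμ.le hw.le]
  have hG2 : 0 < Real.Gamma (2 * (n + μ)) := Real.Gamma_pos_of_pos (by positivity)
  have hG3 : Real.Gamma (2 * (n + μ)) = Real.Gamma (n + μ) * Real.Gamma (n + (μ + 1 / 2)) *
      2 ^ (2 * (n + μ)) / (2 * Real.sqrt Real.pi) := by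
    rw [hdup, sub_eq_add_neg, Real.rpow_add two_pos, Real.rpow_neg two_pos.le]
    have := Real.rpow_pos_of_pos two_pos (2 * (n + μ))
    have := Real.sqrt_pos.2 Real.pi_pos
    field_simp
    simp
  have e1 : (b * x) ^ (μ - 1 / 2) = b ^ (μ - 1 / 2) * x ^ (μ - 1 / 2) :=
    Real.mul_rpow hb0.le hx.le
  have e2 : (2 * (b * hPar η)) ^ (2 * (n + μ)) = 2 ^ (2 * (n + μ)) *
      (b ^ (2 * n) * (b ^ (μ + 1 / 2) * b ^ (μ - 1 / 2))) *
        (hPar η ^ (2 * n) * (hPar η ^ μ * hPar η ^ μ)) := by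
    rw [Real.mul_rpow two_pos.le (by positivity), Real.mul_rpow hb0.le hh.le,
      ← Real.rpow_natCast b, ← Real.rpow_natCast (hPar η), ← Real.rpow_add hb0,
      ← Real.rpow_add hb0, ← Real.rpow_add hh, ← Real.rpow_add hh]
    push_cast
    ring_nf
  have e3 : x ^ (2 * (n + μ) - 1) = x ^ (2 * n) * (x ^ (μ - 1 / 2) * x ^ (μ - 1 / 2)) := by
    rw [← Real.rpow_natCast, ← Real.rpow_add hx, ← Real.rpow_add hx]
    push_cast
    ring_nf
  have e4 : 2 * Real.sqrt Real.pi * μ ^ (μ + 1 / 2) * hPar η ^ μ /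
      (Real.Gamma μ * w ^ (μ + 1 / 2)) =
      2 * Real.sqrt Real.pi * hPar η ^ μ / Real.Gamma μ * b ^ (μ + 1 / 2) := by
    rw [← hμw]
    field_simp
  rw [e1, e2, e3, e4, hG3, Real.rpow_neg hh.le]
  have := Real.rpow_pos_of_pos hh μ
  have := Real.rpow_pos_of_pos two_pos (2 * (n + μ))
  have := Real.sqrt_pos.2 Real.pi_pos
  field_simp
  simp only [pow_mul, ← mul_pow]
  field_simp

lemma Valid.hasSum_pdf (hF : F.Valid) {x : ℝ} (hx : 0 < x) :
    HasSum (fun n : ℕ => F.weight n * gammaPDFReal (F.order n) (1 / F.scale) x) (F.pdf x) := by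
  cases F with
  | kappaMu κ μ w => exact kappaMu_hasSum_pdf hF.1 hF.2.1 hF.2.2 hx
  | etaMu η μ w => exact etaMu_hasSum_pdf hF.1 hF.2.1 hF.2.2 hx

/-- The density is used from here on only through this formula: every mean of a nonnegative function
is the weighted series of its Gamma means, by Tonelli. -/
lemma Valid.lintegral_law (hF : F.Valid) {g : ℝ → ℝ≥0∞} (hg : Measurable g) :
    ∫⁻ x, g x ∂F.law = ∑' n, ENNReal.ofReal (F.weight n) *
      gammaLIntegral (F.order n) (1 / F.scale) g := by
  have hr : 0 < 1 / F.scale := one_div_pos.2 hF.scale_pos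
  have hm : ∀ n, Measurable fun x => ENNReal.ofReal (gammaPDFReal (F.order n) (1 / F.scale) x) :=
    fun n => (measurable_gammaPDFReal _ _).ennreal_ofReal
  have hae : (fun x => ENNReal.ofReal (F.pdf x)) =ᵐ[volume.restrict (Ioi 0)]
      fun x => ∑' n, ENNReal.ofReal (F.weight n) *
        ENNReal.ofReal (gammaPDFReal (F.order n) (1 / F.scale) x) := by
    filter_upwards [ae_restrict_mem measurableSet_Ioi] with x hx
    have h := hF.hasSum_pdf hx
    have h0 : ∀ n, 0 ≤ F.weight n * gammaPDFReal (F.order n) (1 / F.scale) x := fun n =>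
      mul_nonneg (hF.weight_nonneg n) (gammaPDFReal_nonneg (hF.order_pos n) hr x)
    rw [← h.tsum_eq, ENNReal.ofReal_tsum_of_nonneg h0 h.summable]
    simp_rw [ENNReal.ofReal_mul (hF.weight_nonneg _)]
  have hmt : Measurable fun x => ∑' n, ENNReal.ofReal (F.weight n) *
      ENNReal.ofReal (gammaPDFReal (F.order n) (1 / F.scale) x) :=
    Measurable.tsum fun n => measurable_const.mul (hm n)
  rw [law, withDensity_congr_ae hae, lintegral_withDensity_eq_lintegral_mul _ hmt hg]
  simp only [Pi.mul_apply, ← ENNReal.tsum_mul_right]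
  rw [lintegral_tsum (f := fun n x => ENNReal.ofReal (F.weight n) *
    ENNReal.ofReal (gammaPDFReal (F.order n) (1 / F.scale) x) * g x)
    fun n => ((measurable_const.mul (hm n)).mul hg).aemeasurable]
  refine tsum_congr fun n => ?_
  simp_rw [mul_assoc]
  exact lintegral_const_mul _ ((hm n).mul hg)

lemma ae_law_pos : ∀ᵐ x ∂F.law, 0 < x :=
  (withDensity_absolutelyContinuous _ _).ae_le (ae_restrict_mem measurableSet_Ioi)

lemma Valid.lintegral_law_rpow (hF : F.Valid) {δ : ℝ} (hδ : 0 ≤ δ) :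
    ∫⁻ x, ENNReal.ofReal (x ^ δ) ∂F.law = ∑' n, ENNReal.ofReal (F.weight n *
      (F.scale ^ δ * (Real.Gamma (F.order n + δ) / Real.Gamma (F.order n)))) := by
  rw [hF.lintegral_law (by fun_prop)]
  refine tsum_congr fun n => ?_
  rw [gammaLIntegral_rpow (hF.order_pos n) (one_div_pos.2 hF.scale_pos) hδ,
    ← ENNReal.ofReal_mul (hF.weight_nonneg n), one_div_one_div]

lemma Valid.lintegral_law_exp (hF : F.Valid) {u : ℝ} (hu : 0 ≤ u) :
    ∫⁻ x, ENNReal.ofReal (Real.exp (-(u * x))) ∂F.law = ∑' n, ENNReal.ofReal (F.weight n *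
      (1 + F.scale * u) ^ (-F.order n)) := by
  rw [hF.lintegral_law (by fun_prop)]
  refine tsum_congr fun n => ?_
  rw [gammaLIntegral_exp (hF.order_pos n) (one_div_pos.2 hF.scale_pos) hu,
    ← ENNReal.ofReal_mul (hF.weight_nonneg n), one_div_one_div]

/-- The Gamma law of shape `order n` has mean `order n * scale`, so this is finiteness of the mean
power. It also dominates the kernel series, because `gKer i z ≤ i`. -/
lemma Valid.summable_weight_mul_order (hF : F.Valid) :
    Summable fun n => F.weight n * F.order n := by
  cases F with
  | kappaMu κ μ w =>
    obtain ⟨h1, h2, h3⟩ := hF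
    have hpos : ∀ n : ℕ, 0 < (kappaMu κ μ w).weight n * (kappaMu κ μ w).order n := fun n => by
      simp only [weight, order]
      positivity
    refine summable_of_ratio_test_tendsto_lt_one zero_lt_one
      (Eventually.of_forall fun n => (hpos n).ne') ?_
    have h : Tendsto (fun n : ℕ => μ * κ / ((n : ℝ) + 1) * ((n + (μ + 1)) / ((n : ℝ) + μ))) atTop
        (𝓝 (0 * 1)) :=
      ((tendsto_natCast_add_atTop 1).const_div_atTop _).mul (tendsto_natCast_add_div _ _)
    rw [zero_mul] at h
    refine h.congr fun n => ?_
    rw [Real.norm_of_nonneg (hpos _).le, Real.norm_of_nonneg (hpos _).le]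
    simp only [weight, order]
    rw [Nat.factorial_succ, pow_succ]
    push_cast
    field_simp
    ring
  | etaMu η μ w =>
    obtain ⟨h1, h2, h3⟩ := hF
    -- For `H = 0` only the weight at `n = 0` survives, and the ratio test would divide by zero.
    rcases eq_or_ne (HPar η) 0 with hH | hH
    · refine summable_of_ne_finset_zero (s := {0}) fun n hn => ?_
      rw [weight_etaMu h1, hH]
      have : n ≠ 0 := by simpa using hn
      simp [this]
    have hh := hPar_pos h1
    have hpos : ∀ n : ℕ, 0 < (etaMu η μ w).weight n * (etaMu η μ w).order n := fun n => by
      have := Gamma_natCast_add_pos h2 n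
      have := Real.Gamma_pos_of_pos h2
      rw [weight_etaMu h1]
      simp only [order]
      positivity
    refine summable_of_ratio_test_tendsto_lt_one (HPar_div_hPar_sq_lt_one h1)
      (Eventually.of_forall fun n => (hpos n).ne') ?_
    have h : Tendsto (fun n : ℕ => ((n : ℝ) + μ) / (n + 1) * (HPar η / hPar η) ^ 2 *
        ((n + (μ + 1)) / ((n : ℝ) + μ))) atTop (𝓝 (1 * (HPar η / hPar η) ^ 2 * 1)) :=
      ((tendsto_natCast_add_div _ _).mul_const _).mul (tendsto_natCast_add_div _ _)
    rw [one_mul, mul_one] at h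
    refine h.congr fun n => ?_
    rw [Real.norm_of_nonneg (hpos _).le, Real.norm_of_nonneg (hpos _).le, weight_etaMu h1,
      weight_etaMu h1]
    simp only [order]
    have hG := Gamma_natCast_add_pos h2 n
    have e : Real.Gamma (((n + 1 : ℕ) : ℝ) + μ) = (n + μ) * Real.Gamma (n + μ) := by
      rw [← Real.Gamma_add_one (by positivity)]
      congr 1
      push_cast
      ring
    have := Real.Gamma_pos_of_pos h2
    have := Real.rpow_pos_of_pos hh (-μ)
    have hρ : (HPar η / hPar η) ^ 2 ≠ 0 := by positivity
    generalize (HPar η / hPar η) ^ 2 = ρ at hρ ⊢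
    rw [Nat.factorial_succ, pow_succ, e]
    push_cast
    field_simp
    ring

lemma Valid.summable_weight (hF : F.Valid) : Summable F.weight := by
  have h0 := hF.order_pos 0
  refine (hF.summable_weight_mul_order.mul_left (F.order 0)⁻¹).of_nonneg_of_le
    hF.weight_nonneg fun n => ?_
  have h : F.order 0 ≤ F.order n := by
    cases F <;> simp [order]
  have := hF.weight_nonneg n
  rw [← div_eq_inv_mul, le_div_iff₀ h0]
  gcongr

/-- The sum needs no evaluation: each Gamma density has mass `1`, so the weights add up to the total
mass of the law, which is a probability measure by assumption. -/
lemma Valid.hasSum_weight (hF : F.Valid) [IsProbabilityMeasure F.law] : HasSum F.weight 1 := by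
  have h := hF.lintegral_law_exp le_rfl
  simp only [zero_mul, neg_zero, Real.exp_zero, ENNReal.ofReal_one, lintegral_const, measure_univ,
    mul_one, mul_zero, add_zero, Real.one_rpow] at h
  rw [← ENNReal.ofReal_tsum_of_nonneg hF.weight_nonneg hF.summable_weight] at h
  have h' := hF.summable_weight.hasSum
  rwa [show ∑' n, F.weight n = 1 by
    rw [← ENNReal.ofReal_eq_one]
    exact h.symm] at h'

lemma Valid.lintegral_law_id_lt_top (hF : F.Valid) : ∫⁻ x, ENNReal.ofReal x ∂F.law < ∞ := by
  have h := hF.lintegral_law_rpow zero_le_one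
  simp only [Real.rpow_one] at h
  rw [h]
  have e : ∀ n, F.weight n * (F.scale * (Real.Gamma (F.order n + 1) / Real.Gamma (F.order n))) =
      F.scale * (F.weight n * F.order n) := by
    intro n
    have := Real.Gamma_pos_of_pos (hF.order_pos n)
    rw [Real.Gamma_add_one (hF.order_pos n).ne']
    field_simp
  simp_rw [e]
  exact (hF.summable_weight_mul_order.mul_left _).tsum_ofReal_lt_top

end Fading

end

/-! ### Gauss-Laguerre quadrature: orthogonality, nodes, exactness, positive weights. -/

open Polynomial in
lemma integrableOn_polynomial_mul_exp (p : ℝ[X]) :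
    IntegrableOn (fun t => p.eval t * Real.exp (-t)) (Ioi 0) := by
  induction p using Polynomial.induction_on' with
  | add p q hp hq =>
    refine (hp.add hq).congr_fun (fun t _ => ?_) measurableSet_Ioi
    simp only [Pi.add_apply, Polynomial.eval_add]
    ring
  | monomial n a =>
    have h := (Real.GammaIntegral_convergent (show (0 : ℝ) < n + 1 by positivity)).const_mul a
    refine IntegrableOn.congr_fun h (fun t _ => ?_) measurableSet_Ioi
    simp only [Polynomial.eval_monomial, add_sub_cancel_right, Real.rpow_natCast]
    ring

open Polynomial in
/-- The mean of a polynomial with respect to the exponential distribution. -/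
def expMean : ℝ[X] →ₗ[ℝ] ℝ where
  toFun p := ∫ t in Ioi (0 : ℝ), p.eval t * Real.exp (-t)
  map_add' p q := by
    rw [← integral_add (integrableOn_polynomial_mul_exp p) (integrableOn_polynomial_mul_exp q)]
    simp only [Polynomial.eval_add, add_mul]
  map_smul' a p := by
    simp only [Polynomial.eval_smul, smul_eq_mul, RingHom.id_apply, mul_assoc]
    rw [integral_const_mul]

open Polynomial in
lemma expMean_apply (p : ℝ[X]) : expMean p = ∫ t in Ioi (0 : ℝ), p.eval t * Real.exp (-t) := rfl

open Polynomial in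
lemma expMean_X_pow (n : ℕ) : expMean (X ^ n : ℝ[X]) = n.factorial := by
  rw [expMean_apply, ← Real.Gamma_nat_eq_factorial, Real.Gamma_eq_integral (by positivity)]
  refine setIntegral_congr_fun measurableSet_Ioi fun t _ => ?_
  simp only [Polynomial.eval_pow, Polynomial.eval_X, add_sub_cancel_right, Real.rpow_natCast]
  ring

-- The integral is an alternating binomial sum of `(k + j)! / k!`. This is a polynomial in `k` of
-- degree `j < M`, and its `M`-th finite difference is zero.
open Polynomial in
lemma expMean_X_pow_mul_laguerre {M j : ℕ} (hj : j < M) :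
    expMean (X ^ j * laguerre M : ℝ[X]) = 0 := by
  have h1 : (X ^ j * laguerre M : ℝ[X]) = ∑ k ∈ Finset.range (M + 1),
      ((M.choose k : ℝ) * (-1) ^ k / (k.factorial : ℝ)) • (X ^ (k + j) : ℝ[X]) := by
    rw [laguerre, Finset.mul_sum]
    refine Finset.sum_congr rfl fun k _ => ?_
    rw [Polynomial.smul_eq_C_mul, pow_add]
    ring
  rw [h1, map_sum]
  simp only [map_smul, expMean_X_pow, smul_eq_mul]
  -- `Q(k) = (k + 1)(k + 2) ⋯ (k + j)`.
  let Q : ℝ[X] := (ascPochhammer ℝ j).comp (X + C 1)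
  have hQdeg : Q.natDegree < M := by
    rw [Polynomial.natDegree_comp, ascPochhammer_natDegree, Polynomial.natDegree_X_add_C, mul_one]
    exact hj
  have hQ : ∀ k : ℕ, Q.eval (k : ℝ) = ((k + j).factorial : ℝ) / k.factorial := by
    intro k
    have : ((k : ℝ) + 1) = ((k + 1 : ℕ) : ℝ) := by push_cast; rfl
    rw [eq_div_iff (by positivity), Polynomial.eval_comp]
    simp only [Polynomial.eval_add, Polynomial.eval_X, Polynomial.eval_C]
    rw [this, ← ascPochhammer_eval_cast, ascPochhammer_nat_eq_ascFactorial,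
      ← Nat.factorial_mul_ascFactorial]
    push_cast
    ring
  have h2 := congrFun (Polynomial.fwdDiff_iter_eq_zero_of_degree_lt hQdeg) 0
  rw [fwdDiff_iter_eq_sum_shift] at h2
  have h3 : ∀ k ∈ Finset.range (M + 1), (M.choose k : ℝ) * (-1) ^ k / (k.factorial : ℝ) *
      ((k + j).factorial : ℝ) =
      (-1) ^ M * (((-1 : ℤ) ^ (M - k) * (M.choose k : ℤ)) • Q.eval (0 + k • (1 : ℝ))) := by
    intro k hk
    have hkM : k ≤ M := Nat.lt_succ_iff.1 (Finset.mem_range.1 hk)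
    have hs : (-1 : ℝ) ^ M * (-1) ^ (M - k) = (-1) ^ k := by
      rw [← pow_add, show M + (M - k) = 2 * (M - k) + k by omega, pow_add, pow_mul]
      simp
    rw [zero_add, nsmul_eq_mul, mul_one, hQ, zsmul_eq_mul, ← hs]
    push_cast
    ring
  rw [Finset.sum_congr rfl h3, ← Finset.mul_sum, h2]
  simp

open Polynomial in
lemma coeff_laguerre (M : ℕ) : (laguerre M).coeff M = (-1) ^ M / (M.factorial : ℝ) := by
  rw [laguerre, Polynomial.finsetSum_coeff]
  simp only [Polynomial.coeff_C_mul, Polynomial.coeff_X_pow]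
  rw [Finset.sum_eq_single M]
  · simp
  · intro k _ hk
    simp [hk.symm]
  · simp

open Polynomial in
lemma natDegree_laguerre (M : ℕ) : (laguerre M).natDegree = M := by
  refine Polynomial.natDegree_eq_of_le_of_coeff_ne_zero ?_ ?_
  · rw [laguerre]
    refine Polynomial.natDegree_sum_le_of_forall_le _ _ fun k hk => ?_
    refine (Polynomial.natDegree_C_mul_X_pow_le _ _).trans ?_
    exact Nat.lt_succ_iff.1 (Finset.mem_range.1 hk)
  · rw [coeff_laguerre]
    positivity

lemma laguerre_ne_zero (M : ℕ) : laguerre M ≠ 0 := by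
  intro h
  have := coeff_laguerre M
  rw [h, Polynomial.coeff_zero] at this
  have h2 : (-1 : ℝ) ^ M / (M.factorial : ℝ) ≠ 0 := by positivity
  exact h2 this.symm

open Polynomial in
/-- The Laguerre polynomials are orthogonal to all polynomials of smaller degree. -/
lemma expMean_mul_laguerre {M : ℕ} {q : ℝ[X]} (hq : q.degree < M) :
    expMean (q * laguerre M) = 0 := by
  rcases eq_or_ne q 0 with rfl | h0
  · simp
  rw [q.as_sum_range' M ((Polynomial.natDegree_lt_iff_degree_lt h0).2 hq), Finset.sum_mul, map_sum]
  refine Finset.sum_eq_zero fun j hj => ?_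
  rw [← Polynomial.C_mul_X_pow_eq_monomial, mul_assoc, ← Polynomial.smul_eq_C_mul, map_smul,
    expMean_X_pow_mul_laguerre (Finset.mem_range.1 hj), smul_zero]

open Polynomial in
lemma expMean_nonneg {p : ℝ[X]} (hp : ∀ t, 0 < t → 0 ≤ p.eval t) : 0 ≤ expMean p :=
  setIntegral_nonneg measurableSet_Ioi fun t ht => mul_nonneg (hp t ht) (Real.exp_nonneg _)

open Polynomial in
lemma expMean_pos {p : ℝ[X]} (h0 : p ≠ 0) (hp : ∀ t, 0 < t → 0 ≤ p.eval t) : 0 < expMean p := by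
  refine (expMean_nonneg hp).lt_of_ne fun h => ?_
  have hn : 0 ≤ᵐ[volume.restrict (Ioi 0)] fun t => p.eval t * Real.exp (-t) := by
    filter_upwards [ae_restrict_mem measurableSet_Ioi] with t ht
    exact mul_nonneg (hp t ht) (Real.exp_nonneg _)
  have h1 := (setIntegral_eq_zero_iff_of_nonneg_ae hn (integrableOn_polynomial_mul_exp p)).1 h.symm
  have h2 : ∀ᵐ t ∂(volume : Measure ℝ), t ∉ (p.roots.toFinset : Set ℝ) :=
    (Finset.finite_toSet _).countable.ae_notMem _
  have h3 : ∀ᵐ t ∂(volume.restrict (Ioi (0 : ℝ))), False := by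
    filter_upwards [h1, ae_restrict_of_ae h2] with t ht ht2
    simp only [Pi.zero_apply, mul_eq_zero, (Real.exp_pos _).ne', or_false] at ht
    exact ht2 (by simpa [h0] using ht)
  rw [ae_iff] at h3
  simp at h3

open Polynomial in
/-- Multiplying a nonzero polynomial by suitable linear factors, whose roots are distinct positive
roots of the polynomial, makes its sign constant on the positive half-line. -/
lemma exists_finset_roots_const_sign (n : ℕ) : ∀ p : ℝ[X], p ≠ 0 → p.natDegree = n →
    ∃ S : Finset ℝ, (∀ a ∈ S, 0 < a ∧ p.eval a = 0) ∧
      ∃ σ : ℝ, σ ≠ 0 ∧ ∀ t, 0 < t → 0 ≤ σ * (p * ∏ a ∈ S, (X - C a)).eval t := by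
  classical
  induction n with
  | zero =>
    intro p h0 hn
    refine ⟨∅, by simp, ?_⟩
    rw [Polynomial.eq_C_of_natDegree_eq_zero hn] at h0 ⊢
    have : p.coeff 0 ≠ 0 := by simpa using h0
    exact ⟨p.coeff 0, this, fun t _ => by simpa using mul_self_nonneg _⟩
  | succ n ih =>
    intro p h0 hn
    by_cases hr : ∃ a, 0 < a ∧ p.eval a = 0
    · obtain ⟨a, ha, hpa⟩ := hr
      obtain ⟨q, rfl⟩ := Polynomial.dvd_iff_isRoot.2 hpa
      have hq0 : q ≠ 0 := right_ne_zero_of_mul h0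
      have hqn : q.natDegree = n := by
        rw [Polynomial.natDegree_mul (Polynomial.X_sub_C_ne_zero a) hq0,
          Polynomial.natDegree_X_sub_C] at hn
        omega
      obtain ⟨S, hS, σ, hσ, hs⟩ := ih q hq0 hqn
      -- The factor `X - a` split off from `p` can stand in for the one of `S`, so `a` leaves `S`
      -- when it was there. Otherwise `a` joins `S`, which leaves a square `(t - a)²`. Thus `S` ends
      -- up with the positive roots of odd multiplicity.
      by_cases haS : a ∈ S
      · refine ⟨S.erase a, fun b hb => ⟨(hS b (Finset.mem_of_mem_erase hb)).1, ?_⟩, σ, hσ, ?_⟩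
        · simp [(hS b (Finset.mem_of_mem_erase hb)).2]
        · intro t ht
          convert hs t ht using 3
          rw [← Finset.mul_prod_erase _ _ haS]
          ring
      · refine ⟨insert a S, fun b hb => ?_, σ, hσ, fun t ht => ?_⟩
        · rcases Finset.mem_insert.1 hb with rfl | hb
          · exact ⟨ha, hpa⟩
          · exact ⟨(hS b hb).1, by simp [(hS b hb).2]⟩
        · rw [Finset.prod_insert haS]
          have := mul_nonneg (hs t ht) (sq_nonneg (t - a))
          refine this.trans_eq ?_
          simp only [Polynomial.eval_mul, Polynomial.eval_sub, Polynomial.eval_X,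
            Polynomial.eval_C]
          ring
    · push Not at hr
      refine ⟨∅, by simp, ?_⟩
      -- Without positive roots the sign on the half-line is that of `p(1)`, by the intermediate
      -- value theorem.
      have h1 : ∀ t, 0 < t → 0 ≤ p.eval 1 * p.eval t := by
        intro t ht
        by_contra hneg
        push Not at hneg
        have hc : ContinuousOn (fun x => p.eval x) (uIcc 1 t) := p.continuous.continuousOn
        have h0m : (0 : ℝ) ∈ uIcc (p.eval 1) (p.eval t) := by
          rw [mem_uIcc]
          rcases mul_neg_iff.1 hneg with h | h
          · exact Or.inr ⟨h.2.le, h.1.le⟩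
          · exact Or.inl ⟨h.1.le, h.2.le⟩
        obtain ⟨x, hx, hx0⟩ := intermediate_value_uIcc hc h0m
        have hx1 : min 1 t ≤ x := hx.1
        exact hr x (lt_of_lt_of_le (lt_min one_pos ht) hx1) hx0
      exact ⟨p.eval 1, hr 1 one_pos, fun t ht => by simpa using h1 t ht⟩

-- Let `S` be a set of positive roots whose linear factors make the sign of the Laguerre polynomial
-- constant. With fewer than `M` elements, the product of these factors would have degree below `M`
-- and be orthogonal to the Laguerre polynomial, although their product has a nonzero integral. So
-- `S` has `M` elements and exhausts the roots.
open Polynomial in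
theorem laguerreNodes_card_and_pos (M : ℕ) :
    (laguerreNodes M).card = M ∧ ∀ x ∈ laguerreNodes M, 0 < x := by
  classical
  obtain ⟨S, hS, σ, hσ, hs⟩ := exists_finset_roots_const_sign M (laguerre M) (laguerre_ne_zero M)
    (natDegree_laguerre M)
  have hsub : S ⊆ laguerreNodes M := by
    intro a ha
    simpa [laguerreNodes, laguerre_ne_zero] using (hS a ha).2
  have hle : (laguerreNodes M).card ≤ M := by
    have := (Multiset.toFinset_card_le (laguerre M).roots).trans (laguerre M).card_roots'
    rwa [natDegree_laguerre] at this
  have hge : M ≤ S.card := by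
    by_contra hlt
    push Not at hlt
    have hm : (∏ a ∈ S, (X - C a) : ℝ[X]).Monic := Polynomial.monic_prod_of_monic _ _
      fun a _ => Polynomial.monic_X_sub_C a
    have hd : (∏ a ∈ S, (X - C a) : ℝ[X]).degree < M := by
      rw [Polynomial.degree_prod]
      simpa using hlt
    have h1 := expMean_mul_laguerre hd
    have h2 : (C σ * (laguerre M * ∏ a ∈ S, (X - C a))) ≠ 0 :=
      mul_ne_zero (by simpa using hσ) (mul_ne_zero (laguerre_ne_zero M) hm.ne_zero)
    have h3 := expMean_pos h2 fun t ht => by simpa using hs t ht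
    rw [← Polynomial.smul_eq_C_mul, map_smul, mul_comm, h1] at h3
    simp at h3
  have heq : S = laguerreNodes M := Finset.eq_of_subset_of_card_le hsub (hle.trans hge)
  exact ⟨le_antisymm hle (heq ▸ hge), fun x hx => (hS x (heq ▸ hx)).1⟩

open Polynomial in
lemma sum_laguerreWeight_of_degree_lt {M : ℕ} {p : ℝ[X]} (hp : p.degree < M) :
    ∑ x ∈ laguerreNodes M, laguerreWeight M x * p.eval x = expMean p := by
  have h := Lagrange.eq_interpolate (s := laguerreNodes M) (v := id) (f := p)
    Function.injective_id.injOn (by rwa [(laguerreNodes_card_and_pos M).1])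
  conv_rhs => rw [h, Lagrange.interpolate_apply, map_sum]
  refine Finset.sum_congr rfl fun x _ => ?_
  rw [← Polynomial.smul_eq_C_mul, map_smul, smul_eq_mul, mul_comm]
  rfl

open Polynomial in
/-- The Gauss-Laguerre quadrature of order `M` is exact for polynomials of degree less than
`2 * M`. -/
theorem sum_laguerreWeight {M : ℕ} {p : ℝ[X]} (hp : p.natDegree < 2 * M) :
    ∑ x ∈ laguerreNodes M, laguerreWeight M x * p.eval x = expMean p := by
  have hL := laguerre_ne_zero M
  have hdL : (laguerre M).degree = M := by
    rw [Polynomial.degree_eq_natDegree hL, natDegree_laguerre]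
  -- Division by the Laguerre polynomial: the quotient has degree below `M`, so its part integrates
  -- to zero by orthogonality and vanishes at the nodes. Only the remainder counts, and
  -- interpolation integrates it exactly.
  have hr : (p % laguerre M).degree < M := hdL ▸ Polynomial.degree_mod_lt p hL
  have hq : (p / laguerre M).degree < M := by
    by_cases h : (laguerre M).degree ≤ p.degree
    · have h1 := Polynomial.degree_add_div hL h
      have hp0 : p ≠ 0 := by
        rintro rfl
        simp [hdL] at h
      rw [hdL, Polynomial.degree_eq_natDegree hp0] at h1
      rcases eq_or_ne (p / laguerre M) 0 with h0 | h0
      · rw [h0, Polynomial.degree_zero]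
        exact WithBot.bot_lt_coe M
      · rw [Polynomial.degree_eq_natDegree h0] at h1 ⊢
        norm_cast at h1 ⊢
        omega
    · rw [(Polynomial.div_eq_zero_iff hL).2 (not_le.1 h), Polynomial.degree_zero]
      exact WithBot.bot_lt_coe M
  have hp' := EuclideanDomain.div_add_mod p (laguerre M)
  conv_rhs => rw [← hp', map_add, mul_comm, expMean_mul_laguerre hq, zero_add]
  rw [← sum_laguerreWeight_of_degree_lt hr]
  refine Finset.sum_congr rfl fun x hx => ?_
  have hx0 : (laguerre M).eval x = 0 := by
    simpa [laguerreNodes, hL] using hx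
  conv_lhs => rw [← hp']
  simp [hx0]

-- The square of the Lagrange basis polynomial has degree `2M - 2`, so the rule is exact for it. It
-- is `1` at one node and `0` at the others, which makes the weight the integral of a square.
open Polynomial in
lemma laguerreWeight_nonneg {M : ℕ} {x : ℝ} (hx : x ∈ laguerreNodes M) :
    0 ≤ laguerreWeight M x := by
  have hcard := (laguerreNodes_card_and_pos M).1
  have hM : 0 < M := hcard ▸ Finset.card_pos.2 ⟨x, hx⟩
  set b := Lagrange.basis (laguerreNodes M) id x with hb
  have hdeg : (b * b).natDegree < 2 * M := by
    refine Polynomial.natDegree_mul_le.trans_lt ?_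
    rw [hb, Lagrange.natDegree_basis Function.injective_id.injOn hx, hcard]
    omega
  have h := sum_laguerreWeight hdeg
  rw [Finset.sum_eq_single x] at h
  · rw [Polynomial.eval_mul, show b.eval x = 1 from
      Lagrange.eval_basis_self (v := id) Function.injective_id.injOn hx] at h
    simp only [mul_one] at h
    rw [h]
    exact expMean_nonneg fun t _ => by simpa using mul_self_nonneg _
  · intro y hy hyx
    have : b.eval y = 0 := Lagrange.eval_basis_of_ne (v := id) hyx.symm hy
    simp [this]
  · exact fun h' => absurd hx h'

/-! ### Convergence of the quadrature for decaying exponentials. -/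

/-- The remainder of order `J` in the Taylor expansion of `exp (-x)` has the sign `(-1) ^ J`. -/
lemma exp_neg_sub_taylor_nonneg (J : ℕ) : ∀ x : ℝ, 0 ≤ x →
    0 ≤ (-1) ^ J * (Real.exp (-x) - ∑ j ∈ Finset.range J, (-x) ^ j / (j.factorial : ℝ)) := by
  induction J with
  | zero => intro x _; simp [Real.exp_nonneg]
  | succ J ih =>
    intro x hx
    let f : ℝ → ℝ := fun x => (-1) ^ (J + 1) *
      (Real.exp (-x) - ∑ j ∈ Finset.range (J + 1), (-x) ^ j / (j.factorial : ℝ))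
    -- Differentiating the signed remainder of order `J + 1` gives the one of order `J`, which is
    -- nonnegative by induction; both sides start from `0`.
    have hder : ∀ y, HasDerivAt f ((-1) ^ J *
        (Real.exp (-y) - ∑ j ∈ Finset.range J, (-y) ^ j / (j.factorial : ℝ))) y := by
      intro y
      have h1 : HasDerivAt (fun x : ℝ => Real.exp (-x)) (-Real.exp (-y)) y := by
        simpa using (hasDerivAt_neg y).exp
      have h2 : HasDerivAt (fun x : ℝ => ∑ j ∈ Finset.range (J + 1), (-x) ^ j / (j.factorial : ℝ))
          (∑ j ∈ Finset.range (J + 1), (j : ℝ) * (-y) ^ (j - 1) * (-1) / (j.factorial : ℝ)) y := by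
        refine HasDerivAt.fun_sum fun j _ => ?_
        exact ((hasDerivAt_neg y).pow j).div_const _
      have h3 : ∑ j ∈ Finset.range (J + 1), (j : ℝ) * (-y) ^ (j - 1) * (-1) / (j.factorial : ℝ) =
          -∑ j ∈ Finset.range J, (-y) ^ j / (j.factorial : ℝ) := by
        rw [Finset.sum_range_succ', ← Finset.sum_neg_distrib]
        simp only [Nat.cast_zero, zero_mul, zero_div, add_zero]
        refine Finset.sum_congr rfl fun j _ => ?_
        rw [Nat.factorial_succ]
        push_cast
        field_simp
      rw [h3] at h2
      refine ((h1.sub h2).const_mul ((-1) ^ (J + 1))).congr_deriv ?_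
      rw [pow_succ]
      ring
    have hmono : MonotoneOn f (Ici 0) := by
      refine monotoneOn_of_deriv_nonneg (convex_Ici 0)
        (fun y _ => (hder y).continuousAt.continuousWithinAt)
        (fun y _ => (hder y).differentiableAt.differentiableWithinAt) fun y hy => ?_
      rw [(hder y).deriv]
      rw [interior_Ici] at hy
      exact ih y (le_of_lt hy)
    have h0 : f 0 = 0 := by
      simp only [f, neg_zero, Real.exp_zero]
      rw [Finset.sum_range_succ']
      simp
    have := hmono (mem_Ici.2 le_rfl) (mem_Ici.2 hx) hx
    rwa [h0] at this

/-- Consecutive remainders have opposite signs, so each is at most the first omitted term. -/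
lemma abs_exp_neg_sub_taylor_le (J : ℕ) {x : ℝ} (hx : 0 ≤ x) :
    |Real.exp (-x) - ∑ j ∈ Finset.range J, (-x) ^ j / (j.factorial : ℝ)| ≤
      x ^ J / (J.factorial : ℝ) := by
  have h1 := exp_neg_sub_taylor_nonneg J x hx
  have h2 := exp_neg_sub_taylor_nonneg (J + 1) x hx
  rw [Finset.sum_range_succ] at h2
  have e : (-x) ^ J = (-1) ^ J * x ^ J := by rw [← mul_pow]; ring
  rw [e, pow_succ] at h2
  have hs : (-1 : ℝ) ^ J * (-1) ^ J = 1 := by rw [← mul_pow]; simp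
  have ha : |Real.exp (-x) - ∑ j ∈ Finset.range J, (-x) ^ j / (j.factorial : ℝ)| =
      (-1) ^ J * (Real.exp (-x) - ∑ j ∈ Finset.range J, (-x) ^ j / (j.factorial : ℝ)) := by
    rw [← abs_of_nonneg h1, abs_mul]
    simp
  rw [ha]
  have : (-1 : ℝ) ^ J * ((-1) ^ J * x ^ J / (J.factorial : ℝ)) = x ^ J / (J.factorial : ℝ) := by
    rw [← mul_div_assoc, ← mul_assoc, hs, one_mul]
  linarith

/-- The mean of `x ^ k * exp (-t * x)` with respect to the exponential distribution. -/
def expMoment (k : ℕ) (t : ℝ) : ℝ :=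
  ∫ x in Ioi (0 : ℝ), x ^ k * Real.exp (-(t * x)) * Real.exp (-x)

/-- The Gauss-Laguerre quadrature of order `M` for `x ^ k * exp (-t * x)`. -/
def quadMoment (M k : ℕ) (t : ℝ) : ℝ :=
  ∑ x ∈ laguerreNodes M, laguerreWeight M x * (x ^ k * Real.exp (-(t * x)))

lemma expMoment_eq_and_integrable (k : ℕ) {t : ℝ} (ht : 0 ≤ t) :
    expMoment k t = (k.factorial : ℝ) / (1 + t) ^ (k + 1) ∧
      IntegrableOn (fun x => x ^ k * Real.exp (-(t * x)) * Real.exp (-x)) (Ioi 0) := by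
  have h := Real.integral_rpow_mul_exp_neg_mul_Ioi (show (0 : ℝ) < k + 1 by positivity)
    (show 0 < 1 + t by positivity)
  have e : ∀ x : ℝ, x ^ k * Real.exp (-(t * x)) * Real.exp (-x) =
      x ^ ((k : ℝ) + 1 - 1) * Real.exp (-((1 + t) * x)) := by
    intro x
    rw [mul_assoc, ← Real.exp_add, add_sub_cancel_right, Real.rpow_natCast]
    ring_nf
  have h2 : expMoment k t = (k.factorial : ℝ) / (1 + t) ^ (k + 1) := by
    unfold expMoment
    simp_rw [e]
    rw [h, Real.Gamma_nat_eq_factorial]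
    rw [show (k : ℝ) + 1 = ((k + 1 : ℕ) : ℝ) by push_cast; rfl, Real.rpow_natCast, one_div,
      inv_pow]
    field_simp
  refine ⟨h2, Integrable.of_integral_ne_zero ?_⟩
  change expMoment k t ≠ 0
  rw [h2]
  positivity

/-- The Taylor expansion in the decay rate around `t`. Its terms and its error are again of the form
`x ^ j * exp (-t x)`, which the quadrature at rate `t` controls through the moments. -/
lemma abs_mul_exp_sub_sum_le (k J : ℕ) {t h x : ℝ} (hh : 0 ≤ h) (hx : 0 ≤ x) :
    |x ^ k * Real.exp (-((t + h) * x)) - ∑ j ∈ Finset.range J,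
      (-h) ^ j / (j.factorial : ℝ) * (x ^ (k + j) * Real.exp (-(t * x)))| ≤
      h ^ J / (J.factorial : ℝ) * (x ^ (k + J) * Real.exp (-(t * x))) := by
  have h0 := abs_exp_neg_sub_taylor_le J (mul_nonneg hh hx)
  have e1 : x ^ k * Real.exp (-((t + h) * x)) - ∑ j ∈ Finset.range J,
      (-h) ^ j / (j.factorial : ℝ) * (x ^ (k + j) * Real.exp (-(t * x))) =
      x ^ k * Real.exp (-(t * x)) * (Real.exp (-(h * x)) -
        ∑ j ∈ Finset.range J, (-(h * x)) ^ j / (j.factorial : ℝ)) := by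
    rw [mul_sub, Finset.mul_sum, show -((t + h) * x) = -(t * x) + -(h * x) by ring, Real.exp_add]
    congr 1
    · ring
    · refine Finset.sum_congr rfl fun j _ => ?_
      rw [show -(h * x) = (-h) * x by ring, mul_pow, pow_add]
      ring
  rw [e1, abs_mul, abs_of_nonneg (by positivity : 0 ≤ x ^ k * Real.exp (-(t * x)))]
  refine (mul_le_mul_of_nonneg_left h0 (by positivity)).trans_eq ?_
  rw [mul_pow, pow_add]
  ring

/-- Positivity of the weights lets the pointwise Taylor bound pass through the quadrature sum. -/
lemma abs_quadMoment_sub_sum_le (M k J : ℕ) {t h : ℝ} (hh : 0 ≤ h) :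
    |quadMoment M k (t + h) - ∑ j ∈ Finset.range J,
      (-h) ^ j / (j.factorial : ℝ) * quadMoment M (k + j) t| ≤
      h ^ J / (J.factorial : ℝ) * quadMoment M (k + J) t := by
  have e : quadMoment M k (t + h) - ∑ j ∈ Finset.range J,
      (-h) ^ j / (j.factorial : ℝ) * quadMoment M (k + j) t =
      ∑ x ∈ laguerreNodes M, laguerreWeight M x *
        (x ^ k * Real.exp (-((t + h) * x)) - ∑ j ∈ Finset.range J,
          (-h) ^ j / (j.factorial : ℝ) * (x ^ (k + j) * Real.exp (-(t * x)))) := by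
    unfold quadMoment
    simp_rw [mul_sub, Finset.sum_sub_distrib, Finset.mul_sum]
    rw [Finset.sum_comm]
    congr 1
    exact Finset.sum_congr rfl fun _ _ => Finset.sum_congr rfl fun _ _ => by ring
  rw [e, quadMoment, Finset.mul_sum]
  refine (Finset.abs_sum_le_sum_abs _ _).trans (Finset.sum_le_sum fun x hx => ?_)
  have hw := laguerreWeight_nonneg hx
  rw [abs_mul, abs_of_nonneg hw]
  refine (mul_le_mul_of_nonneg_left (abs_mul_exp_sub_sum_le k J hh
    ((laguerreNodes_card_and_pos M).2 x hx).le) hw).trans_eq ?_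
  ring

lemma abs_expMoment_sub_sum_le (k J : ℕ) {t h : ℝ} (ht : 0 ≤ t) (hh : 0 ≤ h) :
    |expMoment k (t + h) - ∑ j ∈ Finset.range J,
      (-h) ^ j / (j.factorial : ℝ) * expMoment (k + j) t| ≤
      h ^ J / (J.factorial : ℝ) * expMoment (k + J) t := by
  have hi := fun n => (expMoment_eq_and_integrable n ht).2
  have hi2 := (expMoment_eq_and_integrable k (add_nonneg ht hh)).2
  have hi3 : ∀ j, IntegrableOn (fun x => (-h) ^ j / (j.factorial : ℝ) *
      (x ^ (k + j) * Real.exp (-(t * x)) * Real.exp (-x))) (Ioi 0) := fun j => (hi _).const_mul _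
  have e : expMoment k (t + h) - ∑ j ∈ Finset.range J,
      (-h) ^ j / (j.factorial : ℝ) * expMoment (k + j) t =
      ∫ x in Ioi (0 : ℝ), (x ^ k * Real.exp (-((t + h) * x)) * Real.exp (-x) -
        ∑ j ∈ Finset.range J, (-h) ^ j / (j.factorial : ℝ) *
          (x ^ (k + j) * Real.exp (-(t * x)) * Real.exp (-x))) := by
    rw [integral_sub hi2 (integrable_finsetSum _ fun j _ => hi3 j),
      integral_finsetSum _ fun j _ => hi3 j]
    simp_rw [integral_const_mul]
    rfl
  rw [e, expMoment, ← integral_const_mul, ← Real.norm_eq_abs]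
  refine norm_integral_le_of_norm_le ((hi _).const_mul _) ?_
  filter_upwards [ae_restrict_mem measurableSet_Ioi] with x hx
  have hb := abs_mul_exp_sub_sum_le (t := t) k J hh (le_of_lt hx)
  have e2 : x ^ k * Real.exp (-((t + h) * x)) * Real.exp (-x) -
        ∑ j ∈ Finset.range J, (-h) ^ j / (j.factorial : ℝ) *
          (x ^ (k + j) * Real.exp (-(t * x)) * Real.exp (-x)) =
      (x ^ k * Real.exp (-((t + h) * x)) - ∑ j ∈ Finset.range J,
      (-h) ^ j / (j.factorial : ℝ) * (x ^ (k + j) * Real.exp (-(t * x)))) * Real.exp (-x) := by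
    rw [sub_mul, Finset.sum_mul]
    congr 1
    exact Finset.sum_congr rfl fun _ _ => by ring
  rw [e2, Real.norm_eq_abs, abs_mul, abs_of_nonneg (Real.exp_nonneg (-x))]
  refine (mul_le_mul_of_nonneg_right hb (Real.exp_nonneg _)).trans_eq ?_
  ring

/-- The moment of order `k + J` is at most `(k + J)!`. After division by `J!` this grows like `J ^
k`, and the geometric factor wins precisely because `h < 1`. -/
lemma tendsto_pow_div_factorial_mul_expMoment (k : ℕ) {t h : ℝ} (ht : 0 ≤ t) (hh : 0 ≤ h)
    (hh1 : h < 1) :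
    Tendsto (fun J : ℕ => h ^ J / (J.factorial : ℝ) * expMoment (k + J) t) atTop (𝓝 0) := by
  have hs := (summable_choose_mul_geometric_of_norm_lt_one k (r := h)
    (by rwa [Real.norm_of_nonneg hh])).tendsto_atTop_zero.const_mul (k.factorial : ℝ)
  rw [mul_zero] at hs
  have e := fun n => (expMoment_eq_and_integrable n ht).1
  refine squeeze_zero (fun J => ?_) (fun J => ?_) hs
  · rw [e]
    positivity
  · rw [e]
    have h1 : ((k + J).factorial : ℝ) / (1 + t) ^ (k + J + 1) ≤ (k + J).factorial :=
      div_le_self (by positivity) (one_le_pow₀ (by linarith))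
    have h2 : ((k + J).factorial : ℝ) = ((J + k).choose k : ℝ) * k.factorial * J.factorial := by
      have := Nat.add_choose_mul_factorial_mul_factorial J k
      rw [show k + J = J + k by ring, ← this]
      push_cast
      ring
    calc h ^ J / (J.factorial : ℝ) * (((k + J).factorial : ℝ) / (1 + t) ^ (k + J + 1))
        ≤ h ^ J / (J.factorial : ℝ) * (k + J).factorial := by gcongr
      _ = _ := by
        rw [h2]
        field_simp

lemma tendsto_quadMoment_add {t h : ℝ} (ht : 0 ≤ t) (hh : 0 ≤ h) (hh1 : h < 1)
    (hlim : ∀ k, Tendsto (fun M => quadMoment M k t) atTop (𝓝 (expMoment k t))) (k : ℕ) :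
    Tendsto (fun M => quadMoment M k (t + h)) atTop (𝓝 (expMoment k (t + h))) := by
  rw [Metric.tendsto_nhds]
  intro ε hε
  -- Fix `J` so that the Taylor error of the integral is small. The same error for the quadrature
  -- converges to it by `hlim`, and so does the finite Taylor sum: three parts of size `ε / 3`.
  obtain ⟨J, hJ⟩ := ((tendsto_pow_div_factorial_mul_expMoment k ht hh hh1).eventually
    (gt_mem_nhds (show 0 < ε / 3 by positivity))).exists
  have h1 : ∀ᶠ M in atTop, h ^ J / (J.factorial : ℝ) * quadMoment M (k + J) t < ε / 3 :=
    ((hlim (k + J)).const_mul _).eventually (gt_mem_nhds hJ)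
  have h2 : Tendsto (fun M => ∑ j ∈ Finset.range J,
      (-h) ^ j / (j.factorial : ℝ) * quadMoment M (k + j) t) atTop (𝓝 (∑ j ∈ Finset.range J,
      (-h) ^ j / (j.factorial : ℝ) * expMoment (k + j) t)) :=
    tendsto_finsetSum _ fun j _ => (hlim (k + j)).const_mul _
  have h3 := Metric.tendsto_nhds.1 h2 (ε / 3) (by positivity)
  filter_upwards [h1, h3] with M h1 h3
  have h4 := abs_quadMoment_sub_sum_le (t := t) M k J hh
  have h5 := abs_expMoment_sub_sum_le k J ht hh
  rw [Real.dist_eq] at h3 ⊢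
  rw [abs_le] at h4 h5
  rw [abs_lt] at h3 ⊢
  constructor <;> linarith [h3.1, h3.2, h4.1, h4.2, h5.1, h5.2]

/-- Exactness on polynomials settles `t = 0`, but the Taylor estimate only carries the rate forward
by less than `1`. Hence the rate is advanced in steps of at most `1 / 2`. All moments `k` must be
carried along, since the expansion at one rate involves every moment at the previous one. -/
lemma tendsto_quadMoment {t : ℝ} (ht : 0 ≤ t) (k : ℕ) :
    Tendsto (fun M => quadMoment M k t) atTop (𝓝 (expMoment k t)) := by
  have key : ∀ n : ℕ, ∀ t : ℝ, 0 ≤ t → t ≤ n / 2 → ∀ k,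
      Tendsto (fun M => quadMoment M k t) atTop (𝓝 (expMoment k t)) := by
    intro n
    induction n with
    | zero =>
      intro t ht ht0 k
      obtain rfl : t = 0 := le_antisymm (by simpa using ht0) ht
      refine tendsto_const_nhds.congr' ?_
      -- At `t = 0` the rule is exact as soon as `k < 2M`, so the sequence is eventually constant.
      filter_upwards [eventually_gt_atTop k] with M hM
      have := sum_laguerreWeight (M := M) (p := Polynomial.X ^ k) (by simp; omega)
      simpa [quadMoment, expMoment, expMean_apply] using this.symm
    | succ n ih =>
      intro t ht htn k
      have h1 : 0 ≤ t - min t (1 / 2) := by linarith [min_le_left t (1 / 2 : ℝ)]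
      have h2 : t - min t (1 / 2) ≤ n / 2 := by
        push_cast at htn
        rcases le_total t (1 / 2) with h | h
        · rw [min_eq_left h]
          simp
          positivity
        · rw [min_eq_right h]
          linarith
      have := tendsto_quadMoment_add h1 (show 0 ≤ min t (1 / 2) by positivity)
        ((min_le_right t (1 / 2)).trans_lt (by norm_num)) (ih _ h1 h2) k
      simpa using this
  obtain ⟨n, hn⟩ := exists_nat_ge (2 * t)
  exact key n t ht (by linarith) k

/-- The Gauss-Laguerre quadrature converges for decaying exponentials. -/
theorem tendsto_quadrature_exp {t : ℝ} (ht : 0 ≤ t) :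
    Tendsto (fun M => ∑ x ∈ laguerreNodes M, laguerreWeight M x * Real.exp (-(t * x))) atTop
      (𝓝 (1 / (1 + t))) := by
  have := tendsto_quadMoment ht 0
  rw [(expMoment_eq_and_integrable 0 ht).1] at this
  simpa [quadMoment] using this

/-- Exactness for the constant `1` gives equality for `M > 0`; the rule of order `0` is empty. -/
lemma sum_laguerreWeight_le_one (M : ℕ) : ∑ x ∈ laguerreNodes M, laguerreWeight M x ≤ 1 := by
  rcases Nat.eq_zero_or_pos M with rfl | hM
  · have : laguerreNodes 0 = ∅ := Finset.card_eq_zero.1 (laguerreNodes_card_and_pos 0).1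
    simp [this]
  · have := sum_laguerreWeight (M := M) (p := 1) (by simpa using hM)
    have h1 := expMean_X_pow 0
    simp only [pow_zero, Nat.factorial_zero, Nat.cast_one] at h1
    rw [h1] at this
    simpa using this.le

/-! ### The mean of the logarithm as an integral of exponentials. -/

section

lemma gKer_nonneg {i z : ℝ} (hi : 0 ≤ i) (hz : 0 < z) : 0 ≤ gKer i z := by
  unfold gKer
  refine mul_nonneg (by positivity) (sub_nonneg.2 ?_)
  rw [div_le_one (by positivity)]
  exact Real.one_le_rpow (by linarith) hi

/-- `(1 + z)^{-i} = e^{-i log(1 + z)} ≥ 1 - i log(1 + z) ≥ 1 - i z`. -/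
lemma gKer_le {i z : ℝ} (hi : 0 ≤ i) (hz : 0 < z) : gKer i z ≤ i := by
  unfold gKer
  rw [one_div_mul_eq_div, div_le_iff₀ hz, one_div, ← Real.rpow_neg (by positivity)]
  have h1 : Real.log (1 + z) ≤ z := by
    have := Real.log_le_sub_one_of_pos (show 0 < 1 + z by positivity)
    linarith
  have h2 := Real.one_sub_le_exp_neg (i * Real.log (1 + z))
  rw [Real.rpow_def_of_pos (by positivity), show Real.log (1 + z) * -i = -(i * Real.log (1 + z)) by
    ring]
  nlinarith [mul_le_mul_of_nonneg_left h1 hi]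

lemma measurable_gKer (i : ℝ) : Measurable (gKer i) := by
  unfold gKer
  fun_prop

namespace Fading

lemma Valid.summable_weight_mul_gKer {F : Fading} (hF : F.Valid) {z : ℝ} (hz : 0 < z) :
    Summable fun n => F.weight n * gKer (F.order n) z :=
  hF.summable_weight_mul_order.of_nonneg_of_le
    (fun n => mul_nonneg (hF.weight_nonneg n) (gKer_nonneg (hF.order_pos n).le hz))
    (fun n => mul_le_mul_of_nonneg_left (gKer_le (hF.order_pos n).le hz) (hF.weight_nonneg n))

/-- This is where the kernels come from: a Gamma component of shape `i` contributes `1 - (1 +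
z)^{-i} = z g_i(z)` with `z = scale * u`. -/
lemma Valid.integral_law_one_sub_exp {F : Fading} (hF : F.Valid) [IsProbabilityMeasure F.law]
    {u : ℝ} (hu : 0 < u) :
    1 - ∫ x, Real.exp (-(u * x)) ∂F.law =
      F.scale * u * ∑' n, F.weight n * gKer (F.order n) (F.scale * u) := by
  have hc := hF.scale_pos
  have hz : 0 < F.scale * u := mul_pos hc hu
  have h := hF.lintegral_law_exp hu.le
  have hle : ∀ n, (1 + F.scale * u) ^ (-F.order n) ≤ 1 := fun n =>
    Real.rpow_le_one_of_one_le_of_nonpos (by linarith) (neg_nonpos.2 (hF.order_pos n).le)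
  have hs : Summable fun n => F.weight n * (1 + F.scale * u) ^ (-F.order n) :=
    hF.summable_weight.of_nonneg_of_le
      (fun n => mul_nonneg (hF.weight_nonneg n) (by positivity))
      (fun n => mul_le_of_le_one_right (hF.weight_nonneg n) (hle n))
  rw [integral_eq_lintegral_of_nonneg_ae (Eventually.of_forall fun x => Real.exp_nonneg _)
    (by fun_prop), h, ← ENNReal.ofReal_tsum_of_nonneg
      (fun n => mul_nonneg (hF.weight_nonneg n) (by positivity)) hs, ENNReal.toReal_ofReal
      (tsum_nonneg fun n => mul_nonneg (hF.weight_nonneg n) (by positivity)),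
    ← tsum_mul_left]
  refine ((hF.hasSum_weight.sub hs.hasSum).tsum_eq).symm.trans (tsum_congr fun n => ?_)
  unfold gKer
  rw [Real.rpow_neg (by positivity)]
  field_simp

end Fading

lemma setLIntegral_Ioc_exp {a b w : ℝ} (ha : 0 < a) (hw : 0 ≤ w) :
    ∫⁻ t in Ioc 0 w, ENNReal.ofReal (Real.exp (-(a * (t + b)))) =
      ENNReal.ofReal (1 / a * ((1 - Real.exp (-(a * w))) * Real.exp (-(a * b)))) := by
  have hc : Continuous fun t => Real.exp (-(a * (t + b))) := by fun_prop
  rw [← ofReal_integral_eq_lintegral_ofReal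
    ((hc.integrableOn_Icc (a := 0) (b := w)).mono_set Ioc_subset_Icc_self)
    (Eventually.of_forall fun t => Real.exp_nonneg _), ← intervalIntegral.integral_of_le hw,
    intervalIntegral.integral_eq_sub_of_hasDerivAt (f := fun t => -(1 / a) *
      Real.exp (-(a * (t + b)))) (fun t _ => ?_) (hc.intervalIntegrable _ _)]
  · congr 1
    rw [zero_add, show -(a * (w + b)) = -(a * w) + -(a * b) by ring, Real.exp_add]
    ring
  · have h1 : HasDerivAt (fun t => -(a * (t + b))) (-(a * 1)) t :=
      (((hasDerivAt_id t).add_const b).const_mul a).neg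
    refine (h1.exp.const_mul (-(1 / a))).congr_deriv ?_
    field_simp

lemma setLIntegral_Ioc_inv {n b w : ℝ} (hn : 0 < n) (hb : 0 ≤ b) (hw : 0 ≤ w) :
    ∫⁻ t in Ioc 0 w, ENNReal.ofReal (1 / (1 + (t + b) / n)) =
      ENNReal.ofReal (n * Real.log (1 + w / (b + n))) := by
  have hpos : ∀ t ∈ Icc 0 w, 0 < 1 + (t + b) / n := fun t ht => by
    have := ht.1
    positivity
  have hc : ContinuousOn (fun t => 1 / (1 + (t + b) / n)) (Icc 0 w) := by
    refine ContinuousOn.div (by fun_prop) (by fun_prop) fun t ht => (hpos t ht).ne'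
  rw [← ofReal_integral_eq_lintegral_ofReal (hc.integrableOn_Icc.mono_set Ioc_subset_Icc_self),
    ← intervalIntegral.integral_of_le hw,
    intervalIntegral.integral_eq_sub_of_hasDerivAt (f := fun t => n * Real.log (t + b + n))]
  · congr 1
    rw [← mul_sub, ← Real.log_div (by positivity) (by positivity)]
    congr 2
    field_simp
    ring
  · intro t ht
    rw [uIcc_of_le hw] at ht
    have := ht.1
    have h1 : HasDerivAt (fun t => t + b + n) 1 t := ((hasDerivAt_id t).add_const b).add_const n
    refine ((h1.log (by positivity)).const_mul n).congr_deriv ?_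
    field_simp
    ring
  · exact (hc.mono (uIcc_of_le hw).le).intervalIntegrable
  · filter_upwards [ae_restrict_mem measurableSet_Ioc] with t ht
    exact (one_div_pos.2 (hpos t (Ioc_subset_Icc_self ht))).le

section LogMean

variable {Ω : Type*} [MeasurableSpace Ω]

/-- The measure `P ⊗ dt` on the region under the graph of `W`. -/
def underGraph (P : Measure Ω) (W : Ω → ℝ) : Measure (Ω × ℝ) :=
  (P.prod volume).restrict {z | 0 < z.2 ∧ z.2 ≤ W z.1}

variable {P : Measure Ω} {W : Ω → ℝ} {I : Ω → ℝ≥0∞} {N₀ : ℝ}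

lemma measurableSet_underGraph (hW : Measurable W) :
    MeasurableSet {z : Ω × ℝ | 0 < z.2 ∧ z.2 ≤ W z.1} :=
  (measurableSet_lt measurable_const measurable_snd).inter
    (measurableSet_le measurable_snd (hW.comp measurable_fst))

lemma lintegral_underGraph (hW : Measurable W) {g : Ω × ℝ → ℝ≥0∞} (hg : Measurable g) :
    ∫⁻ z, g z ∂underGraph P W = ∫⁻ ω, ∫⁻ t in Ioc 0 (W ω), g (ω, t) ∂volume ∂P := by
  have hm := measurableSet_underGraph hW
  rw [underGraph, ← lintegral_indicator hm, lintegral_prod _ (hg.indicator hm).aemeasurable]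
  refine lintegral_congr fun ω => ?_
  rw [← lintegral_indicator measurableSet_Ioc]
  rfl

variable (I N₀) in
/-- The normalized sum of a power and the interference. -/
def normInterf (z : Ω × ℝ) : ℝ := (z.2 + (I z.1).toReal) / N₀

lemma measurable_normInterf (hI : Measurable I) : Measurable (normInterf I N₀) := by
  unfold normInterf
  fun_prop

lemma ae_normInterf_nonneg (hW : Measurable W) (hN : 0 < N₀) :
    ∀ᵐ z ∂underGraph P W, 0 ≤ normInterf I N₀ z := by
  filter_upwards [ae_restrict_mem (measurableSet_underGraph hW)] with z hz
  have h1 : 0 < z.2 := hz.1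
  have h2 : 0 ≤ (I z.1).toReal := ENNReal.toReal_nonneg
  unfold normInterf
  positivity

variable {F : Fading}

lemma integrable_of_hasLaw_fading (hF : F.Valid) (hWm : Measurable W) (hW : HasLaw W F.law P) :
    (∀ᵐ ω ∂P, 0 < W ω) ∧ ∫⁻ ω, ENNReal.ofReal (W ω) ∂P < ∞ ∧ Integrable W P := by
  have h1 : ∀ᵐ ω ∂P, 0 < W ω :=
    (hW.ae_iff (p := fun x => 0 < x) (measurableSet_setOfPred.1 measurableSet_Ioi)).2
      Fading.ae_law_pos
  have h2 : ∫⁻ ω, ENNReal.ofReal (W ω) ∂P < ∞ := by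
    rw [hW.lintegral_comp (f := fun x => ENNReal.ofReal x) (by fun_prop)]
    exact hF.lintegral_law_id_lt_top
  refine ⟨h1, h2, hWm.aestronglyMeasurable, ?_⟩
  rwa [hasFiniteIntegral_iff_ofReal (h1.mono fun ω h => h.le)]

lemma log_mean_nonneg_le (hN : 0 < N₀) {w i : ℝ} (hw : 0 ≤ w) (hi : 0 ≤ i) :
    0 ≤ Real.log (1 + w / (i + N₀)) ∧ Real.log (1 + w / (i + N₀)) ≤ w / N₀ := by
  have h : 0 ≤ w / (i + N₀) := by positivity
  refine ⟨Real.log_nonneg (by linarith), ?_⟩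
  have h1 := Real.log_le_sub_one_of_pos (show 0 < 1 + w / (i + N₀) by positivity)
  have h2 : w / (i + N₀) ≤ w / N₀ := by
    gcongr
    linarith
  linarith

lemma laplace_nonneg (s : ℝ) : 0 ≤ laplace P I s := integral_nonneg fun _ => Real.exp_nonneg _

lemma integrable_log (hF : F.Valid) (hWm : Measurable W) (hW : HasLaw W F.law P)
    (hI : Measurable I) (hN : 0 < N₀) :
    Integrable (fun ω => Real.log (1 + W ω / ((I ω).toReal + N₀))) P := by
  obtain ⟨h1, -, h3⟩ := integrable_of_hasLaw_fading hF hWm hW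
  refine (h3.div_const N₀).mono' (Measurable.aestronglyMeasurable (by fun_prop))
    (h1.mono fun ω hω => ?_)
  have := log_mean_nonneg_le hN hω.le (i := (I ω).toReal) ENNReal.toReal_nonneg
  rw [Real.norm_of_nonneg this.1]
  exact this.2

/-- `log (t + I + N₀)` is a primitive of `1 / (t + I + N₀)`, so integrating over `0 < t ≤ W`
recovers the logarithm up to the factor `N₀`. -/
lemma lintegral_inv_underGraph (hF : F.Valid) (hWm : Measurable W) (hW : HasLaw W F.law P)
    (hI : Measurable I) (hN : 0 < N₀) :
    ∫⁻ z, ENNReal.ofReal (1 / (1 + normInterf I N₀ z)) ∂underGraph P W =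
      ENNReal.ofReal (N₀ * ∫ ω, Real.log (1 + W ω / ((I ω).toReal + N₀)) ∂P) := by
  have h1 := (integrable_of_hasLaw_fading hF hWm hW).1
  have hm := measurable_normInterf (N₀ := N₀) hI
  rw [lintegral_underGraph hWm (by fun_prop), ← integral_const_mul,
    ofReal_integral_eq_lintegral_ofReal ((integrable_log hF hWm hW hI hN).const_mul _)]
  · refine lintegral_congr_ae (h1.mono fun ω hω => ?_)
    have := setLIntegral_Ioc_inv hN (b := (I ω).toReal) ENNReal.toReal_nonneg hω.le
    simpa only [normInterf] using this
  · filter_upwards [h1] with ω hω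
    exact mul_nonneg hN.le (log_mean_nonneg_le hN hω.le ENNReal.toReal_nonneg).1

variable [IsProbabilityMeasure P]

/-- With `u = x / N₀`, the integral of `e^{-u(t + I)}` over `0 < t ≤ W` is `(1 - e^{-uW}) e^{-uI} /
u`. Independence splits its mean into the kernel series of the fading law and the Laplace transform
of `I`. -/
lemma lintegral_exp_underGraph (hF : F.Valid) (hWm : Measurable W) (hW : HasLaw W F.law P)
    (hI : Measurable I) (hind : IndepFun W I P) (hN : 0 < N₀) {x : ℝ} (hx : 0 < x) :
    ∫⁻ z, ENNReal.ofReal (Real.exp (-(x * normInterf I N₀ z))) ∂underGraph P W =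
      ENNReal.ofReal (F.scale * (∑' n, F.weight n * gKer (F.order n) (F.scale / N₀ * x)) *
        laplace P I (x / N₀)) := by
  have h1 := (integrable_of_hasLaw_fading hF hWm hW).1
  have hlaw : IsProbabilityMeasure F.law := hW.isProbabilityMeasure_iff.1 inferInstance
  have hm := measurable_normInterf (N₀ := N₀) hI
  have hu : 0 < x / N₀ := by positivity
  rw [lintegral_underGraph hWm (by fun_prop)]
  have e1 : ∀ᵐ ω ∂P, ∫⁻ t in Ioc 0 (W ω),
      ENNReal.ofReal (Real.exp (-(x * normInterf I N₀ (ω, t)))) =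
      ENNReal.ofReal (1 / (x / N₀) * ((1 - Real.exp (-(x / N₀ * W ω))) *
        Real.exp (-(x / N₀ * (I ω).toReal)))) := by
    filter_upwards [h1] with ω hω
    rw [← setLIntegral_Ioc_exp hu hω.le]
    refine lintegral_congr fun t => ?_
    unfold normInterf
    ring_nf
  have hb1 : ∀ᵐ ω ∂P, 0 ≤ 1 - Real.exp (-(x / N₀ * W ω)) := by
    filter_upwards [h1] with ω hω
    have : 0 ≤ x / N₀ * W ω := by positivity
    simpa using this
  have hi2 : Integrable (fun ω => Real.exp (-(x / N₀ * W ω))) P := by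
    refine (integrable_const (1 : ℝ)).mono' (Measurable.aestronglyMeasurable (by fun_prop))
      (hb1.mono fun ω hω => ?_)
    rw [Real.norm_of_nonneg (Real.exp_nonneg _)]
    linarith
  have hi1 : Integrable (fun ω => 1 - Real.exp (-(x / N₀ * W ω))) P :=
    (integrable_const _).sub hi2
  have hi3 : Integrable (fun ω => Real.exp (-(x / N₀ * (I ω).toReal))) P := by
    refine (integrable_const (1 : ℝ)).mono' (Measurable.aestronglyMeasurable (by fun_prop))
      (Eventually.of_forall fun ω => ?_)
    have : 0 ≤ x / N₀ * (I ω).toReal := mul_nonneg hu.le ENNReal.toReal_nonneg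
    rw [Real.norm_of_nonneg (Real.exp_nonneg _)]
    simpa using this
  have hind' : IndepFun (fun ω => 1 - Real.exp (-(x / N₀ * W ω)))
      (fun ω => Real.exp (-(x / N₀ * (I ω).toReal))) P :=
    hind.comp (φ := fun w => 1 - Real.exp (-(x / N₀ * w)))
      (ψ := fun i : ℝ≥0∞ => Real.exp (-(x / N₀ * i.toReal))) (by fun_prop) (by fun_prop)
  have hE : ∫ ω, Real.exp (-(x / N₀ * W ω)) ∂P = ∫ w, Real.exp (-(x / N₀ * w)) ∂F.law := by
    exact hW.integral_comp (f := fun w => Real.exp (-(x / N₀ * w))) (by fun_prop)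
  have hi4 : Integrable (fun ω => 1 / (x / N₀) * ((1 - Real.exp (-(x / N₀ * W ω))) *
        Real.exp (-(x / N₀ * (I ω).toReal)))) P := (hind'.integrable_mul hi1 hi3).const_mul _
  rw [lintegral_congr_ae e1, ← ofReal_integral_eq_lintegral_ofReal hi4, integral_const_mul,
    hind'.integral_fun_mul_eq_mul_integral hi1.aestronglyMeasurable hi3.aestronglyMeasurable,
    integral_sub (integrable_const _) hi2, hE]
  · simp only [integral_const, probReal_univ, smul_eq_mul, mul_one]
    rw [hF.integral_law_one_sub_exp hu, show F.scale / N₀ * x = F.scale * (x / N₀) by ring]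
    change ENNReal.ofReal (_ * (_ * laplace P I (x / N₀))) = _
    congr 1
    field_simp
  · filter_upwards [hb1] with ω hω
    have := mul_nonneg hω (Real.exp_nonneg (-(x / N₀ * (I ω).toReal)))
    positivity

lemma measurable_laplace (hI : Measurable I) : Measurable (laplace P I) := by
  have : StronglyMeasurable (Function.uncurry fun (s : ℝ) (ω : Ω) =>
      Real.exp (-(s * (I ω).toReal))) := by
    refine Measurable.stronglyMeasurable ?_
    unfold Function.uncurry
    fun_prop
  exact this.integral_prod_right.measurable

lemma laplace_le_one {s : ℝ} (hs : 0 ≤ s) : laplace P I s ≤ 1 := by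
  unfold laplace
  have h : ∀ ω, Real.exp (-(s * (I ω).toReal)) ≤ 1 := fun ω => by
    simpa using mul_nonneg hs ENNReal.toReal_nonneg
  by_cases hi : Integrable (fun ω => Real.exp (-(s * (I ω).toReal))) P
  · simpa using integral_mono hi (integrable_const (1 : ℝ)) h
  · rw [integral_undef hi]
    exact zero_le_one

/-- The evaluation of `E[log (1 + W / (I + N₀))]` for an interference `I` that is independent of
the power `W` of the intended link. -/
theorem evaluatesLogMean (hF : F.Valid) (hWm : Measurable W) (hW : HasLaw W F.law P)
    (hI : Measurable I) (hind : IndepFun W I P) (hN : 0 < N₀) :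
    EvaluatesLogMean P W I N₀ F := by
  have hc := hF.scale_pos
  obtain ⟨h1, hfin, h3⟩ := integrable_of_hasLaw_fading hF hWm hW
  have hm := measurable_normInterf (N₀ := N₀) hI
  have hnn := ae_normInterf_nonneg (P := P) (I := I) hWm hN
  have hLm := measurable_laplace (P := P) hI
  -- The total mass is `E W`, so constants are admissible dominating functions below.
  have hfinρ : IsFiniteMeasure (underGraph P W) := by
    refine ⟨?_⟩
    rw [← lintegral_one, lintegral_underGraph hWm measurable_const]
    simpa using hfin
  have hlog := integrable_log hF hWm hW hI hN
  have hlog0 : 0 ≤ ∫ ω, Real.log (1 + W ω / ((I ω).toReal + N₀)) ∂P :=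
    integral_nonneg_of_ae (h1.mono fun ω hω =>
      (log_mean_nonneg_le hN hω.le ENNReal.toReal_nonneg).1)
  have hg0 : ∀ n, ∀ x ∈ Ioi (0 : ℝ), 0 ≤ gKer (F.order n) (F.scale / N₀ * x) := fun n x hx =>
    gKer_nonneg (hF.order_pos n).le (mul_pos (by positivity) hx)
  have hterm0 : ∀ n, ∀ x ∈ Ioi (0 : ℝ),
      0 ≤ gKer (F.order n) (F.scale / N₀ * x) * laplace P I (x / N₀) * Real.exp (-x) :=
    fun n x hx => mul_nonneg (mul_nonneg (hg0 n x hx) (laplace_nonneg _)) (Real.exp_nonneg _)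
  have htermm : ∀ n, Measurable fun x =>
      gKer (F.order n) (F.scale / N₀ * x) * laplace P I (x / N₀) * Real.exp (-x) := fun n => by
    have := measurable_gKer (F.order n)
    fun_prop
  have hint : ∀ n : ℕ, IntegrableOn (fun x => gKer (F.order n) (F.scale / N₀ * x) *
      laplace P I (x / N₀) * Real.exp (-x)) (Ioi 0) := by
    intro n
    have hexp : IntegrableOn (fun x : ℝ => F.order n * Real.exp (-x)) (Ioi 0) :=
      (integrableOn_exp_neg_Ioi 0).const_mul _
    refine Integrable.mono' hexp (htermm n).aestronglyMeasurable ?_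
    filter_upwards [ae_restrict_mem measurableSet_Ioi] with x hx
    have hx : 0 < x := hx
    rw [Real.norm_of_nonneg (hterm0 n x hx)]
    refine mul_le_mul_of_nonneg_right ?_ (Real.exp_nonneg _)
    exact (mul_le_of_le_one_right (hg0 n x hx) (laplace_le_one (by positivity))).trans
      (gKer_le (hF.order_pos n).le (by positivity))
  have hinv := lintegral_inv_underGraph hF hWm hW hI hN
  have hG := fun x hx => lintegral_exp_underGraph hF hWm hW hI hind hN (x := x) hx
  refine ⟨hlog, hint, ?_, ?_, laguerreNodes_card_and_pos, ?_⟩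
  · have hw0 : ∀ n, 0 ≤ F.scale / N₀ * F.weight n := fun n =>
      mul_nonneg (by positivity) (hF.weight_nonneg n)
    -- Summation and both integrations are exchanged in `[0, ∞]`, where no integrability is needed;
    -- what remains is `∫ e^{-(1 + Y) x} dx = 1 / (1 + Y)`.
    have hkey : ∑' n : ℕ, ENNReal.ofReal (F.scale * F.weight n) *
        ∫⁻ x in Ioi (0 : ℝ), ENNReal.ofReal (gKer (F.order n) (F.scale / N₀ * x) *
          laplace P I (x / N₀) * Real.exp (-x)) =
        ENNReal.ofReal (N₀ * ∫ ω, Real.log (1 + W ω / ((I ω).toReal + N₀)) ∂P) := by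
      rw [← hinv]
      have e1 : ∀ n, ENNReal.ofReal (F.scale * F.weight n) *
          ∫⁻ x in Ioi (0 : ℝ), ENNReal.ofReal (gKer (F.order n) (F.scale / N₀ * x) *
          laplace P I (x / N₀) * Real.exp (-x)) = ∫⁻ x in Ioi (0 : ℝ),
          ENNReal.ofReal (F.scale * F.weight n) *
            ENNReal.ofReal (gKer (F.order n) (F.scale / N₀ * x) *
          laplace P I (x / N₀) * Real.exp (-x)) := fun n =>
        (lintegral_const_mul _ (htermm n).ennreal_ofReal).symm
      simp_rw [e1]
      rw [← lintegral_tsum fun n => ((htermm n).ennreal_ofReal.const_mul _).aemeasurable]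
      have e2 : ∀ x ∈ Ioi (0 : ℝ), ∑' n, ENNReal.ofReal (F.scale * F.weight n) *
            ENNReal.ofReal (gKer (F.order n) (F.scale / N₀ * x) *
          laplace P I (x / N₀) * Real.exp (-x)) =
          ∫⁻ z, ENNReal.ofReal (Real.exp (-((1 + normInterf I N₀ z) * x))) ∂underGraph P W := by
        intro x hx
        have hx' : 0 < F.scale / N₀ * x := mul_pos (by positivity) hx
        have hsum := hF.summable_weight_mul_gKer hx'
        have e3 : ∀ z, ENNReal.ofReal (Real.exp (-((1 + normInterf I N₀ z) * x))) =
            ENNReal.ofReal (Real.exp (-(x * normInterf I N₀ z))) *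
              ENNReal.ofReal (Real.exp (-x)) := by
          intro z
          rw [← ENNReal.ofReal_mul (Real.exp_nonneg _), ← Real.exp_add]
          ring_nf
        simp_rw [e3]
        rw [lintegral_mul_const _ (by fun_prop), hG x hx,
          ← ENNReal.ofReal_mul (mul_nonneg (mul_nonneg hc.le (tsum_nonneg fun n =>
            mul_nonneg (hF.weight_nonneg n) (hg0 n x hx))) (laplace_nonneg _)),
          show F.scale * (∑' n, F.weight n * gKer (F.order n) (F.scale / N₀ * x)) *
            laplace P I (x / N₀) * Real.exp (-x) =
            ∑' n, F.weight n * gKer (F.order n) (F.scale / N₀ * x) *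
              (F.scale * (laplace P I (x / N₀) * Real.exp (-x))) by
            rw [tsum_mul_right]; ring,
          ENNReal.ofReal_tsum_of_nonneg _ (hsum.mul_right _)]
        · refine tsum_congr fun n => ?_
          rw [← ENNReal.ofReal_mul (mul_nonneg hc.le (hF.weight_nonneg n))]
          ring_nf
        · intro n
          exact mul_nonneg (mul_nonneg (hF.weight_nonneg n) (hg0 n x hx))
            (mul_nonneg hc.le (mul_nonneg (laplace_nonneg _) (Real.exp_nonneg _)))
      rw [setLIntegral_congr_fun measurableSet_Ioi e2, lintegral_lintegral_swap (by fun_prop)]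
      refine lintegral_congr_ae (hnn.mono fun z hz => ?_)
      have := lintegral_rpow_mul_exp_neg_mul_Ioi one_pos (show 0 < 1 + normInterf I N₀ z by
        linarith)
      simpa using this
    have hne : ∑' n : ℕ, ENNReal.ofReal (F.scale * F.weight n) *
        ∫⁻ x in Ioi (0 : ℝ), ENNReal.ofReal (gKer (F.order n) (F.scale / N₀ * x) *
          laplace P I (x / N₀) * Real.exp (-x)) ≠ ∞ := by
      rw [hkey]
      exact ENNReal.ofReal_ne_top
    have hs := (ENNReal.hasSum_toReal hne).mul_left (1 / N₀)
    rw [← ENNReal.tsum_toReal_eq (ENNReal.ne_top_of_tsum_ne_top hne), hkey,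
      ENNReal.toReal_ofReal (mul_nonneg hN.le hlog0), ← mul_assoc,
      one_div_mul_cancel hN.ne', one_mul] at hs
    refine hs.congr_fun fun n => ?_
    rw [ENNReal.toReal_mul, ENNReal.toReal_ofReal (mul_nonneg hc.le (hF.weight_nonneg n)),
      integral_eq_lintegral_of_nonneg_ae _ (htermm n).aestronglyMeasurable]
    · ring
    · filter_upwards [ae_restrict_mem measurableSet_Ioi] with x hx
      exact hterm0 n x hx
  · intro x hx
    exact hF.summable_weight_mul_gKer (by positivity)
  · have hint2 : ∀ x, 0 < x →
        Integrable (fun z => Real.exp (-(x * normInterf I N₀ z))) (underGraph P W) := by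
      intro x hx
      refine (integrable_const (1 : ℝ)).mono' (Measurable.aestronglyMeasurable (by fun_prop))
        (hnn.mono fun z hz => ?_)
      rw [Real.norm_of_nonneg (Real.exp_nonneg _)]
      simpa using mul_nonneg hx.le hz
    -- At a node `x` the kernel series times the Laplace transform is the integral of `e^{-xY}`, so
    -- the whole sum is the integral of the quadrature rule applied to `x ↦ e^{-xY}`.
    have hQ : ∀ M, F.scale / N₀ * ∑ x ∈ laguerreNodes M, ∑' n : ℕ,
        laguerreWeight M x * F.weight n * gKer (F.order n) (F.scale / N₀ * x) *
          laplace P I (x / N₀) = 1 / N₀ * ∫ z, ∑ x ∈ laguerreNodes M,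
            laguerreWeight M x * Real.exp (-(normInterf I N₀ z * x)) ∂underGraph P W := by
      intro M
      have hpos := (laguerreNodes_card_and_pos M).2
      rw [integral_finsetSum _ fun x hx => by
        simpa only [mul_comm x] using (hint2 x (hpos x hx)).const_mul (laguerreWeight M x),
        Finset.mul_sum, Finset.mul_sum]
      refine Finset.sum_congr rfl fun x hx => ?_
      have hx0 := hpos x hx
      simp_rw [mul_comm _ x]
      rw [integral_const_mul, integral_eq_lintegral_of_nonneg_ae
        (Eventually.of_forall fun z => Real.exp_nonneg _) (by fun_prop), hG x hx0,
        ENNReal.toReal_ofReal (mul_nonneg (mul_nonneg hc.le (tsum_nonneg fun n =>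
            mul_nonneg (hF.weight_nonneg n) (hg0 n x hx0))) (laplace_nonneg _)), tsum_mul_right]
      simp_rw [mul_assoc (laguerreWeight M x)]
      rw [tsum_mul_left]
      ring_nf
    simp_rw [hQ]
    have hval : ∫ z, 1 / (1 + normInterf I N₀ z) ∂underGraph P W =
        N₀ * ∫ ω, Real.log (1 + W ω / ((I ω).toReal + N₀)) ∂P := by
      rw [integral_eq_lintegral_of_nonneg_ae (hnn.mono fun z hz => by
        change 0 ≤ 1 / (1 + normInterf I N₀ z)
        positivity) (Measurable.aestronglyMeasurable (by fun_prop)), hinv,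
        ENNReal.toReal_ofReal (mul_nonneg hN.le hlog0)]
    -- The rule is bounded by `1` on these functions, as its nonnegative weights sum to at most `1`
    -- and its nodes are positive.
    have hlim : Tendsto (fun M => ∫ z, ∑ x ∈ laguerreNodes M,
        laguerreWeight M x * Real.exp (-(normInterf I N₀ z * x)) ∂underGraph P W) atTop
        (𝓝 (∫ z, 1 / (1 + normInterf I N₀ z) ∂underGraph P W)) := by
      refine tendsto_integral_of_dominated_convergence (fun _ => (1 : ℝ))
        (fun M => by fun_prop) (integrable_const _) (fun M => hnn.mono fun z hz => ?_)
        (hnn.mono fun z hz => tendsto_quadrature_exp hz)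
      have hpos := (laguerreNodes_card_and_pos M).2
      rw [Real.norm_of_nonneg (Finset.sum_nonneg fun x hx =>
        mul_nonneg (laguerreWeight_nonneg hx) (Real.exp_nonneg _))]
      refine (Finset.sum_le_sum fun x hx => ?_).trans (sum_laguerreWeight_le_one M)
      refine mul_le_of_le_one_right (laguerreWeight_nonneg hx) ?_
      simpa using mul_nonneg hz (hpos x hx).le
    have := hlim.const_mul (1 / N₀)
    rwa [hval, ← mul_assoc, one_div_mul_cancel hN.ne', one_mul] at this

end LogMean

end

/-! ### The kernels of integer index as derivatives. -/

lemma gKer_natCast (k : ℕ) (z : ℝ) : gKer k z = 1 / z * (1 - 1 / (1 + z) ^ k) := by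
  rw [gKer, Real.rpow_natCast]

lemma iteratedDeriv_id_mul {f : ℝ → ℝ} {z : ℝ} {n : ℕ} (hf : ContDiffAt ℝ (n + 2 : ℕ) f z) :
    iteratedDeriv (n + 2) (fun y => y * f y) z =
      z * iteratedDeriv (n + 2) f z + (n + 2) * iteratedDeriv (n + 1) f z := by
  rw [iteratedDeriv_fun_mul (f := fun y : ℝ => y) contDiffAt_fun_id hf, Finset.sum_range_succ',
    Finset.sum_range_succ', Finset.sum_eq_zero]
  · have h0 := iteratedDeriv_id (𝕜 := ℝ) (n := 0) (x := z)
    have h1 := iteratedDeriv_id (𝕜 := ℝ) (n := 1) (x := z)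
    simp only [Function.id_def] at h0 h1
    simp [h0, h1]
    ring
  · intro i _
    have h := iteratedDeriv_id (𝕜 := ℝ) (n := i + 2) (x := z)
    simp only [Function.id_def] at h
    simp [h]

lemma contDiffAt_pow_mul_log (n : ℕ) {z : ℝ} (hz : 0 < z) {m : ℕ} :
    ContDiffAt ℝ m (fun y : ℝ => y ^ n * Real.log (1 + y)) z :=
  (contDiffAt_fun_id.pow n).mul ((contDiffAt_const.add contDiffAt_fun_id).log (by positivity))

/-- Writing `y^{n+1} log(1 + y) = y · y^n log(1 + y)`, only two terms of the Leibniz formula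
survive. They are the derivative of order `n + 1` of the previous function and its derivative, so
the recursion closes. -/
lemma iteratedDeriv_pow_mul_log (n : ℕ) : ∀ z : ℝ, 0 < z →
    iteratedDeriv (n + 1) (fun y : ℝ => y ^ n * Real.log (1 + y)) z =
      (n.factorial : ℝ) * (1 / z * (1 - 1 / (1 + z) ^ (n + 1))) := by
  induction n with
  | zero =>
    intro z hz
    have h1 : HasDerivAt (fun y : ℝ => 1 + y) 1 z := (hasDerivAt_id z).const_add 1
    have h2 := h1.log (show 1 + z ≠ 0 by positivity)
    simp only [pow_zero, one_mul, zero_add, iteratedDeriv_one, h2.deriv]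
    simp
    field_simp
    ring
  | succ n ih =>
    intro z hz
    have e : (fun y : ℝ => y ^ (n + 1) * Real.log (1 + y)) =
        fun y => y * (y ^ n * Real.log (1 + y)) := by
      funext y
      ring
    rw [e, iteratedDeriv_id_mul (contDiffAt_pow_mul_log n hz), ih z hz, iteratedDeriv_succ]
    -- The induction hypothesis holds on a neighbourhood of `z`, hence it may be differentiated.
    have hev : iteratedDeriv (n + 1) (fun y : ℝ => y ^ n * Real.log (1 + y)) =ᶠ[𝓝 z]
        fun z => (n.factorial : ℝ) * (1 / z * (1 - 1 / (1 + z) ^ (n + 1))) := by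
      filter_upwards [lt_mem_nhds hz] with y hy
      exact ih y hy
    have h1 : HasDerivAt (fun y : ℝ => 1 + y) 1 z := (hasDerivAt_id z).const_add 1
    have h2 := ((hasDerivAt_const z (1 : ℝ)).div (hasDerivAt_id z) hz.ne').mul
      ((hasDerivAt_const z (1 : ℝ)).sub ((hasDerivAt_const z (1 : ℝ)).div (h1.pow (n + 1))
        (show (1 + z) ^ (n + 1) ≠ 0 by positivity)))
    have h3 : deriv (fun z => (n.factorial : ℝ) * (1 / z * (1 - 1 / (1 + z) ^ (n + 1)))) z = _ :=
      (h2.const_mul (n.factorial : ℝ)).deriv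
    rw [hev.deriv_eq, h3, Nat.factorial_succ]
    simp
    field_simp
    ring

/-- The kernels of the series for the mean are scaled derivatives. -/
theorem gKer_eq_iteratedDeriv {k : ℕ} (hk : 1 ≤ k) {z : ℝ} (hz : 0 < z) :
    1 / Real.Gamma k * iteratedDeriv k (fun y : ℝ => y ^ (k - 1) * Real.log (1 + y)) z =
      gKer k z := by
  obtain ⟨n, rfl⟩ := Nat.exists_eq_add_of_le' hk
  rw [gKer_natCast, Nat.add_sub_cancel, iteratedDeriv_pow_mul_log n z hz]
  push_cast
  rw [Real.Gamma_nat_eq_factorial]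
  have : (n.factorial : ℝ) ≠ 0 := by positivity
  field_simp

/-! ### The constant in the Laplace transform of the D2D interference. -/

lemma one_sub_negExp_ofReal {b : ℝ} (hb : 0 ≤ b) :
    1 - negExp (ENNReal.ofReal b) = ENNReal.ofReal (∫ t in (0 : ℝ)..b, Real.exp (-t)) := by
  rw [negExp_ofReal hb, ← ENNReal.ofReal_one, ← ENNReal.ofReal_sub _ (Real.exp_nonneg _)]
  congr 1
  rw [intervalIntegral.integral_comp_neg (fun t => Real.exp t)]
  simp

lemma volume_setOf_lt_mul_norm_rpow {a t τ : ℝ} (ha : 0 < a) (ht : 0 < t) (hτ : 0 < τ) :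
    volume {x : Plane | t < a * ‖x‖ ^ (-τ)} =
      ENNReal.ofReal (Real.pi * (a / t) ^ (2 / τ)) := by
  -- The origin drops out of the ball because `0 ^ (-τ) = 0` by convention; it is a null set.
  have hset : {x : Plane | t < a * ‖x‖ ^ (-τ)} = Metric.ball 0 ((a / t) ^ (1 / τ)) \ {0} := by
    ext x
    rcases eq_or_ne x 0 with rfl | hx
    · have h0 : (0 : ℝ) ^ (-τ) = 0 := Real.zero_rpow (neg_ne_zero.2 hτ.ne')
      simp [h0, ht.le]
    · have hn : 0 < ‖x‖ := norm_pos_iff.2 hx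
      have hp := Real.rpow_pos_of_pos hn τ
      simp only [mem_ofPred_eq, Set.mem_sdiff, Metric.mem_ball, dist_zero_right,
        mem_singleton_iff, hx,
        not_false_eq_true, and_true]
      rw [Real.rpow_neg hn.le, ← div_eq_mul_inv, lt_div_iff₀ hp,
        ← Real.rpow_lt_rpow_iff hn.le (by positivity) hτ, ← Real.rpow_mul (by positivity),
        one_div_mul_cancel hτ.ne', Real.rpow_one, lt_div_iff₀ ht, mul_comm]
  rw [hset, measure_sdiff_null (measure_singleton _), EuclideanSpace.volume_ball_fin_two,
    ← ENNReal.ofReal_pow (by positivity), ← Real.rpow_natCast, ← Real.rpow_mul (by positivity),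
    ← ENNReal.ofReal_mul (by positivity), mul_comm]
  congr 3
  push_cast
  ring

/-- The spatial integral that gives the Laplace transform of the interference of a Poisson field of
transmitters in the whole plane. -/
lemma lintegral_one_sub_negExp_plane {a τ : ℝ} (ha : 0 ≤ a) (hτ : 2 < τ) :
    ∫⁻ x : Plane, 1 - negExp (ENNReal.ofReal (a * ‖x‖ ^ (-τ))) =
      ENNReal.ofReal (Real.pi * Real.Gamma (1 - 2 / τ) * a ^ (2 / τ)) := by
  have hδ : 0 < 2 / τ := by positivity
  have hδ1 : 2 / τ < 1 := (div_lt_one (by positivity)).2 hτ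
  rcases ha.eq_or_lt with rfl | ha
  · simp [Real.zero_rpow hδ.ne']
  have hnn : ∀ x : Plane, 0 ≤ a * ‖x‖ ^ (-τ) := fun x => by positivity
  simp_rw [one_sub_negExp_ofReal (hnn _)]
  -- Layer cake formula: with `1 - e^{-b} = ∫_0^b e^{-t} dt` the spatial integral becomes one of
  -- areas of discs `π (a / t)^{2/τ}` against `e^{-t}`. It is a Gamma integral, convergent since `2
  -- / τ < 1`.
  rw [lintegral_comp_eq_lintegral_meas_lt_mul _ (Eventually.of_forall hnn)
    (Measurable.aemeasurable (by fun_prop))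
    (fun t _ => (Continuous.intervalIntegrable (by fun_prop) _ _))
    (Eventually.of_forall fun t => Real.exp_nonneg _)]
  have e : ∀ t ∈ Ioi (0 : ℝ), volume {x : Plane | t < a * ‖x‖ ^ (-τ)} *
      ENNReal.ofReal (Real.exp (-t)) = ENNReal.ofReal (Real.pi * a ^ (2 / τ)) *
        ENNReal.ofReal (t ^ ((1 - 2 / τ) - 1) * Real.exp (-(1 * t))) := by
    intro t ht
    have ht : 0 < t := ht
    rw [volume_setOf_lt_mul_norm_rpow ha ht (by positivity), ← ENNReal.ofReal_mul (by positivity),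
      ← ENNReal.ofReal_mul (by positivity), Real.div_rpow ha.le ht.le,
      show (1 - 2 / τ) - 1 = -(2 / τ) by ring, Real.rpow_neg ht.le, one_mul]
    congr 1
    ring
  rw [setLIntegral_congr_fun measurableSet_Ioi e, lintegral_const_mul _ (by fun_prop),
    lintegral_rpow_mul_exp_neg_mul_Ioi (by linarith) one_pos,
    ← ENNReal.ofReal_mul (by positivity)]
  congr 1
  simp
  ring

/-- It amounts to `(2a)_{2n} = 4^n (a)_n (a + 1/2)_n`, which turns Gamma functions at `2μ + 2n` into
the Pochhammer symbols of a `₂F₁`. -/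
lemma Gamma_add_two_mul_natCast {a : ℝ} (ha : 0 < a) (n : ℕ) :
    Real.Gamma (2 * a + 2 * n) = 4 ^ n * (ascPochhammer ℝ n).eval a *
      (ascPochhammer ℝ n).eval (a + 1 / 2) * Real.Gamma (2 * a) := by
  induction n with
  | zero => simp
  | succ n ih =>
    rw [show 2 * a + 2 * ((n + 1 : ℕ) : ℝ) = (2 * a + 2 * n + 1) + 1 by push_cast; ring,
      Real.Gamma_add_one (by positivity), Real.Gamma_add_one (by positivity), ih,
      ascPochhammer_succ_right, Polynomial.eval_mul, Polynomial.eval_mul]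
    simp
    ring

lemma ascPochhammer_eval_pos {a : ℝ} (ha : 0 < a) (n : ℕ) : 0 < (ascPochhammer ℝ n).eval a :=
  ascPochhammer_pos n a ha

/-- The moment of order `δ` of the power of a fading channel. -/
def fadingMoment (F : Fading) (δ : ℝ) : ℝ :=
  match F with
  | .kappaMu κ μ w => (Real.exp (μ * κ))⁻¹ * hyp1F1 (μ + δ) μ (μ * κ) *
      (w / ((1 + κ) * μ)) ^ δ * (Real.Gamma (μ + δ) / Real.Gamma μ)
  | .etaMu η μ w => (hPar η ^ μ)⁻¹ *
      ordinaryHypergeometric (μ + δ / 2 + 1 / 2) (μ + δ / 2) (μ + 1 / 2) ((HPar η / hPar η) ^ 2) *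
      (w / (2 * μ * hPar η)) ^ δ * (Real.Gamma (2 * μ + δ) / Real.Gamma (2 * μ))

/-- The series agree term by term. For `η-μ` the symbol `(μ)_n` in the weight cancels against the
one in `(2μ)_{2n}`, and so do the powers of `4`. -/
lemma tsum_moment_terms {F : Fading} (hF : F.Valid) {δ : ℝ} (hδ : 0 ≤ δ) :
    ∑' n, F.weight n * (F.scale ^ δ * (Real.Gamma (F.order n + δ) / Real.Gamma (F.order n))) =
      fadingMoment F δ := by
  cases F with
  | kappaMu κ μ w =>
    obtain ⟨h1, h2, h3⟩ := hF
    simp only [fadingMoment, hyp1F1, Fading.weight, Fading.scale, Fading.order]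
    rw [← tsum_mul_left, ← tsum_mul_right, ← tsum_mul_right]
    refine tsum_congr fun n => ?_
    have hG := Real.Gamma_pos_of_pos h2
    have hp := ascPochhammer_eval_pos h2 n
    rw [show μ + (n : ℝ) + δ = (μ + δ) + n by ring, Gamma_add_natCast (by positivity),
      Gamma_add_natCast h2, mul_comm (1 + κ) μ]
    field_simp
  | etaMu η μ w =>
    obtain ⟨h1, h2, h3⟩ := hF
    have hh := hPar_pos h1
    simp only [fadingMoment, ordinaryHypergeometric_eq_tsum]
    rw [← tsum_mul_left, ← tsum_mul_right, ← tsum_mul_right]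
    refine tsum_congr fun n => ?_
    rw [Fading.weight_etaMu h1]
    simp only [Fading.scale, Fading.order]
    have hG := Real.Gamma_pos_of_pos h2
    have hG2 := Real.Gamma_pos_of_pos (show 0 < 2 * μ by positivity)
    have hp := ascPochhammer_eval_pos h2 n
    have hp' := ascPochhammer_eval_pos (show 0 < μ + 1 / 2 by positivity) n
    have hr := Real.rpow_pos_of_pos hh μ
    rw [show 2 * μ + 2 * (n : ℝ) + δ = 2 * (μ + δ / 2) + 2 * n by ring,
      Gamma_add_two_mul_natCast (by positivity), Gamma_add_two_mul_natCast h2,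
      show (n : ℝ) + μ = μ + n by ring, Gamma_add_natCast h2, Real.rpow_neg hh.le,
      show 2 * (μ + δ / 2) = 2 * μ + δ by ring, show μ + δ / 2 + 1 / 2 = μ + δ / 2 + 1 / 2 from rfl,
      smul_eq_mul]
    field_simp

lemma lintegral_law_rpow_eq {F : Fading} (hF : F.Valid) [IsProbabilityMeasure F.law] {δ : ℝ}
    (hδ : 0 ≤ δ) (hδ1 : δ ≤ 1) :
    ∫⁻ x, ENNReal.ofReal (x ^ δ) ∂F.law = ENNReal.ofReal (fadingMoment F δ) ∧
      0 ≤ fadingMoment F δ := by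
  -- Finiteness comes from `x^δ ≤ 1 + x`; it is what makes the real series for the moment summable.
  have hfin : ∫⁻ x, ENNReal.ofReal (x ^ δ) ∂F.law < ∞ := by
    calc ∫⁻ x, ENNReal.ofReal (x ^ δ) ∂F.law ≤ ∫⁻ x, 1 + ENNReal.ofReal x ∂F.law := by
          refine lintegral_mono_ae (Fading.ae_law_pos.mono fun x hx => ?_)
          rw [← ENNReal.ofReal_one, ← ENNReal.ofReal_add zero_le_one hx.le]
          refine ENNReal.ofReal_le_ofReal ?_
          rcases le_total x 1 with h | h
          · have := Real.rpow_le_one hx.le h hδ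
            linarith
          · have := Real.rpow_le_rpow_of_exponent_le h hδ1
            rw [Real.rpow_one] at this
            linarith
      _ = 1 + ∫⁻ x, ENNReal.ofReal x ∂F.law := by
          rw [lintegral_add_left measurable_const]
          simp
      _ < ∞ := ENNReal.add_lt_top.2 ⟨ENNReal.one_lt_top, hF.lintegral_law_id_lt_top⟩
  have h := hF.lintegral_law_rpow hδ
  have hc := hF.scale_pos
  have h0 : ∀ n, 0 ≤ F.weight n *
      (F.scale ^ δ * (Real.Gamma (F.order n + δ) / Real.Gamma (F.order n))) := fun n => by
    have h1 := hF.order_pos n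
    have h2 := Real.Gamma_pos_of_pos h1
    have h3 := Real.Gamma_pos_of_pos (show 0 < F.order n + δ by positivity)
    have h4 := hF.weight_nonneg n
    positivity
  have hs : Summable fun n => F.weight n *
      (F.scale ^ δ * (Real.Gamma (F.order n + δ) / Real.Gamma (F.order n))) := by
    have := ENNReal.summable_toReal (h ▸ hfin.ne)
    exact this.congr fun n => ENNReal.toReal_ofReal (h0 n)
  rw [h, ← ENNReal.ofReal_tsum_of_nonneg h0 hs, tsum_moment_terms hF hδ]
  exact ⟨rfl, tsum_moment_terms hF hδ ▸ tsum_nonneg h0⟩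

/-- The reflection formula `Γ(δ) Γ(1 - δ) = π / sin(πδ)` reduces the printed constant to the Gamma
functions that the computation produces. -/
lemma genBinom_div_nsinc {a δ : ℝ} (hδ : 0 < δ) (hδ1 : δ < 1) :
    1 / nsinc δ * genBinom (a + δ - 1) δ =
      Real.Gamma (1 - δ) * (Real.Gamma (a + δ) / Real.Gamma a) := by
  unfold nsinc genBinom
  have hsin : 0 < Real.sin (Real.pi * δ) :=
    Real.sin_pos_of_pos_of_lt_pi (by positivity) (by nlinarith [Real.pi_pos])
  have hr := Real.Gamma_mul_Gamma_one_sub δ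
  have hG := Real.Gamma_pos_of_pos hδ
  have h1 : Real.Gamma (1 - δ) = Real.pi / Real.sin (Real.pi * δ) / Real.Gamma δ := by
    rw [← hr]
    field_simp
  rw [Real.Gamma_add_one hδ.ne', h1, show a + δ - 1 + 1 = a + δ by ring,
    show a + δ - 1 - δ + 1 = a by ring]
  have := Real.pi_pos
  field_simp

/-- The factors have a probabilistic meaning: thinned intensity, `Γ(1 - δ)` from the plane, `π E[L²;
L ≤ θ]` from the link lengths, and `E[G^δ]` from the fading. -/
lemma Params.cD_eq {p : Params} (hτ : 2 < p.τd) :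
    p.cD = p.lam * (p.q * p.ε) * Real.Gamma (1 - 2 / p.τd) *
      (lowerGamma 2 (p.ξ * Real.pi * p.θ ^ 2) / p.ξ) *
        fadingMoment p.fadID (2 / p.τd) := by
  have hδ : 0 < 2 / p.τd := by positivity
  have hδ1 : 2 / p.τd < 1 := (div_lt_one (by positivity)).2 hτ
  unfold Params.cD fadingMoment
  generalize lowerGamma 2 (p.ξ * Real.pi * p.θ ^ 2) = g
  cases p.fadID with
  | kappaMu κ μ w =>
    have := genBinom_div_nsinc (a := μ) hδ hδ1
    simp only
    -- This holds for `g = 0` as well (the case `θ = 0`), where both sides are zero by the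
    -- convention for division by zero.
    rw [show ∀ x : ℝ, p.q * p.ε * p.lam / (p.ξ / g * x) = p.q * p.ε * p.lam * (g / p.ξ) * x⁻¹ by
      intro x; rw [div_eq_mul_inv, mul_inv, inv_div]; ring]
    calc _ = p.q * p.ε * p.lam * (g / p.ξ) * (Real.exp (μ * κ))⁻¹ *
          hyp1F1 (μ + 2 / p.τd) μ (μ * κ) * (w / ((1 + κ) * μ)) ^ (2 / p.τd) *
          (1 / nsinc (2 / p.τd) * genBinom (μ + 2 / p.τd - 1) (2 / p.τd)) := by ring
      _ = _ := by
        rw [this]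
        ring
  | etaMu η μ w =>
    have := genBinom_div_nsinc (a := 2 * μ) hδ hδ1
    simp only
    rw [show ∀ x : ℝ, p.q * p.ε * p.lam / (p.ξ / g * x) = p.q * p.ε * p.lam * (g / p.ξ) * x⁻¹ by
      intro x; rw [div_eq_mul_inv, mul_inv, inv_div]; ring]
    generalize ordinaryHypergeometric (μ + 2 / p.τd / 2 + 1 / 2) (μ + 2 / p.τd / 2) (μ + 1 / 2)
          ((HPar η / hPar η) ^ 2) = f
    calc _ = p.q * p.ε * p.lam * (g / p.ξ) * (hPar η ^ μ)⁻¹ * f *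
          (w / (2 * μ * hPar η)) ^ (2 / p.τd) *
          (1 / nsinc (2 / p.τd) * genBinom (2 * μ + 2 / p.τd - 1) (2 / p.τd)) := by ring
      _ = _ := by
        rw [this]
        ring

lemma lowerGamma_two (x : ℝ) : lowerGamma 2 x = 1 - (1 + x) * Real.exp (-x) := by
  unfold lowerGamma
  rw [intervalIntegral.integral_eq_sub_of_hasDerivAt (f := fun t => -((1 + t) * Real.exp (-t)))]
  · simp
    ring
  · intro t _
    have h1 : HasDerivAt (fun t : ℝ => Real.exp (-t)) (-Real.exp (-t)) t := by
      simpa using (hasDerivAt_neg t).exp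
    refine (((hasDerivAt_id t).const_add 1).mul h1).neg.congr_deriv ?_
    norm_num
    ring
  · refine Continuous.intervalIntegrable ?_ _ _
    norm_num
    fun_prop

/-- A common form for `P(L ≤ θ)` and `E[L²; L ≤ θ]`, each obtained by exhibiting a primitive `G`. -/
lemma lintegral_lenLawD {ξ : ℝ} (hξ : 0 < ξ) {g : ℝ → ℝ} (hg : Measurable g)
    (hg0 : ∀ x, 0 ≤ x → 0 ≤ g x) {θ : ℝ} {G : ℝ → ℝ}
    (hθ : 0 ≤ θ) (hc : Continuous g) (hG : ∀ x, HasDerivAt G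
      (2 * Real.pi * ξ * x * Real.exp (-(ξ * Real.pi * x ^ 2)) * g x) x) :
    ∫⁻ x, (Iic θ).indicator (fun x => ENNReal.ofReal (g x)) x ∂lenLawD ξ =
      ENNReal.ofReal (G θ - G 0) := by
  have hm : Measurable fun x => ENNReal.ofReal
      (2 * Real.pi * ξ * x * Real.exp (-(ξ * Real.pi * x ^ 2))) := by fun_prop
  rw [lenLawD, lintegral_withDensity_eq_lintegral_mul _ hm
    (hg.ennreal_ofReal.indicator measurableSet_Iic), ← lintegral_indicator measurableSet_Ici]
  have e : ∀ x, (Ici (0 : ℝ)).indicator ((fun x => ENNReal.ofReal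
      (2 * Real.pi * ξ * x * Real.exp (-(ξ * Real.pi * x ^ 2)))) *
      (Iic θ).indicator (fun x => ENNReal.ofReal (g x))) x = (Icc 0 θ).indicator
        (fun x => ENNReal.ofReal
          (2 * Real.pi * ξ * x * Real.exp (-(ξ * Real.pi * x ^ 2)) * g x)) x := by
    intro x
    by_cases h1 : 0 ≤ x <;> by_cases h2 : x ≤ θ <;>
      simp [indicator, h1, h2]
    rw [← ENNReal.ofReal_mul (by positivity)]
  have hcc : Continuous fun x => 2 * Real.pi * ξ * x * Real.exp (-(ξ * Real.pi * x ^ 2)) * g x := by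
    fun_prop
  simp_rw [e]
  rw [lintegral_indicator measurableSet_Icc, ← ofReal_integral_eq_lintegral_ofReal
    hcc.integrableOn_Icc, integral_Icc_eq_integral_Ioc, ← intervalIntegral.integral_of_le hθ,
    intervalIntegral.integral_eq_sub_of_hasDerivAt (fun x _ => hG x)
      (hcc.intervalIntegrable _ _)]
  filter_upwards [ae_restrict_mem measurableSet_Icc] with x hx
  have h1 := hx.1
  have h2 := hg0 x hx.1
  positivity

lemma hasDerivAt_exp_neg_sq (c x : ℝ) :
    HasDerivAt (fun x => Real.exp (-(c * x ^ 2))) (-(2 * c * x * Real.exp (-(c * x ^ 2)))) x := by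
  have h1 : HasDerivAt (fun x : ℝ => -(c * x ^ 2)) (-(c * (2 * x))) x := by
    have := ((hasDerivAt_pow 2 x).const_mul c).fun_neg
    simpa using this
  refine h1.exp.congr_deriv ?_
  ring

lemma lenLawD_Iic {ξ θ : ℝ} (hξ : 0 < ξ) (hθ : 0 ≤ θ) :
    lenLawD ξ (Iic θ) = ENNReal.ofReal (1 - Real.exp (-(ξ * Real.pi * θ ^ 2))) := by
  have := lintegral_lenLawD hξ (g := fun _ => 1) measurable_const (fun _ _ => zero_le_one) hθ
    continuous_const (G := fun x => -Real.exp (-(ξ * Real.pi * x ^ 2))) (fun x => by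
      refine (hasDerivAt_exp_neg_sq (ξ * Real.pi) x).neg.congr_deriv ?_
      ring)
  rw [ENNReal.ofReal_one, lintegral_indicator measurableSet_Iic, setLIntegral_one] at this
  rw [this]
  congr 1
  simp
  ring

lemma lintegral_lenLawD_sq {ξ θ : ℝ} (hξ : 0 < ξ) (hθ : 0 ≤ θ) :
    ∫⁻ x, (Iic θ).indicator (fun x => ENNReal.ofReal (x ^ 2)) x ∂lenLawD ξ =
      ENNReal.ofReal (lowerGamma 2 (ξ * Real.pi * θ ^ 2) / (ξ * Real.pi)) := by
  have hpi := Real.pi_pos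
  rw [lintegral_lenLawD hξ (g := fun x => x ^ 2) (by fun_prop) (fun _ _ => by positivity) hθ
    (by fun_prop) (G := fun x => -((1 + ξ * Real.pi * x ^ 2) *
      Real.exp (-(ξ * Real.pi * x ^ 2))) / (ξ * Real.pi)) (fun x => ?_), lowerGamma_two]
  · congr 1
    simp
    field_simp
    ring
  · have h1 : HasDerivAt (fun x : ℝ => 1 + ξ * Real.pi * x ^ 2) (ξ * Real.pi * (2 * x)) x := by
      simpa using ((hasDerivAt_pow 2 x).const_mul (ξ * Real.pi)).const_add 1
    refine ((h1.mul (hasDerivAt_exp_neg_sq (ξ * Real.pi) x)).neg.div_const _).congr_deriv ?_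
    field_simp
    ring

lemma lowerGamma_two_nonneg {x : ℝ} (hx : 0 ≤ x) : 0 ≤ lowerGamma 2 x := by
  unfold lowerGamma
  refine intervalIntegral.integral_nonneg hx fun t ht => ?_
  have := ht.1
  positivity

lemma ae_lenLawD_nonneg (ξ : ℝ) : ∀ᵐ x ∂lenLawD ξ, 0 ≤ x :=
  (withDensity_absolutelyContinuous _ _).ae_le (ae_restrict_mem measurableSet_Ici)

section

/-! ### Independence of the sources of randomness -/

namespace Network

variable {Ω : Type*}

/-- The σ-algebra generated by a set of sources. -/
@[reducible] def sig (S : Network Ω) (T : Set Source) : MeasurableSpace Ω :=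
  ⨆ s ∈ T, MeasurableSpace.comap (S.source s) (Source.measurableSpaceVal s)

theorem measurable_source_sig (S : Network Ω) {T : Set Source} {s : Source} (hs : s ∈ T) :
    Measurable[S.sig T] (S.source s) :=
  Measurable.of_comap_le (le_iSup₂ (f := fun s (_ : s ∈ T) =>
    MeasurableSpace.comap (S.source s) (Source.measurableSpaceVal s)) s hs)

theorem measurable_ueLoc_sig (S : Network Ω) {T : Set Source} (hs : Source.ueLoc ∈ T) (i : ℕ) :
    Measurable[S.sig T] (S.ueLoc i) := by
  have h : Measurable[S.sig T] fun ω i => S.ueLoc i ω := S.measurable_source_sig hs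
  exact (@measurable_pi_iff _ _ _ (S.sig T) _ _).1 h i

theorem measurable_cellLoc_sig (S : Network Ω) {T : Set Source} (hs : Source.cellLoc ∈ T)
    (i : ℕ) : Measurable[S.sig T] (S.cellLoc i) := by
  have h : Measurable[S.sig T] fun ω i => S.cellLoc i ω := S.measurable_source_sig hs
  exact (@measurable_pi_iff _ _ _ (S.sig T) _ _).1 h i

theorem IsModel.sig_le [MeasurableSpace Ω] {S : Network Ω} {P : Measure Ω} {p : Params}
    (hS : S.IsModel P p) (T : Set Source) : S.sig T ≤ ‹MeasurableSpace Ω› :=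
  iSup₂_le fun s _ => (hS.measurable s).comap_le

theorem IsModel.indep_sig [MeasurableSpace Ω] {S : Network Ω} {P : Measure Ω} {p : Params}
    (hS : S.IsModel P p) {T T' : Set Source} (hT : Disjoint T T') :
    Indep (S.sig T) (S.sig T') P :=
  indep_iSup_of_disjoint (fun s => (hS.measurable s).comap_le) hS.indep hT

theorem IsModel.indepFun [MeasurableSpace Ω] {S : Network Ω} {P : Measure Ω} {p : Params}
    (hS : S.IsModel P p) {T T' : Set Source} (hT : Disjoint T T') {α β : Type*}
    [MeasurableSpace α] [MeasurableSpace β] {f : Ω → α} {g : Ω → β}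
    (hf : Measurable[S.sig T] f) (hg : Measurable[S.sig T'] g) : IndepFun f g P := by
  rw [IndepFun_iff_Indep]
  exact indep_of_indep_of_le_left (indep_of_indep_of_le_right (hS.indep_sig hT) hg.comap_le)
    hf.comap_le

end Network

/-- The Bernoulli distribution on `Bool`. -/
def boolLaw (r : ℝ) : Measure Bool :=
  ENNReal.ofReal r • Measure.dirac true + ENNReal.ofReal (1 - r) • Measure.dirac false

theorem hasLaw_boolLaw {Ω : Type*} [MeasurableSpace Ω] {P : Measure Ω} [IsProbabilityMeasure P]
    {X : Ω → Bool} (hX : Measurable X) {r : ℝ} (hr : r ∈ Icc (0 : ℝ) 1)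
    (h : P {ω | X ω = true} = ENNReal.ofReal r) : HasLaw X (boolLaw r) P := by
  refine ⟨hX.aemeasurable, ?_⟩
  have hm : MeasurableSet {ω | X ω = true} := hX (measurableSet_singleton true)
  have h' : P {ω | X ω = false} = ENNReal.ofReal (1 - r) := by
    have e : {ω | X ω = false} = {ω | X ω = true}ᶜ := by
      ext ω; simp
    rw [e, prob_compl_eq_one_sub hm, h, ENNReal.ofReal_sub _ hr.1, ENNReal.ofReal_one]
  refine Measure.ext_of_singleton fun b => ?_
  rw [Measure.map_apply hX (measurableSet_singleton b)]
  cases b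
  · have e : X ⁻¹' {false} = {ω | X ω = false} := rfl
    simp [e, h', boolLaw]
  · have e : X ⁻¹' {true} = {ω | X ω = true} := rfl
    simp [e, h, boolLaw]

instance {r : ℝ} : SFinite (boolLaw r) := by unfold boolLaw; infer_instance

namespace Network

variable {Ω : Type*}

/-- The mark of a UE. -/
def ueMark (S : Network Ω) (i : ℕ) (ω : Ω) : (Bool × Bool) × (ℝ × ℝ) :=
  ((S.ueD2D i ω, S.ueTx i ω), (S.ueLen i ω, S.ueFad i ω))

/-- The mark of an active cellular transmitter. -/
def cellMark (S : Network Ω) (i : ℕ) (ω : Ω) : ℝ × ℝ := (S.cellLen i ω, S.cellFad i ω)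

/-- The sources of the mark of a UE. -/
def ueMarkSources (i : ℕ) : Set Source := {.ueD2D i, .ueTx i, .ueLen i, .ueFad i}

/-- The sources of the mark of an active cellular transmitter. -/
def cellMarkSources (i : ℕ) : Set Source := {.cellLen i, .cellFad i}

theorem measurable_ueMark_sig (S : Network Ω) {T : Set Source} {i : ℕ} (h : ueMarkSources i ⊆ T) :
    Measurable[S.sig T] (S.ueMark i) := by
  have h1 : Measurable[S.sig T] (S.ueD2D i) :=
    S.measurable_source_sig (s := .ueD2D i) (h (by simp [ueMarkSources]))
  have h2 : Measurable[S.sig T] (S.ueTx i) :=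
    S.measurable_source_sig (s := .ueTx i) (h (by simp [ueMarkSources]))
  have h3 : Measurable[S.sig T] (S.ueLen i) :=
    S.measurable_source_sig (s := .ueLen i) (h (by simp [ueMarkSources]))
  have h4 : Measurable[S.sig T] (S.ueFad i) :=
    S.measurable_source_sig (s := .ueFad i) (h (by simp [ueMarkSources]))
  exact (h1.prodMk h2).prodMk (h3.prodMk h4)

theorem measurable_cellMark_sig (S : Network Ω) {T : Set Source} {i : ℕ}
    (h : cellMarkSources i ⊆ T) : Measurable[S.sig T] (S.cellMark i) := by
  have h1 : Measurable[S.sig T] (S.cellLen i) :=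
    S.measurable_source_sig (s := .cellLen i) (h (by simp [cellMarkSources]))
  have h2 : Measurable[S.sig T] (S.cellFad i) :=
    S.measurable_source_sig (s := .cellFad i) (h (by simp [cellMarkSources]))
  exact h1.prodMk h2

/-- The distribution of the mark of a UE. -/
def ueMarkLaw (p : Params) : Measure ((Bool × Bool) × (ℝ × ℝ)) :=
  ((boolLaw p.q).prod (boolLaw p.ε)).prod ((lenLawD p.ξ).prod p.fadID.law)

/-- The distribution of the mark of an active cellular transmitter. -/
def cellMarkLaw (p : Params) : Measure (ℝ × ℝ) := p.lenLawC.prod p.fadIC.law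

variable [MeasurableSpace Ω] {S : Network Ω} {P : Measure Ω} {p : Params}

theorem IsModel.hasLaw_cellMark [IsProbabilityMeasure P] (hS : S.IsModel P p) (i : ℕ) :
    HasLaw (S.cellMark i) (cellMarkLaw p) P := by
  have h1 : Measurable[S.sig {.cellLen i}] (S.cellLen i) :=
    S.measurable_source_sig (s := .cellLen i) (by simp)
  have h2 : Measurable[S.sig {.cellFad i}] (S.cellFad i) :=
    S.measurable_source_sig (s := .cellFad i) (by simp)
  have h12 : IndepFun (S.cellLen i) (S.cellFad i) P := hS.indepFun (by simp) h1 h2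
  exact h12.hasLaw_prod (hS.cellLen_law i) (hS.cellFad_law i)

theorem IsModel.hasLaw_ueMark [IsProbabilityMeasure P] (hp : p.Valid) (hS : S.IsModel P p)
    (i : ℕ) : HasLaw (S.ueMark i) (ueMarkLaw p) P := by
  have h1 : ∀ {T}, Source.ueD2D i ∈ T → Measurable[S.sig T] (S.ueD2D i) :=
    fun h => S.measurable_source_sig (s := .ueD2D i) h
  have h2 : ∀ {T}, Source.ueTx i ∈ T → Measurable[S.sig T] (S.ueTx i) :=
    fun h => S.measurable_source_sig (s := .ueTx i) h
  have h3 : ∀ {T}, Source.ueLen i ∈ T → Measurable[S.sig T] (S.ueLen i) :=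
    fun h => S.measurable_source_sig (s := .ueLen i) h
  have h4 : ∀ {T}, Source.ueFad i ∈ T → Measurable[S.sig T] (S.ueFad i) :=
    fun h => S.measurable_source_sig (s := .ueFad i) h
  have h12 : IndepFun (S.ueD2D i) (S.ueTx i) P :=
    hS.indepFun (T := {.ueD2D i}) (T' := {.ueTx i}) (by simp) (h1 (by simp)) (h2 (by simp))
  have h34 : IndepFun (S.ueLen i) (S.ueFad i) P :=
    hS.indepFun (T := {.ueLen i}) (T' := {.ueFad i}) (by simp) (h3 (by simp)) (h4 (by simp))
  have hA : Measurable[S.sig {.ueD2D i, .ueTx i}] fun ω => (S.ueD2D i ω, S.ueTx i ω) :=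
    (h1 (by simp)).prodMk (h2 (by simp))
  have hB : Measurable[S.sig {.ueLen i, .ueFad i}] fun ω => (S.ueLen i ω, S.ueFad i ω) :=
    (h3 (by simp)).prodMk (h4 (by simp))
  have hAB : IndepFun (fun ω => (S.ueD2D i ω, S.ueTx i ω)) (fun ω => (S.ueLen i ω, S.ueFad i ω))
      P := hS.indepFun (by simp) hA hB
  exact hAB.hasLaw_prod
    (h12.hasLaw_prod (hasLaw_boolLaw (hS.measurable (.ueD2D i)) hp.q_mem (hS.ueD2D_prob i))
      (hasLaw_boolLaw (hS.measurable (.ueTx i)) hp.ε_mem (hS.ueTx_prob i)))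
    (h34.hasLaw_prod (hS.ueLen_law i) (hS.ueFad_law i))

/-- The marked probability generating functional of the UEs. -/
theorem IsModel.lintegral_negExp_tsum_ue [IsProbabilityMeasure P] (hp : p.Valid)
    (hS : S.IsModel P p) {f : Plane × ((Bool × Bool) × (ℝ × ℝ)) → ℝ≥0∞} (hf : Measurable f) :
    ∫⁻ ω, negExp (∑' i, f (S.ueLoc i ω, S.ueMark i ω)) ∂P =
      negExp (ENNReal.ofReal p.lam *
        ∫⁻ m, ∫⁻ x, 1 - negExp (f (x, m)) ∂volume ∂(ueMarkLaw p)) := by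
  have : IsProbabilityMeasure (ueMarkLaw p) :=
    (hS.hasLaw_ueMark hp 0).isProbabilityMeasure_iff.1 inferInstance
  refine hS.ueLoc_ppp.lintegral_negExp_tsum_mark ?_ hp.lam_pos.le
    (fun i => hS.hasLaw_ueMark hp i) ?_
    -- `𝓕 n` is generated by all the locations and the marks with index below `n`; its sources are
    -- disjoint from those of mark `n`.
    (fun n => S.sig ({.ueLoc} ∪ ⋃ i < n, ueMarkSources i)) ?_ ?_ ?_ hf
  · exact fun i => (S.measurable_ueLoc_sig (T := univ) trivial i).mono (hS.sig_le _) le_rfl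
  · exact fun i => (S.measurable_ueMark_sig (T := univ) (subset_univ _)).mono (hS.sig_le _) le_rfl
  · exact fun n i => S.measurable_ueLoc_sig (Or.inl rfl) i
  · exact fun n i hi => S.measurable_ueMark_sig
      ((subset_biUnion_of_mem (u := ueMarkSources) (s := {i | i < n}) hi).trans
        subset_union_right)
  · intro n
    refine indep_of_indep_of_le_right (hS.indep_sig (T' := ueMarkSources n) ?_)
      (S.measurable_ueMark_sig subset_rfl).comap_le
    rw [Set.disjoint_left]
    rintro s (h | h) hs
    · rw [mem_singleton_iff] at h
      subst h
      simp [ueMarkSources] at hs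
    · simp only [mem_iUnion, ueMarkSources, mem_insert_iff, mem_singleton_iff] at h hs
      obtain ⟨i, hi, h⟩ := h
      rcases h with h | h | h | h <;> subst h <;> simp at hs <;> omega

/-- The marked probability generating functional of the active cellular transmitters. -/
theorem IsModel.lintegral_negExp_tsum_cell [IsProbabilityMeasure P] (hp : p.Valid)
    (hS : S.IsModel P p) {f : Plane × (ℝ × ℝ) → ℝ≥0∞} (hf : Measurable f) :
    ∫⁻ ω, negExp (∑' i, f (S.cellLoc i ω, S.cellMark i ω)) ∂P =
      negExp (ENNReal.ofReal p.lamB *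
        ∫⁻ m, ∫⁻ x, 1 - negExp (f (x, m)) ∂volume ∂(cellMarkLaw p)) := by
  have : IsProbabilityMeasure (cellMarkLaw p) :=
    (hS.hasLaw_cellMark 0).isProbabilityMeasure_iff.1 inferInstance
  refine hS.cellLoc_ppp.lintegral_negExp_tsum_mark ?_ hp.lamB_pos.le
    (fun i => hS.hasLaw_cellMark i) ?_
    (fun n => S.sig ({.cellLoc} ∪ ⋃ i < n, cellMarkSources i)) ?_ ?_ ?_ hf
  · exact fun i => (S.measurable_cellLoc_sig (T := univ) trivial i).mono (hS.sig_le _) le_rfl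
  · exact fun i => (S.measurable_cellMark_sig (T := univ) (subset_univ _)).mono
      (hS.sig_le _) le_rfl
  · exact fun n i => S.measurable_cellLoc_sig (Or.inl rfl) i
  · exact fun n i hi => S.measurable_cellMark_sig
      ((subset_biUnion_of_mem (u := cellMarkSources) (s := {i | i < n}) hi).trans
        subset_union_right)
  · intro n
    refine indep_of_indep_of_le_right (hS.indep_sig (T' := cellMarkSources n) ?_)
      (S.measurable_cellMark_sig subset_rfl).comap_le
    rw [Set.disjoint_left]
    rintro s (h | h) hs
    · rw [mem_singleton_iff] at h
      subst h
      simp [cellMarkSources] at hs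
    · simp only [mem_iUnion, cellMarkSources, mem_insert_iff, mem_singleton_iff] at h hs
      obtain ⟨i, hi, h⟩ := h
      rcases h with h | h <;> subst h <;> simp at hs <;> omega

end Network

/-! ### Finiteness and the Laplace transform of an interference -/

/-- `e^{-sI}` vanishes where `I = ∞` and is at most `1` elsewhere, so its mean is a lower bound for
`P(I < ∞)`; as `s → 0` this bound tends to `1`. Finiteness then allows passing from `negExp` to the
real exponential. -/
theorem ae_lt_top_and_laplace_eq {Ω : Type*} [MeasurableSpace Ω] {P : Measure Ω}
    [IsProbabilityMeasure P] {I : Ω → ℝ≥0∞} (hI : Measurable I) {Φ : ℝ → ℝ}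
    (h : ∀ s, 0 < s → ∫⁻ ω, negExp (ENNReal.ofReal s * I ω) ∂P = ENNReal.ofReal (Real.exp (-Φ s)))
    (hΦ : Tendsto Φ (𝓝[>] 0) (𝓝 0)) :
    (∀ᵐ ω ∂P, I ω < ∞) ∧ ∀ s, 0 < s → laplace P I s = Real.exp (-Φ s) := by
  have hfin : ∀ᵐ ω ∂P, I ω < ∞ := by
    have hm : MeasurableSet {ω | I ω < ∞} := measurableSet_lt hI measurable_const
    have h1 : ∀ s, 0 < s → ENNReal.ofReal (Real.exp (-Φ s)) ≤ P {ω | I ω < ∞} := by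
      intro s hs
      rw [← h s hs, ← lintegral_indicator_one hm]
      refine lintegral_mono fun ω => ?_
      by_cases hω : I ω < ∞
      · simp [hω, negExp_le_one]
      · rw [not_lt_top_iff] at hω
        have : ENNReal.ofReal s * ⊤ = ⊤ := ENNReal.mul_top (by simpa using hs)
        simp [hω, this, negExp_top]
    have h2 : Tendsto (fun s => ENNReal.ofReal (Real.exp (-Φ s))) (𝓝[>] 0) (𝓝 1) := by
      have := (ENNReal.continuous_ofReal.tendsto _).comp
        ((Real.continuous_exp.tendsto _).comp hΦ.neg)
      simpa [Function.comp_def] using this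
    have h3 : 1 ≤ P {ω | I ω < ∞} :=
      le_of_tendsto h2 (eventually_nhdsWithin_of_forall fun s hs => h1 s hs)
    exact (prob_compl_eq_zero_iff hm).2 (le_antisymm prob_le_one h3)
  refine ⟨hfin, fun s hs => ?_⟩
  unfold laplace
  rw [integral_eq_lintegral_of_nonneg_ae (Eventually.of_forall fun ω => (Real.exp_pos _).le)
    (Measurable.aestronglyMeasurable (by fun_prop))]
  have : ∫⁻ ω, ENNReal.ofReal (Real.exp (-(s * (I ω).toReal))) ∂P =
      ∫⁻ ω, negExp (ENNReal.ofReal s * I ω) ∂P := by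
    refine lintegral_congr_ae ?_
    filter_upwards [hfin] with ω hω
    lift I ω to ℝ≥0 using hω.ne with y
    have : ENNReal.ofReal s * (y : ℝ≥0∞) = ENNReal.ofReal (s * y) := by
      rw [ENNReal.ofReal_mul hs.le]; simp
    rw [this, negExp_ofReal (by positivity)]
    simp
  rw [this, h s hs, ENNReal.toReal_ofReal (Real.exp_pos _).le]

end

section

namespace Network

/-! ### The interference at the D2D receiver -/

variable {Ω : Type*}

theorem measurable_tsum_ue_sig (S : Network Ω) {T : Set Source} (h : Source.ueLoc ∈ T)
    (h' : ∀ i, ueMarkSources i ⊆ T) {f : Plane × ((Bool × Bool) × (ℝ × ℝ)) → ℝ≥0∞}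
    (hf : Measurable f) :
    Measurable[S.sig T] fun ω => ∑' i, f (S.ueLoc i ω, S.ueMark i ω) := by
  let _ : MeasurableSpace Ω := S.sig T
  refine Measurable.tsum fun i => ?_
  exact hf.comp ((S.measurable_ueLoc_sig h i).prodMk (S.measurable_ueMark_sig (h' i)))

theorem measurable_tsum_cell_sig (S : Network Ω) {T : Set Source} (h : Source.cellLoc ∈ T)
    (h' : ∀ i, cellMarkSources i ⊆ T) {f : Plane × (ℝ × ℝ) → ℝ≥0∞}
    (hf : Measurable f) :
    Measurable[S.sig T] fun ω => ∑' i, f (S.cellLoc i ω, S.cellMark i ω) := by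
  let _ : MeasurableSpace Ω := S.sig T
  refine Measurable.tsum fun i => ?_
  exact hf.comp ((S.measurable_cellLoc_sig h i).prodMk (S.measurable_cellMark_sig (h' i)))

open Classical in
/-- The interference that a UE with a given location and mark causes at the D2D receiver. -/
def ueIntf (p : Params) (z : Plane × ((Bool × Bool) × (ℝ × ℝ))) : ℝ≥0∞ :=
  if z.2.1.1 = true ∧ z.2.2.1 ≤ p.θ ∧ z.2.1.2 = true then
    ENNReal.ofReal (z.2.2.1 ^ p.τd * z.2.2.2 * ‖z.1‖ ^ (-p.τd)) else 0

theorem measurable_ueIntf (p : Params) : Measurable (ueIntf p) := by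
  unfold ueIntf
  refine Measurable.ite ?_ (by fun_prop) measurable_const
  have h1 : MeasurableSet {z : Plane × ((Bool × Bool) × (ℝ × ℝ)) | z.2.1.1 = true} :=
    (measurable_fst.comp (measurable_fst.comp measurable_snd)) (measurableSet_singleton true)
  have h2 : MeasurableSet {z : Plane × ((Bool × Bool) × (ℝ × ℝ)) | z.2.1.2 = true} :=
    (measurable_snd.comp (measurable_fst.comp measurable_snd)) (measurableSet_singleton true)
  have h3 : MeasurableSet {z : Plane × ((Bool × Bool) × (ℝ × ℝ)) | z.2.2.1 ≤ p.θ} :=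
    measurableSet_le (by fun_prop) measurable_const
  exact h1.inter (h3.inter h2)

theorem interfD_eq_tsum (S : Network Ω) (p : Params) :
    S.interfD p = fun ω => ∑' i, ueIntf p (S.ueLoc i ω, S.ueMark i ω) := rfl

open Classical in
/-- The indicator that a UE with a given location and mark is in cellular mode in the cell. -/
def ueRival (p : Params) (z : Plane × ((Bool × Bool) × (ℝ × ℝ))) : ℝ≥0∞ :=
  if z.1 ∈ Metric.ball (0 : Plane) p.R ∧ (z.2.1.1 = false ∨ p.θ < z.2.2.1) then 1 else 0

theorem measurable_ueRival (p : Params) : Measurable (ueRival p) := by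
  unfold ueRival
  refine Measurable.ite ?_ measurable_const measurable_const
  have h1 : MeasurableSet {z : Plane × ((Bool × Bool) × (ℝ × ℝ)) | z.2.1.1 = false} :=
    (measurable_fst.comp (measurable_fst.comp measurable_snd)) (measurableSet_singleton false)
  have h2 : MeasurableSet {z : Plane × ((Bool × Bool) × (ℝ × ℝ)) |
      z.1 ∈ Metric.ball (0 : Plane) p.R} := measurable_fst measurableSet_ball
  have h3 : MeasurableSet {z : Plane × ((Bool × Bool) × (ℝ × ℝ)) | p.θ < z.2.2.1} :=
    measurableSet_lt measurable_const (by fun_prop)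
  exact h2.inter (h1.union h3)

/-- Counting rivals is a sum over the marked process, hence subject to the same Laplace functional
as the interferences. -/
theorem encard_rivals (S : Network Ω) (p : Params) (ω : Ω) :
    ((S.rivals p ω).encard : ℝ≥0∞) = ∑' i, ueRival p (S.ueLoc i ω, S.ueMark i ω) := by
  rw [← ENNReal.tsum_set_one, tsum_subtype (S.rivals p ω) fun _ => (1 : ℝ≥0∞)]
  refine tsum_congr fun i => ?_
  by_cases hi : i ∈ S.rivals p ω
  · rw [indicator_of_mem hi]; exact (if_pos hi).symm
  · rw [indicator_of_notMem hi]; exact (if_neg hi).symm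

open Classical in
/-- The interference that an active cellular transmitter with a given location and mark causes at
the base station. -/
def cellIntf (p : Params) (z : Plane × (ℝ × ℝ)) : ℝ≥0∞ :=
  if z.1 ∉ Metric.ball (0 : Plane) p.R then
    ENNReal.ofReal (z.2.1 ^ p.τc * z.2.2 * ‖z.1‖ ^ (-p.τc)) else 0

theorem measurable_cellIntf (p : Params) : Measurable (cellIntf p) := by
  unfold cellIntf
  refine Measurable.ite ?_ (by fun_prop) measurable_const
  exact (measurable_fst measurableSet_ball : MeasurableSet
    {z : Plane × (ℝ × ℝ) | z.1 ∈ Metric.ball (0 : Plane) p.R}).compl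

theorem interfC_eq_tsum (S : Network Ω) (p : Params) :
    S.interfC p = fun ω => ∑' i, cellIntf p (S.cellLoc i ω, S.cellMark i ω) := rfl

/-- The sources that describe the UEs. -/
def ueSources : Set Source := {.ueLoc} ∪ ⋃ i, ueMarkSources i

/-- The sources that describe the active cellular transmitters. -/
def cellSources : Set Source := {.cellLoc} ∪ ⋃ i, cellMarkSources i

theorem measurable_interfD_sig (S : Network Ω) (p : Params) {T : Set Source}
    (hT : ueSources ⊆ T) : Measurable[S.sig T] (S.interfD p) :=
  S.measurable_tsum_ue_sig (hT (Or.inl rfl))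
    (fun i => ((subset_iUnion _ i).trans subset_union_right).trans hT) (measurable_ueIntf p)

theorem measurable_rivals_sig (S : Network Ω) (p : Params) {T : Set Source}
    (hT : ueSources ⊆ T) :
    Measurable[S.sig T] fun ω => ((S.rivals p ω).encard : ℝ≥0∞) := by
  simp only [encard_rivals]
  exact S.measurable_tsum_ue_sig (hT (Or.inl rfl))
    (fun i => ((subset_iUnion _ i).trans subset_union_right).trans hT) (measurable_ueRival p)

theorem measurable_interfC_sig (S : Network Ω) (p : Params) {T : Set Source}
    (hT : cellSources ⊆ T) : Measurable[S.sig T] (S.interfC p) :=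
  S.measurable_tsum_cell_sig (hT (Or.inl rfl))
    (fun i => ((subset_iUnion _ i).trans subset_union_right).trans hT) (measurable_cellIntf p)

theorem lintegral_boolLaw {r : ℝ} (f : Bool → ℝ≥0∞) :
    ∫⁻ b, f b ∂boolLaw r = ENNReal.ofReal r * f true + ENNReal.ofReal (1 - r) * f false := by
  simp [boolLaw]

variable [MeasurableSpace Ω] {S : Network Ω} {P : Measure Ω} {p : Params}

theorem IsModel.isProbabilityMeasure_lenLawD [IsProbabilityMeasure P] (hS : S.IsModel P p) :
    IsProbabilityMeasure (lenLawD p.ξ) := hS.len0_law.isProbabilityMeasure_iff.1 inferInstance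

theorem IsModel.isProbabilityMeasure_fadID [IsProbabilityMeasure P] (hS : S.IsModel P p) :
    IsProbabilityMeasure p.fadID.law :=
  (hS.ueFad_law 0).isProbabilityMeasure_iff.1 inferInstance

/-- For a fixed mark the plane contributes `π Γ(1 - δ) (s L^τ G)^δ`. As `τδ = 2`, this is
proportional to `s^δ L² G^δ`, a product of functions of independent components of the mark. -/
theorem lintegral_ueIntf (hp : p.Valid) [IsProbabilityMeasure (lenLawD p.ξ)]
    [IsProbabilityMeasure p.fadID.law] {s : ℝ} (hs : 0 < s) :
    ENNReal.ofReal p.lam * ∫⁻ m, ∫⁻ x, 1 - negExp (ENNReal.ofReal s * ueIntf p (x, m)) ∂volume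
      ∂(ueMarkLaw p) = ENNReal.ofReal (p.cD * s ^ (2 / p.τd)) := by
  have hτ : 0 < p.τd := by linarith [hp.τd_gt]
  have hδ : 0 < 2 / p.τd := by positivity
  have hδ1 : 2 / p.τd < 1 := (div_lt_one (by positivity)).2 hp.τd_gt
  have hΓ : 0 ≤ Real.Gamma (1 - 2 / p.τd) := (Real.Gamma_pos_of_pos (by linarith)).le
  obtain ⟨hm1, hm2⟩ := lintegral_law_rpow_eq hp.fadID_valid hδ.le hδ1.le
  set δ := 2 / p.τd with hδ_def
  -- `A` selects transmitting potential D2D UEs; `B` carries the threshold, `L²` and `G^δ`.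
  let A : Bool × Bool → ℝ≥0∞ := fun b =>
    (if b.1 = true then 1 else 0) * (if b.2 = true then 1 else 0)
  let B : ℝ × ℝ → ℝ≥0∞ := fun z => (Iic p.θ).indicator (fun x => ENNReal.ofReal (x ^ 2)) z.1 *
    ENNReal.ofReal (z.2 ^ δ)
  have hB1 : Measurable ((Iic p.θ).indicator (fun x : ℝ => ENNReal.ofReal (x ^ 2))) :=
    Measurable.indicator (by fun_prop) measurableSet_Iic
  have hB2 : Measurable fun x : ℝ => ENNReal.ofReal (x ^ δ) := by fun_prop
  have hBm : Measurable B := (hB1.comp measurable_fst).mul (hB2.comp measurable_snd)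
  have hAm : Measurable A := by fun_prop
  have hae : ∀ᵐ m ∂(ueMarkLaw p), 0 ≤ m.2.1 ∧ 0 < m.2.2 := by
    have h1 : ∀ᵐ z ∂((lenLawD p.ξ).prod p.fadID.law), 0 ≤ z.1 ∧ 0 < z.2 :=
      (Measure.quasiMeasurePreserving_fst.ae (ae_lenLawD_nonneg p.ξ)).and
        (Measure.quasiMeasurePreserving_snd.ae p.fadID.ae_law_pos)
    exact Measure.quasiMeasurePreserving_snd.ae h1
  have key : ∀ᵐ m ∂(ueMarkLaw p),
      ∫⁻ x, 1 - negExp (ENNReal.ofReal s * ueIntf p (x, m)) ∂volume =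
        ENNReal.ofReal (Real.pi * Real.Gamma (1 - δ) * s ^ δ) * (A m.1 * B m.2) := by
    filter_upwards [hae] with m hm
    obtain ⟨⟨d, t⟩, ⟨l, g⟩⟩ := m
    obtain ⟨hl, hg⟩ := hm
    simp only at hl hg
    by_cases hc : d = true ∧ l ≤ p.θ ∧ t = true
    · have e : ∀ x : Plane, ENNReal.ofReal s * ueIntf p (x, ((d, t), (l, g))) =
          ENNReal.ofReal (s * (l ^ p.τd * g) * ‖x‖ ^ (-p.τd)) := by
        intro x
        rw [ueIntf, if_pos hc, ← ENNReal.ofReal_mul hs.le]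
        congr 1; ring
      simp only [e]
      have hlp : 0 ≤ l ^ p.τd := Real.rpow_nonneg hl _
      rw [lintegral_one_sub_negExp_plane (by positivity) hp.τd_gt]
      have e2 : (s * (l ^ p.τd * g)) ^ δ = s ^ δ * (l ^ 2 * g ^ δ) := by
        rw [Real.mul_rpow hs.le (by positivity), Real.mul_rpow hlp hg.le, ← Real.rpow_mul hl]
        have : p.τd * δ = (2 : ℕ) := by rw [hδ_def]; push_cast; field_simp
        rw [this, Real.rpow_natCast]
      have e3 : B (l, g) = ENNReal.ofReal (l ^ 2 * g ^ δ) := by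
        simp only [B]
        rw [indicator_of_mem (show l ∈ Iic p.θ from hc.2.1), ENNReal.ofReal_mul (by positivity)]
      have e4 : A (d, t) = 1 := by simp [A, hc.1, hc.2.2]
      simp only [← hδ_def]
      rw [e2, e3, e4, one_mul, ← ENNReal.ofReal_mul (by positivity)]
      congr 1; ring
    · have e : ∀ x : Plane, ueIntf p (x, ((d, t), (l, g))) = 0 := fun x => by
        rw [ueIntf, if_neg hc]
      have e2 : A (d, t) * B (l, g) = 0 := by
        by_contra hne
        apply hc
        simp only [A, B] at hne
        refine ⟨?_, ?_, ?_⟩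
        · by_contra h; simp [h] at hne
        · by_contra h; simp [h] at hne
        · by_contra h; simp [h] at hne
      simp only
      rw [e2]
      simp [e]
  rw [lintegral_congr_ae key, lintegral_const_mul _ (by fun_prop), ueMarkLaw,
    lintegral_prod_mul hAm.aemeasurable hBm.aemeasurable]
  have hA : ∫⁻ b, A b ∂((boolLaw p.q).prod (boolLaw p.ε)) = ENNReal.ofReal (p.q * p.ε) := by
    simp only [A]
    rw [lintegral_prod_mul (f := fun b : Bool => if b = true then (1 : ℝ≥0∞) else 0)
      (g := fun b : Bool => if b = true then (1 : ℝ≥0∞) else 0)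
      (Measurable.of_discrete).aemeasurable (Measurable.of_discrete).aemeasurable,
      lintegral_boolLaw, lintegral_boolLaw, ENNReal.ofReal_mul hp.q_mem.1]
    simp
  have hB : ∫⁻ z, B z ∂((lenLawD p.ξ).prod p.fadID.law) =
      ENNReal.ofReal (lowerGamma 2 (p.ξ * Real.pi * p.θ ^ 2) / (p.ξ * Real.pi)) *
        ENNReal.ofReal (fadingMoment p.fadID δ) := by
    simp only [B]
    rw [lintegral_prod_mul hB1.aemeasurable hB2.aemeasurable,
      lintegral_lenLawD_sq hp.ξ_pos hp.θ_nonneg, hm1]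
  have hL : 0 ≤ lowerGamma 2 (p.ξ * Real.pi * p.θ ^ 2) / (p.ξ * Real.pi) := by
    have := hp.ξ_pos
    exact div_nonneg (lowerGamma_two_nonneg (by positivity)) (by positivity)
  have hq := hp.q_mem.1
  have hε := hp.ε_mem.1
  have hl := hp.lam_pos.le
  rw [hA, hB, ← ENNReal.ofReal_mul hL, ← ENNReal.ofReal_mul (by positivity),
    ← ENNReal.ofReal_mul (by positivity), ← ENNReal.ofReal_mul hl, Params.cD_eq hp.τd_gt]
  congr 1
  have := hp.ξ_pos.ne'
  have := Real.pi_ne_zero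
  simp only [← hδ_def]
  field_simp

theorem IsModel.interfD_lt_top_and_laplace [IsProbabilityMeasure P] (hp : p.Valid)
    (hS : S.IsModel P p) : (∀ᵐ ω ∂P, S.interfD p ω < ∞) ∧ ∀ s, 0 < s →
      laplace P (S.interfD p) s = Real.exp (-(p.cD * s ^ (2 / p.τd))) := by
  have := hS.isProbabilityMeasure_lenLawD
  have := hS.isProbabilityMeasure_fadID
  have hτ : 0 < p.τd := by linarith [hp.τd_gt]
  have hδ : 0 < 2 / p.τd := by positivity
  have hδ1 : 2 / p.τd < 1 := (div_lt_one (by positivity)).2 hp.τd_gt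
  have hc : 0 ≤ p.cD := by
    rw [Params.cD_eq hp.τd_gt]
    have h1 := hp.ξ_pos
    have h2 := lowerGamma_two_nonneg (x := p.ξ * Real.pi * p.θ ^ 2) (by positivity)
    have h3 := (lintegral_law_rpow_eq hp.fadID_valid hδ.le hδ1.le).2
    have h4 : 0 ≤ Real.Gamma (1 - 2 / p.τd) := (Real.Gamma_pos_of_pos (by linarith)).le
    have h5 := hp.q_mem.1
    have h6 := hp.ε_mem.1
    have h7 := hp.lam_pos
    positivity
  refine ae_lt_top_and_laplace_eq
    ((S.measurable_interfD_sig p (subset_univ _)).mono (hS.sig_le _) le_rfl) (fun s hs => ?_) ?_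
  · rw [← negExp_ofReal (by positivity), ← lintegral_ueIntf hp hs,
      ← hS.lintegral_negExp_tsum_ue hp (f := fun z => ENNReal.ofReal s * ueIntf p z)
        ((measurable_ueIntf p).const_mul _)]
    simp only [ENNReal.tsum_mul_left, interfD_eq_tsum]
  · have : ContinuousAt (fun s : ℝ => p.cD * s ^ (2 / p.τd)) 0 :=
      continuousAt_const.mul (Real.continuousAt_rpow_const _ _ (Or.inr hδ.le))
    have h := this.tendsto
    simp only [Real.zero_rpow hδ.ne', mul_zero] at h
    exact h.mono_left nhdsWithin_le_nhds

end Network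

end

section

/-! ### The load of the cell and the average rates -/

theorem isProbabilityMeasure_boolLaw {r : ℝ} (hr : r ∈ Icc (0 : ℝ) 1) :
    IsProbabilityMeasure (boolLaw r) := ⟨by
  rw [← lintegral_one, Network.lintegral_boolLaw, mul_one, mul_one,
    ← ENNReal.ofReal_add hr.1 (by linarith [hr.2])]
  simp⟩

theorem Params.R_sq {p : Params} (hp : p.Valid) : p.R ^ 2 = 1 / (Real.pi * p.lamB) := by
  have := hp.lamB_pos
  have := Real.pi_pos
  exact Real.sq_sqrt (by positivity)

theorem Params.R_pos {p : Params} (hp : p.Valid) : 0 < p.R := by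
  have := hp.lamB_pos
  have := Real.pi_pos
  exact Real.sqrt_pos.2 (by positivity)

theorem volume_cell {p : Params} (hp : p.Valid) :
    volume (Metric.ball (0 : Plane) p.R) = ENNReal.ofReal (1 / p.lamB) := by
  rw [EuclideanSpace.volume_ball_fin_two, ← ENNReal.ofReal_pow (Params.R_pos hp).le,
    ← ENNReal.ofReal_mul (by positivity), Params.R_sq hp]
  congr 1
  have := hp.lamB_pos
  have := Real.pi_pos
  field_simp

theorem lenLawD_real_Iic {ξ θ : ℝ} (hξ : 0 < ξ) (hθ : 0 ≤ θ) :
    (lenLawD ξ).real (Iic θ) = 1 - Real.exp (-(ξ * Real.pi * θ ^ 2)) := by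
  have : Real.exp (-(ξ * Real.pi * θ ^ 2)) ≤ 1 :=
    Real.exp_le_one_iff.2 (neg_nonpos.2 (by positivity))
  rw [Measure.real, lenLawD_Iic hξ hθ, ENNReal.toReal_ofReal (by linarith)]

theorem Params.lamC_pos {p : Params} (hp : p.Valid) [IsProbabilityMeasure (lenLawD p.ξ)] :
    0 < p.lamC := by
  have h1 : 0 < (lenLawD p.ξ).real (Ioi p.θ) := by
    have h := prob_compl_eq_one_sub (μ := lenLawD p.ξ) (measurableSet_Iic (a := p.θ))
    rw [compl_Iic] at h
    rw [Measure.real, h, ENNReal.toReal_sub_of_le prob_le_one ENNReal.one_ne_top]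
    change 0 < 1 - (lenLawD p.ξ).real (Iic p.θ)
    rw [lenLawD_real_Iic hp.ξ_pos hp.θ_nonneg, sub_sub_cancel]
    exact Real.exp_pos _
  have hq := hp.q_mem
  have hl := hp.lam_pos
  unfold Params.lamC
  refine mul_pos ?_ hl
  -- For `q = 1` positivity rests on `P(L > θ) > 0` alone.
  rcases eq_or_lt_of_le hq.2 with h | h
  · rw [h]; linarith
  · have := mul_nonneg hq.1 h1.le
    linarith

namespace Network

variable {Ω : Type*} [MeasurableSpace Ω] {S : Network Ω} {P : Measure Ω} {p : Params}

/-- The integrand is constant on the cell, whose area is `1 / λ_b`, and zero elsewhere. The marks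
contribute the probability of cellular mode, so the intensity becomes `λ_c / λ_b`. -/
theorem lintegral_ueRival (hp : p.Valid) [IsProbabilityMeasure (lenLawD p.ξ)]
    [IsProbabilityMeasure p.fadID.law] {u : ℝ} (hu : 0 ≤ u) :
    ENNReal.ofReal p.lam * ∫⁻ m, ∫⁻ x, 1 - negExp (ENNReal.ofReal u * ueRival p (x, m)) ∂volume
      ∂(ueMarkLaw p) = ENNReal.ofReal (p.lamC / p.lamB * (1 - Real.exp (-u))) := by
  have := isProbabilityMeasure_boolLaw hp.q_mem
  have := isProbabilityMeasure_boolLaw hp.ε_mem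
  let A₀ : Bool × Bool → ℝ≥0∞ := fun b => if b.1 = true then 0 else 1
  let A₁ : Bool × Bool → ℝ≥0∞ := fun b => if b.1 = true then 1 else 0
  let B₁ : ℝ × ℝ → ℝ≥0∞ := fun z => (Ioi p.θ).indicator (fun _ => 1) z.1
  have hB₁ : Measurable B₁ :=
    (measurable_const.indicator measurableSet_Ioi).comp measurable_fst
  have hA₀ : Measurable A₀ := .of_discrete
  have hA₁ : Measurable A₁ := .of_discrete
  have hexp : Real.exp (-u) ≤ 1 := Real.exp_le_one_iff.2 (by linarith)
  have key : ∀ m, ∫⁻ x, 1 - negExp (ENNReal.ofReal u * ueRival p (x, m)) ∂volume =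
      -- Cellular mode is split into disjoint cases: not a potential D2D UE, or one whose link is
      -- too long.
      ENNReal.ofReal ((1 - Real.exp (-u)) * (1 / p.lamB)) * (A₀ m.1 * 1 + A₁ m.1 * B₁ m.2) := by
    rintro ⟨⟨d, t⟩, ⟨l, g⟩⟩
    by_cases hc : d = false ∨ p.θ < l
    · have e : ∀ x : Plane, 1 - negExp (ENNReal.ofReal u * ueRival p (x, ((d, t), (l, g)))) =
          (Metric.ball (0 : Plane) p.R).indicator
            (fun _ => ENNReal.ofReal (1 - Real.exp (-u))) x := by
        intro x
        by_cases hx : x ∈ Metric.ball (0 : Plane) p.R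
        · rw [indicator_of_mem hx, ueRival, if_pos ⟨hx, hc⟩, mul_one, negExp_ofReal hu,
            ENNReal.ofReal_sub _ (Real.exp_nonneg _), ENNReal.ofReal_one]
        · rw [indicator_of_notMem hx, ueRival, if_neg fun h => hx h.1]
          simp
      have e2 : A₀ (d, t) * 1 + A₁ (d, t) * B₁ (l, g) = 1 := by
        cases d
        · simp [A₀, A₁]
        · have : p.θ < l := by simpa using hc
          simp [A₀, A₁, B₁, this]
      simp only [e]
      rw [lintegral_indicator_const measurableSet_ball, volume_cell hp, e2,
        ENNReal.ofReal_mul (by linarith), mul_one]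
    · have e : ∀ x : Plane, ueRival p (x, ((d, t), (l, g))) = 0 := fun x => by
        rw [ueRival, if_neg fun h => hc h.2]
      have h1 : d = true := by simpa using fun h => hc (Or.inl h)
      have h2 : ¬ p.θ < l := fun h => hc (Or.inr h)
      have e2 : A₀ (d, t) * 1 + A₁ (d, t) * B₁ (l, g) = 0 := by
        simp [A₀, A₁, B₁, h1, h2]
      simp only
      rw [e2]
      simp [e]
  have hI : ∀ f : Bool → ℝ≥0∞, ∫⁻ b, f b.1 ∂((boolLaw p.q).prod (boolLaw p.ε)) =
      ENNReal.ofReal p.q * f true + ENNReal.ofReal (1 - p.q) * f false := by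
    intro f
    have := lintegral_prod_mul (μ := boolLaw p.q) (ν := boolLaw p.ε) (f := f) (g := fun _ => 1)
      (Measurable.of_discrete).aemeasurable (Measurable.of_discrete).aemeasurable
    rw [lintegral_boolLaw] at this
    simpa only [mul_one, lintegral_one, measure_univ] using this
  have hJ : ∫⁻ z, B₁ z ∂((lenLawD p.ξ).prod p.fadID.law) =
      ENNReal.ofReal ((lenLawD p.ξ).real (Ioi p.θ)) := by
    have := lintegral_prod_mul (μ := lenLawD p.ξ) (ν := p.fadID.law)
      (f := (Ioi p.θ).indicator (fun _ => 1)) (g := fun _ => 1)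
      (measurable_const.indicator measurableSet_Ioi).aemeasurable aemeasurable_const
    simpa [lintegral_indicator_const measurableSet_Ioi] using this
  have hm : ∫⁻ m, (A₀ m.1 * 1 + A₁ m.1 * B₁ m.2) ∂(ueMarkLaw p) =
      ENNReal.ofReal ((1 - p.q) + p.q * (lenLawD p.ξ).real (Ioi p.θ)) := by
    have hq := hp.q_mem
    rw [lintegral_add_left (by fun_prop), ueMarkLaw,
      lintegral_prod_mul (f := A₀) (g := fun _ => 1) hA₀.aemeasurable aemeasurable_const,
      lintegral_prod_mul hA₁.aemeasurable hB₁.aemeasurable, hJ]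
    simp only [A₀, A₁]
    rw [hI fun b => if b = true then 0 else 1, hI fun b => if b = true then 1 else 0,
      ENNReal.ofReal_add (by linarith [hq.2]) (mul_nonneg hq.1 measureReal_nonneg),
      ENNReal.ofReal_mul hq.1]
    simp
  simp only [key]
  rw [lintegral_const_mul _ (by fun_prop), hm]
  have hq := hp.q_mem
  have hb := hp.lamB_pos
  have h1 : 0 ≤ 1 - Real.exp (-u) := by linarith
  rw [← ENNReal.ofReal_mul (by positivity), ← ENNReal.ofReal_mul hp.lam_pos.le]
  congr 1
  unfold Params.lamC
  ring

theorem IsModel.rivals_lt_top_and_laplace [IsProbabilityMeasure P] (hp : p.Valid)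
    (hS : S.IsModel P p) : (∀ᵐ ω ∂P, ((S.rivals p ω).encard : ℝ≥0∞) < ∞) ∧ ∀ u, 0 < u →
      laplace P (fun ω => ((S.rivals p ω).encard : ℝ≥0∞)) u =
        Real.exp (-(p.lamC / p.lamB * (1 - Real.exp (-u)))) := by
  have := hS.isProbabilityMeasure_lenLawD
  have := hS.isProbabilityMeasure_fadID
  refine ae_lt_top_and_laplace_eq
    ((S.measurable_rivals_sig p (subset_univ _)).mono (hS.sig_le _) le_rfl) (fun u hu => ?_) ?_
  · have h0 : 0 ≤ p.lamC / p.lamB * (1 - Real.exp (-u)) := by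
      have h1 := Params.lamC_pos hp
      have h2 := hp.lamB_pos
      have h3 : Real.exp (-u) ≤ 1 := Real.exp_le_one_iff.2 (by linarith)
      have h4 : 0 ≤ 1 - Real.exp (-u) := by linarith
      positivity
    rw [← negExp_ofReal h0, ← lintegral_ueRival hp hu.le,
      ← hS.lintegral_negExp_tsum_ue hp (f := fun z => ENNReal.ofReal u * ueRival p z)
        ((measurable_ueRival p).const_mul _)]
    simp only [ENNReal.tsum_mul_left, encard_rivals]
  · have : Continuous fun u : ℝ => p.lamC / p.lamB * (1 - Real.exp (-u)) := by fun_prop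
    have h := this.tendsto 0
    simp only [neg_zero, Real.exp_zero, sub_self, mul_zero] at h
    exact h.mono_left nhdsWithin_le_nhds

theorem integral_exp_neg_mul_exp {m : ℝ} (hm : 0 < m) :
    ∫ u in Ioi (0 : ℝ), Real.exp (-u) * Real.exp (-(m * (1 - Real.exp (-u)))) =
      1 / m * (1 - Real.exp (-m)) := by
  have hd : ∀ u ∈ Ici (0 : ℝ),
      HasDerivAt (fun u => -(1 / m * Real.exp (-(m * (1 - Real.exp (-u))))))
      (Real.exp (-u) * Real.exp (-(m * (1 - Real.exp (-u))))) u := by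
    intro u _
    have h1 : HasDerivAt (fun u : ℝ => Real.exp (-u)) (Real.exp (-u) * (-1)) u :=
      (hasDerivAt_id u).neg.exp
    have h2 := ((((h1.const_sub 1).const_mul m).fun_neg).exp.const_mul (1 / m)).fun_neg
    refine h2.congr_deriv ?_
    field_simp
  have hl : Tendsto (fun u : ℝ => -(1 / m * Real.exp (-(m * (1 - Real.exp (-u)))))) atTop
      (𝓝 (-(1 / m * Real.exp (-(m * (1 - 0)))))) := by
    have h1 : Tendsto (fun u : ℝ => Real.exp (-u)) atTop (𝓝 0) :=
      Real.tendsto_exp_neg_atTop_nhds_zero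
    exact (((Real.continuous_exp.tendsto _).comp
      (((h1.const_sub 1).const_mul m).neg)).const_mul _).neg
  rw [integral_Ioi_of_hasDerivAt_of_nonneg' hd (fun u _ => by positivity) hl]
  simp
  ring

/-- `1 / (1 + K) = ∫_0^∞ e^{-u} e^{-uK} du`, so the mean depends only on the Laplace transform of
`K`, and the law itself is never identified. -/
theorem integral_one_div_one_add [IsProbabilityMeasure P] {K : Ω → ℝ≥0∞} (hK : Measurable K)
    {m : ℝ} (hm : 0 < m)
    (h : ∀ u, 0 < u → laplace P K u = Real.exp (-(m * (1 - Real.exp (-u))))) :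
    ∫ ω, 1 / (1 + (K ω).toReal) ∂P = 1 / m * (1 - Real.exp (-m)) := by
  have e1 : ∀ ω, 1 / (1 + (K ω).toReal) =
      ∫ u in Ioi (0 : ℝ), Real.exp (-u) * Real.exp (-(u * (K ω).toReal)) := by
    intro ω
    have h0 : 0 ≤ (K ω).toReal := ENNReal.toReal_nonneg
    have := integral_exp_mul_Ioi (a := -(1 + (K ω).toReal)) (by linarith) 0
    simp only [mul_zero, Real.exp_zero] at this
    rw [neg_div_neg_eq] at this
    rw [← this]
    congr 1; ext u
    rw [← Real.exp_add]
    congr 1; ring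
  simp only [e1]
  rw [integral_integral_swap]
  · rw [← integral_exp_neg_mul_exp hm]
    refine setIntegral_congr_fun measurableSet_Ioi fun u hu => ?_
    rw [integral_const_mul, ← h u hu]
    rfl
  · have hb : Integrable (fun z : Ω × ℝ => Real.exp (-z.2)) (P.prod (volume.restrict (Ioi 0))) :=
      Integrable.comp_snd (integrableOn_exp_neg_Ioi 0) P
    refine hb.mono' (Measurable.aestronglyMeasurable (by
      unfold Function.uncurry; fun_prop)) ?_
    have hpos : ∀ᵐ z ∂(P.prod (volume.restrict (Ioi (0 : ℝ)))), 0 < z.2 :=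
      Measure.quasiMeasurePreserving_snd.ae (ae_restrict_mem measurableSet_Ioi)
    filter_upwards [hpos] with z hz
    simp only [Function.uncurry]
    rw [Real.norm_of_nonneg (by positivity)]
    exact mul_le_of_le_one_right (Real.exp_pos _).le
      (Real.exp_le_one_iff.2 (by
        have : 0 ≤ (K z.1).toReal := ENNReal.toReal_nonneg
        nlinarith))

/-- This holds without a finiteness assumption: for an infinite set both `ncard` and `toReal ∞` are
`0`. -/
theorem one_div_numCell {Ω : Type*} (S : Network Ω) (p : Params) (ω : Ω) :
    1 / (S.numCell p ω : ℝ) = 1 / (1 + ((S.rivals p ω).encard : ℝ≥0∞).toReal) := by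
  unfold numCell
  rcases (S.rivals p ω).finite_or_infinite with h | h
  · rw [← h.cast_ncard_eq]; simp
  · rw [h.ncard, h.encard_eq]; simp

end Network

end

/-! ### The average rates. -/

section

namespace Network

variable {Ω : Type*} [MeasurableSpace Ω] {S : Network Ω} {P : Measure Ω} {p : Params}

theorem disjoint_ueSources_cellSources : Disjoint ueSources cellSources := by
  rw [Set.disjoint_left]
  rintro s (h | h) (h' | h')
  · rw [mem_singleton_iff] at h h'
    subst h; simp at h'
  · rw [mem_singleton_iff] at h
    subst h; simp [cellMarkSources] at h'
  · rw [mem_singleton_iff] at h'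
    subst h'; simp [ueMarkSources] at h
  · simp only [mem_iUnion, ueMarkSources, cellMarkSources, mem_insert_iff,
      mem_singleton_iff] at h h'
    obtain ⟨i, h⟩ := h
    obtain ⟨j, h'⟩ := h'
    rcases h with h | h | h | h <;> subst h <;> simp at h'

theorem notMem_ueSources {s : Source} (hs : s = .len0 ∨ s = .tx0 ∨ s = .W_c ∨ s = .W_d) :
    s ∉ ueSources := by
  rintro (h | h)
  · rw [mem_singleton_iff] at h; subst h; simp at hs
  · simp only [mem_iUnion, ueMarkSources, mem_insert_iff, mem_singleton_iff] at h
    obtain ⟨i, h⟩ := h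
    rcases h with h | h | h | h <;> subst h <;> simp at hs

theorem notMem_cellSources {s : Source} (hs : s = .len0 ∨ s = .tx0 ∨ s = .W_c ∨ s = .W_d) :
    s ∉ cellSources := by
  rintro (h | h)
  · rw [mem_singleton_iff] at h; subst h; simp at hs
  · simp only [mem_iUnion, cellMarkSources, mem_insert_iff, mem_singleton_iff] at h
    obtain ⟨i, h⟩ := h
    rcases h with h | h <;> subst h <;> simp at hs

theorem measurable_log_sinrC_sig {Ω : Type*} (S : Network Ω) (p : Params) :
    Measurable[S.sig (cellSources ∪ {.W_c})] fun ω => Real.log (1 + S.sinrC p ω) := by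
  have h1 : Measurable[S.sig (cellSources ∪ {.W_c})] S.W_c :=
    S.measurable_source_sig (s := .W_c) (Or.inr rfl)
  have h2 := S.measurable_interfC_sig p (T := cellSources ∪ {.W_c}) subset_union_left
  exact Real.measurable_log.comp ((h1.div (h2.ennreal_toReal.add_const _)).const_add _)

theorem measurable_log_sinrD_sig {Ω : Type*} (S : Network Ω) (p : Params) :
    Measurable[S.sig (ueSources ∪ {.W_d})] fun ω => Real.log (1 + S.sinrD p ω) := by
  have h1 : Measurable[S.sig (ueSources ∪ {.W_d})] S.W_d :=
    S.measurable_source_sig (s := .W_d) (Or.inr rfl)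
  have h2 := S.measurable_interfD_sig p (T := ueSources ∪ {.W_d}) subset_union_left
  exact Real.measurable_log.comp ((h1.div (h2.ennreal_toReal.add_const _)).const_add _)

theorem measurable_one_div_numCell_sig {Ω : Type*} (S : Network Ω) (p : Params) :
    Measurable[S.sig ueSources] fun ω => 1 / (S.numCell p ω : ℝ) := by
  simp only [one_div_numCell]
  exact ((S.measurable_rivals_sig p subset_rfl).ennreal_toReal.const_add 1).const_div 1

theorem sig_mono {Ω : Type*} (S : Network Ω) {T T' : Set Source} (h : T ⊆ T') :
    S.sig T ≤ S.sig T' :=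
  biSup_mono h

theorem measurable_rateC_sig {Ω : Type*} (S : Network Ω) (p : Params) :
    Measurable[S.sig (ueSources ∪ cellSources ∪ {.W_c})] (S.rateC p) := by
  have h1 := (S.measurable_one_div_numCell_sig p).mono
    (S.sig_mono (T' := ueSources ∪ cellSources ∪ {.W_c})
      (subset_union_left.trans subset_union_left)) le_rfl
  have h2 := (S.measurable_log_sinrC_sig p).mono
    (S.sig_mono (T' := ueSources ∪ cellSources ∪ {.W_c})
      (union_subset_union_left _ subset_union_right)) le_rfl
  exact (h1.const_mul (1 - p.β)).mul h2

theorem measurable_rateDHat_sig {Ω : Type*} (S : Network Ω) (p : Params) :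
    Measurable[S.sig (ueSources ∪ {.W_d} ∪ {.tx0})] (S.rateDHat p) := by
  have h1 := (S.measurable_log_sinrD_sig p).mono
    (S.sig_mono (T' := ueSources ∪ {.W_d} ∪ {.tx0}) subset_union_left) le_rfl
  have h2 : Measurable[S.sig (ueSources ∪ {.W_d} ∪ {.tx0})] S.tx0 :=
    S.measurable_source_sig (s := .tx0) (Or.inr rfl)
  have h3 := h2 (measurableSet_singleton true)
  exact (Measurable.ite h3 h1 measurable_const).const_mul p.β

/-- The expectation of a function over an independent event. -/
theorem IsModel.integral_indicator_eq (hS : S.IsModel P p) {T T' : Set Source}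
    (hT : Disjoint T T') {A : Set Ω} (hA : MeasurableSet[S.sig T] A) {f : Ω → ℝ}
    (hf : Measurable[S.sig T'] f) : ∫ ω, A.indicator f ω ∂P = P.real A * ∫ ω, f ω ∂P := by
  have hA' : MeasurableSet A := hS.sig_le T _ hA
  have h1 : Measurable[S.sig T] (A.indicator fun _ => (1 : ℝ)) := measurable_const.indicator hA
  have h2 := (hS.indepFun hT h1 hf).integral_fun_mul_eq_mul_integral
    (h1.mono (hS.sig_le T) le_rfl).aestronglyMeasurable
    (hf.mono (hS.sig_le T') le_rfl).aestronglyMeasurable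
  rw [integral_indicator_const _ hA', smul_eq_mul, mul_one] at h2
  rw [← h2]
  congr 1; ext ω
  by_cases h : ω ∈ A <;> simp [h]

theorem IsModel.evaluatesLogMean_C [IsProbabilityMeasure P] (hp : p.Valid) (hS : S.IsModel P p) :
    EvaluatesLogMean P S.W_c (S.interfC p) p.N₀ p.fadC := by
  refine evaluatesLogMean hp.fadC_valid (hS.measurable .W_c) hS.W_c_law
    ((S.measurable_interfC_sig p (subset_univ _)).mono (hS.sig_le _) le_rfl) ?_ hp.N₀_pos
  exact hS.indepFun (T := {.W_c}) (T' := cellSources)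
    (disjoint_singleton_left.2 (notMem_cellSources (by simp)))
    (S.measurable_source_sig (s := .W_c) rfl) (S.measurable_interfC_sig p subset_rfl)

theorem IsModel.evaluatesLogMean_D [IsProbabilityMeasure P] (hp : p.Valid) (hS : S.IsModel P p) :
    EvaluatesLogMean P S.W_d (S.interfD p) p.N₀ p.fadD := by
  refine evaluatesLogMean hp.fadD_valid (hS.measurable .W_d) hS.W_d_law
    ((S.measurable_interfD_sig p (subset_univ _)).mono (hS.sig_le _) le_rfl) ?_ hp.N₀_pos
  exact hS.indepFun (T := {.W_d}) (T' := ueSources)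
    (disjoint_singleton_left.2 (notMem_ueSources (by simp)))
    (S.measurable_source_sig (s := .W_d) rfl) (S.measurable_interfD_sig p subset_rfl)

theorem IsModel.integrable_rateC [IsProbabilityMeasure P] (hp : p.Valid) (hS : S.IsModel P p) :
    Integrable (S.rateC p) P := by
  have h := (hS.evaluatesLogMean_C hp).integrable
  have hm : Measurable fun ω => 1 / (S.numCell p ω : ℝ) :=
    (S.measurable_one_div_numCell_sig p).mono (hS.sig_le _) le_rfl
  refine (h.bdd_mul (c := |1 - p.β|) (hm.const_mul (1 - p.β)).aestronglyMeasurable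
    (Eventually.of_forall fun ω => ?_))
  rw [norm_mul, Real.norm_eq_abs, Real.norm_eq_abs]
  refine mul_le_of_le_one_right (abs_nonneg _) ?_
  rw [abs_of_nonneg (by positivity)]
  unfold numCell
  push_cast
  rw [div_le_one (by positivity)]
  have : (0 : ℝ) ≤ ((S.rivals p ω).ncard : ℝ) := by positivity
  linarith

theorem rateDHat_eq {Ω : Type*} (S : Network Ω) (p : Params) :
    S.rateDHat p = fun ω => p.β * {ω | S.tx0 ω = true}.indicator
      (fun ω => Real.log (1 + S.sinrD p ω)) ω := by
  ext ω
  by_cases h : S.tx0 ω = true <;> simp [rateDHat, indicator, h]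

theorem rateD_eq {Ω : Type*} (S : Network Ω) (p : Params) :
    S.rateD p = fun ω => {ω | p.θ < S.len0 ω}.indicator (S.rateC p) ω +
      {ω | S.len0 ω ≤ p.θ}.indicator (S.rateDHat p) ω := by
  ext ω
  by_cases h : S.len0 ω ≤ p.θ
  · have h' : ¬ p.θ < S.len0 ω := not_lt.2 h
    simp [rateD, indicator, h]
  · have h' : p.θ < S.len0 ω := not_le.1 h
    simp [rateD, indicator, h, h']

theorem IsModel.measurableSet_tx0 (hS : S.IsModel P p) : MeasurableSet {ω | S.tx0 ω = true} :=
  hS.measurable .tx0 (measurableSet_singleton true)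

theorem IsModel.integrable_rateDHat [IsProbabilityMeasure P] (hp : p.Valid)
    (hS : S.IsModel P p) : Integrable (S.rateDHat p) P := by
  rw [rateDHat_eq]
  exact ((hS.evaluatesLogMean_D hp).integrable.indicator hS.measurableSet_tx0).const_mul _

theorem IsModel.measurableSet_len0_le (hS : S.IsModel P p) :
    MeasurableSet {ω | S.len0 ω ≤ p.θ} :=
  hS.measurable .len0 (measurableSet_Iic (a := p.θ))

theorem IsModel.measurableSet_lt_len0 (hS : S.IsModel P p) :
    MeasurableSet {ω | p.θ < S.len0 ω} :=
  hS.measurable .len0 (measurableSet_Ioi (a := p.θ))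

theorem IsModel.integrable_rateD [IsProbabilityMeasure P] (hp : p.Valid)
    (hS : S.IsModel P p) : Integrable (S.rateD p) P := by
  rw [rateD_eq]
  exact ((hS.integrable_rateC hp).indicator hS.measurableSet_lt_len0).add
    ((hS.integrable_rateDHat hp).indicator hS.measurableSet_len0_le)

/-- The load depends on the UEs only, the SINR on the cellular transmitters and `W_c` only. These
sources are disjoint, so the mean of the product is the product of the means. -/
theorem IsModel.integral_rateC [IsProbabilityMeasure P] (hp : p.Valid) (hS : S.IsModel P p) :
    ∫ ω, S.rateC p ω ∂P =
      (1 - p.β) * (p.lamB / p.lamC) * (1 - Real.exp (-(p.lamC / p.lamB))) *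
        ∫ ω, Real.log (1 + S.W_c ω / ((S.interfC p ω).toReal + p.N₀)) ∂P := by
  have := hS.isProbabilityMeasure_lenLawD
  have hC := Params.lamC_pos hp
  have hB := hp.lamB_pos
  have hd : Disjoint ueSources (cellSources ∪ {.W_c}) :=
    disjoint_union_right.2 ⟨disjoint_ueSources_cellSources,
      disjoint_singleton_right.2 (notMem_ueSources (by simp))⟩
  have h1 := S.measurable_one_div_numCell_sig p
  have h2 := S.measurable_log_sinrC_sig p
  have h3 := (hS.indepFun hd h1 h2).integral_fun_mul_eq_mul_integral
    (h1.mono (hS.sig_le _) le_rfl).aestronglyMeasurable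
    (h2.mono (hS.sig_le _) le_rfl).aestronglyMeasurable
  have h4 := integral_one_div_one_add (P := P)
    ((S.measurable_rivals_sig p (subset_univ _)).mono (hS.sig_le _) le_rfl) (div_pos hC hB)
    (hS.rivals_lt_top_and_laplace hp).2
  simp only [← one_div_numCell] at h4
  unfold rateC
  simp only [mul_assoc]
  rw [integral_const_mul, h3, h4]
  simp only [sinrC, one_div_div, mul_assoc]

theorem IsModel.integral_rateDHat [IsProbabilityMeasure P] (hp : p.Valid)
    (hS : S.IsModel P p) :
    ∫ ω, S.rateDHat p ω ∂P =
      p.β * p.ε * ∫ ω, Real.log (1 + S.W_d ω / ((S.interfD p ω).toReal + p.N₀)) ∂P := by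
  have hm : Measurable[S.sig {.tx0}] S.tx0 :=
    S.measurable_source_sig (s := .tx0) (mem_singleton _)
  have hA : MeasurableSet[S.sig {.tx0}] {ω | S.tx0 ω = true} := hm (measurableSet_singleton true)
  have hd : Disjoint ({.tx0} : Set Source) (ueSources ∪ {.W_d}) :=
    disjoint_singleton_left.2 (by
      rintro (h | h)
      · exact notMem_ueSources (by simp) h
      · simp at h)
  have h := hS.integral_indicator_eq hd hA (S.measurable_log_sinrD_sig p)
  rw [rateDHat_eq, integral_const_mul, h, Measure.real, hS.tx0_prob,
    ENNReal.toReal_ofReal hp.ε_mem.1, ← mul_assoc]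
  rfl

theorem IsModel.integral_rateD [IsProbabilityMeasure P] (hp : p.Valid)
    (hS : S.IsModel P p) :
    ∫ ω, S.rateD p ω ∂P =
      (∫ ω, S.rateC p ω ∂P) * P.real {ω | p.θ < S.len0 ω} +
        (∫ ω, S.rateDHat p ω ∂P) * P.real {ω | S.len0 ω ≤ p.θ} := by
  have hm : Measurable[S.sig {.len0}] S.len0 :=
    S.measurable_source_sig (s := .len0) (mem_singleton _)
  have hA : MeasurableSet[S.sig {.len0}] {ω | p.θ < S.len0 ω} := hm measurableSet_Ioi
  have hB : MeasurableSet[S.sig {.len0}] {ω | S.len0 ω ≤ p.θ} := hm measurableSet_Iic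
  have hdA : Disjoint ({.len0} : Set Source) (ueSources ∪ cellSources ∪ {.W_c}) :=
    disjoint_singleton_left.2 (by
      rintro ((h | h) | h)
      · exact notMem_ueSources (by simp) h
      · exact notMem_cellSources (by simp) h
      · simp at h)
  have hdB : Disjoint ({.len0} : Set Source) (ueSources ∪ {.W_d} ∪ {.tx0}) :=
    disjoint_singleton_left.2 (by
      rintro ((h | h) | h)
      · exact notMem_ueSources (by simp) h
      · simp at h
      · simp at h)
  rw [rateD_eq, integral_add ((hS.integrable_rateC hp).indicator hS.measurableSet_lt_len0)
    ((hS.integrable_rateDHat hp).indicator hS.measurableSet_len0_le),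
    hS.integral_indicator_eq hdA hA (S.measurable_rateC_sig p),
    hS.integral_indicator_eq hdB hB (S.measurable_rateDHat_sig p), mul_comm,
    mul_comm (P.real _)]

theorem IsModel.real_len0_le (hp : p.Valid) (hS : S.IsModel P p) :
    P.real {ω | S.len0 ω ≤ p.θ} = 1 - Real.exp (-(p.ξ * Real.pi * p.θ ^ 2)) := by
  have hm : Measurable S.len0 := hS.measurable .len0
  rw [← lenLawD_real_Iic hp.ξ_pos hp.θ_nonneg, ← hS.len0_law.map_eq, Measure.real, Measure.real,
    Measure.map_apply hm measurableSet_Iic]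
  rfl

end Network

end

/-! ### The Mellin-Barnes integral -/

theorem integrableOn_rpow_mul_one_add_rpow {a k : ℝ} (ha : 0 < a) (hak : a < k) :
    IntegrableOn (fun y : ℝ => y ^ (a - 1) * (1 + y) ^ (-k)) (Ioi 0) := by
  have hm : Measurable fun y : ℝ => y ^ (a - 1) * (1 + y) ^ (-k) := by fun_prop
  rw [← Ioc_union_Ioi_eq_Ioi zero_le_one, integrableOn_union]
  constructor
  · have h : IntegrableOn (fun y : ℝ => y ^ (a - 1)) (Ioc 0 1) :=
      (intervalIntegrable_iff_integrableOn_Ioc_of_le zero_le_one).1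
        (intervalIntegral.intervalIntegrable_rpow' (by linarith))
    refine h.mono' hm.aestronglyMeasurable ?_
    filter_upwards [ae_restrict_mem measurableSet_Ioc] with y hy
    have hy0 := hy.1
    rw [Real.norm_of_nonneg (by positivity)]
    exact mul_le_of_le_one_right (by positivity)
      (Real.rpow_le_one_of_one_le_of_nonpos (by linarith) (by linarith))
  · have h : IntegrableOn (fun y : ℝ => y ^ (a - 1 - k)) (Ioi 1) :=
      integrableOn_Ioi_rpow_of_lt (by linarith) one_pos
    refine h.mono' hm.aestronglyMeasurable ?_
    filter_upwards [ae_restrict_mem measurableSet_Ioi] with y hy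
    have hy0 : (0 : ℝ) < y := one_pos.trans hy
    rw [Real.norm_of_nonneg (by positivity), sub_eq_add_neg (a - 1) k, Real.rpow_add hy0]
    exact mul_le_mul_of_nonneg_left
      (Real.rpow_le_rpow_of_nonpos hy0 (by linarith) (by linarith)) (by positivity)

/-- The Beta integral over the half-line. -/
theorem integral_cpow_mul_one_add_rpow {a : ℂ} {k : ℝ} (ha : 0 < a.re) (hak : a.re < k) :
    ∫ y in Ioi (0 : ℝ), (y : ℂ) ^ (a - 1) * ((1 + y) ^ (-k) : ℝ) =
      Complex.Gamma a * Complex.Gamma (k - a) / Complex.Gamma k := by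
  have hk : 0 < k := ha.trans hak
  -- Inserting `Γ(k) (1 + y)^{-k} = ∫ t^{k-1} e^{-(1+y)t} dt` and integrating over `y` first leaves
  -- two Gamma integrals.
  let K : ℝ → ℝ → ℂ := fun y t =>
    (y : ℂ) ^ (a - 1) * ((t ^ (k - 1) * Real.exp (-((1 + y) * t)) : ℝ) : ℂ)
  have h1 : ∀ y ∈ Ioi (0 : ℝ), ∫ t in Ioi (0 : ℝ), K y t =
      Complex.Gamma k * ((y : ℂ) ^ (a - 1) * ((1 + y) ^ (-k) : ℝ)) := by
    intro y hy
    have hy0 : (0 : ℝ) < 1 + y := by have : (0 : ℝ) < y := hy; linarith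
    simp only [K]
    rw [integral_const_mul, integral_complex_ofReal, Real.integral_rpow_mul_exp_neg_mul_Ioi hk hy0,
      one_div, Real.inv_rpow hy0.le, ← Real.rpow_neg hy0.le, Complex.ofReal_mul,
      Complex.Gamma_ofReal]
    ring
  have h2 : ∀ t ∈ Ioi (0 : ℝ), ∫ y in Ioi (0 : ℝ), K y t =
      Complex.Gamma a * ((t : ℂ) ^ ((k - a : ℂ) - 1) * Complex.exp (-((1 : ℝ) * t))) := by
    intro t ht
    have ht0 : (0 : ℝ) < t := ht
    have e : ∀ y : ℝ, K y t = ((t ^ (k - 1) * Real.exp (-t) : ℝ) : ℂ) *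
        ((y : ℂ) ^ (a - 1) * Complex.exp (-(t * y))) := by
      intro y
      simp only [K]
      rw [show -((1 + y) * t) = -t + -(t * y) by ring, Real.exp_add]
      push_cast
      ring
    simp only [e]
    rw [integral_const_mul, Complex.integral_cpow_mul_exp_neg_mul_Ioi ha ht0]
    have htc : (t : ℂ) ≠ 0 := Complex.ofReal_ne_zero.2 ht0.ne'
    have e2 : (1 / (t : ℂ)) ^ a = (t : ℂ) ^ (-a) := by
      rw [one_div, Complex.inv_cpow _ _ (by
        rw [Complex.arg_ofReal_of_nonneg ht0.le]; exact Real.pi_pos.ne), Complex.cpow_neg]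
    have e3 : ((t ^ (k - 1) : ℝ) : ℂ) = (t : ℂ) ^ ((k : ℂ) - 1) := by
      rw [Complex.ofReal_cpow ht0.le]; push_cast; rfl
    have e4 : (t : ℂ) ^ ((k - a : ℂ) - 1) = (t : ℂ) ^ ((k : ℂ) - 1) * (t : ℂ) ^ (-a) := by
      rw [← Complex.cpow_add _ _ htc]; congr 1; ring
    rw [e2, Complex.ofReal_mul, e3, e4]
    push_cast
    rw [one_mul]
    ring
  have hint : Integrable (Function.uncurry K)
      ((volume.restrict (Ioi 0)).prod (volume.restrict (Ioi 0))) := by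
    have hmK : Measurable (Function.uncurry K) := by
      simp only [K, Function.uncurry_def]; fun_prop
    rw [integrable_prod_iff hmK.aestronglyMeasurable]
    have hn : ∀ y ∈ Ioi (0 : ℝ), ∀ t ∈ Ioi (0 : ℝ), ‖K y t‖ =
        y ^ (a.re - 1) * (t ^ (k - 1) * Real.exp (-((1 + y) * t))) := by
      intro y hy t ht
      have ht0 : (0 : ℝ) < t := ht
      simp only [K]
      rw [norm_mul, Complex.norm_real, Real.norm_of_nonneg (by positivity),
        Complex.norm_cpow_eq_rpow_re_of_pos hy]
      simp
    constructor
    · filter_upwards [ae_restrict_mem measurableSet_Ioi] with y hy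
      have hy0 : (0 : ℝ) < 1 + y := by have : (0 : ℝ) < y := hy; linarith
      have h3 : IntegrableOn (fun t : ℝ => t ^ (k - 1) * Real.exp (-((1 + y) * t))) (Ioi 0) := by
        have := integrableOn_rpow_mul_exp_neg_mul_rpow (s := k - 1) (by linarith) one_pos hy0
        simpa only [Real.rpow_one, neg_mul] using this
      exact (Integrable.ofReal (𝕜 := ℂ) h3).const_mul ((y : ℂ) ^ (a - 1))
    · have : IntegrableOn (fun y : ℝ => Real.Gamma k * (y ^ (a.re - 1) * (1 + y) ^ (-k)))
          (Ioi 0) := (integrableOn_rpow_mul_one_add_rpow ha hak).const_mul _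
      refine this.congr_fun (fun y hy => ?_) measurableSet_Ioi
      have hy0 : (0 : ℝ) < 1 + y := by have : (0 : ℝ) < y := hy; linarith
      simp only [Function.uncurry]
      rw [setIntegral_congr_fun measurableSet_Ioi (hn y hy), integral_const_mul,
        Real.integral_rpow_mul_exp_neg_mul_Ioi hk hy0, one_div, Real.inv_rpow hy0.le,
        ← Real.rpow_neg hy0.le]
      ring
  have hswap := integral_integral_swap hint
  rw [setIntegral_congr_fun measurableSet_Ioi h1, setIntegral_congr_fun measurableSet_Ioi h2,
    integral_const_mul, integral_const_mul,
    Complex.integral_cpow_mul_exp_neg_mul_Ioi (by simpa using hak) one_pos] at hswap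
  have hΓ : Complex.Gamma k ≠ 0 := Complex.Gamma_ne_zero_of_re_pos (by simpa using hk)
  rw [eq_div_iff hΓ, mul_comm, hswap]
  simp

theorem norm_Gamma_le {s : ℂ} (hs : 0 < s.re) : ‖Complex.Gamma s‖ ≤ Real.Gamma s.re := by
  rw [Complex.Gamma_eq_integral hs, Real.Gamma_eq_integral hs, Complex.GammaIntegral]
  refine (norm_integral_le_integral_norm _).trans (le_of_eq ?_)
  refine setIntegral_congr_fun measurableSet_Ioi fun x hx => ?_
  rw [norm_mul, Complex.norm_real, Real.norm_of_nonneg (Real.exp_pos _).le,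
    Complex.norm_cpow_eq_rpow_re_of_pos hx]
  simp

/-- `Γ(s) = Γ(s + 1) / s` gains one power of decay on vertical lines. Together with another factor
`1 / w` this suffices for integrability. -/
theorem norm_Gamma_le_div {s : ℂ} (hs : 0 < s.re) :
    ‖Complex.Gamma s‖ ≤ Real.Gamma (s.re + 1) / ‖s‖ := by
  have h0 : s ≠ 0 := by rintro rfl; simp at hs
  rw [le_div_iff₀ (norm_pos_iff.2 h0), mul_comm, ← norm_mul, ← Complex.Gamma_add_one s h0]
  have : 0 < (s + 1).re := by simp; linarith
  simpa using norm_Gamma_le this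

/-- The incomplete Beta function `∫_0^{1/z} y^{δ-1} (1+y)^{-k} dy`. -/
def betaTail (δ k z : ℝ) : ℝ := ∫ y in Ioc 0 (1 / z), y ^ (δ - 1) * (1 + y) ^ (-k)

/-- Mellin inversion recovers a function at its points of continuity. -/
theorem continuousAt_betaTail {δ k z : ℝ} (hδ : 0 < δ) (hk : 0 < k) (hz : 0 < z) :
    ContinuousAt (betaTail δ k) z := by
  let g : ℝ → ℝ := (Ioi 0).indicator fun y => y ^ (δ - 1) * (1 + y) ^ (-k)
  have hgm : Measurable g := Measurable.indicator (by fun_prop) measurableSet_Ioi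
  have hg : ∀ a b, IntervalIntegrable g volume a b := fun a b => by
    refine (intervalIntegral.intervalIntegrable_rpow' (r := δ - 1) (by linarith)).mono_fun
      hgm.aestronglyMeasurable (Eventually.of_forall fun y => ?_)
    by_cases hy : y ∈ Ioi (0 : ℝ)
    · have hy0 : (0 : ℝ) < y := hy
      simp only [g]
      rw [indicator_of_mem hy, norm_mul]
      refine mul_le_of_le_one_right (norm_nonneg _) ?_
      rw [Real.norm_of_nonneg (by positivity)]
      exact Real.rpow_le_one_of_one_le_of_nonpos (by linarith) (by linarith)
    · simp only [g]
      rw [indicator_of_notMem hy, norm_zero]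
      exact norm_nonneg _
  have hc : Continuous fun x => ∫ y in (0 : ℝ)..x, g y :=
    intervalIntegral.continuous_primitive hg 0
  have h1 : ContinuousAt (fun z : ℝ => ∫ y in (0 : ℝ)..(1 / z), g y) z :=
    hc.continuousAt.comp (f := fun z : ℝ => 1 / z) (continuousAt_const.div continuousAt_id hz.ne')
  refine h1.congr ?_
  filter_upwards [lt_mem_nhds hz] with x hx
  rw [intervalIntegral.integral_of_le (by positivity), betaTail]
  exact setIntegral_congr_fun measurableSet_Ioc fun y hy => indicator_of_mem (s := Ioi 0) hy.1 _

/-- The Mellin transform of the incomplete Beta function. -/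
theorem hasMellin_betaTail {δ k : ℝ} {w : ℂ} (hw : 0 < w.re) (hwδ : w.re < δ)
    (hk : δ - w.re < k) :
    HasMellin (fun z => (betaTail δ k z : ℂ)) w
      (Complex.Gamma (δ - w) * Complex.Gamma (k - (δ - w)) / Complex.Gamma k / w) := by
  have hw0 : w ≠ 0 := by rintro rfl; simp at hw
  let g : ℝ → ℝ := fun y => y ^ (δ - 1) * (1 + y) ^ (-k)
  -- The region `y ≤ 1 / z` is symmetric in `y` and `z`. Integrating over `z` first gives `y^{-w} /
  -- w` and leaves the Beta integral with `δ - w` in place of `δ`.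
  let H : ℝ → ℝ → ℂ := fun z y =>
    {q : ℝ × ℝ | q.2 ≤ 1 / q.1}.indicator (fun q => (q.1 : ℂ) ^ (w - 1) * (g q.2 : ℂ)) (z, y)
  have hg : Measurable g := by fun_prop
  have hHm : Measurable (Function.uncurry H) := by
    have h1 : MeasurableSet {q : ℝ × ℝ | q.2 ≤ 1 / q.1} :=
      measurableSet_le measurable_snd (measurable_const.div measurable_fst)
    exact Measurable.indicator (by fun_prop) h1
  have hH1 : ∀ z ∈ Ioi (0 : ℝ), ∀ y ∈ Ioi (0 : ℝ), H z y =
      (z : ℂ) ^ (w - 1) * ((Ioc 0 (1 / z)).indicator g y : ℝ) := by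
    intro z hz y hy
    by_cases h : y ≤ 1 / z
    · have h' : y ∈ Ioc 0 (1 / z) := ⟨hy, h⟩
      simp only [H]
      rw [indicator_of_mem h', indicator_of_mem (by exact h)]
    · have h' : y ∉ Ioc 0 (1 / z) := fun h' => h h'.2
      simp only [H]
      rw [indicator_of_notMem h', indicator_of_notMem (by exact h)]
      simp
  have hH2 : ∀ y ∈ Ioi (0 : ℝ), ∀ z ∈ Ioi (0 : ℝ), H z y =
      (g y : ℂ) * (Ioc 0 (1 / y)).indicator (fun z : ℝ => (z : ℂ) ^ (w - 1)) z := by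
    intro y hy z hz
    have hy0 : (0 : ℝ) < y := hy
    have hz0 : (0 : ℝ) < z := hz
    have hiff : y ≤ 1 / z ↔ z ≤ 1 / y := by
      rw [le_div_iff₀ hz0, le_div_iff₀ hy0, mul_comm]
    by_cases h : y ≤ 1 / z
    · have h' : z ∈ Ioc 0 (1 / y) := ⟨hz, hiff.1 h⟩
      simp only [H]
      rw [indicator_of_mem h', indicator_of_mem (by exact h), mul_comm]
    · have h' : z ∉ Ioc 0 (1 / y) := fun h' => h (hiff.2 h'.2)
      simp only [H]
      rw [indicator_of_notMem h', indicator_of_notMem (by exact h)]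
      simp
  have hz1 : ∀ z ∈ Ioi (0 : ℝ), ∫ y in Ioi (0 : ℝ), H z y =
      (z : ℂ) ^ (w - 1) * (betaTail δ k z : ℂ) := by
    intro z hz
    rw [setIntegral_congr_fun measurableSet_Ioi (hH1 z hz), integral_const_mul,
      integral_complex_ofReal, setIntegral_indicator measurableSet_Ioc,
      inter_eq_right.2 Ioc_subset_Ioi_self]
    rfl
  have hy1 : ∀ y ∈ Ioi (0 : ℝ), ∫ z in Ioi (0 : ℝ), H z y =
      1 / w * ((y : ℂ) ^ ((δ - w) - 1) * ((1 + y) ^ (-k) : ℝ)) := by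
    intro y hy
    have hy0 : (0 : ℝ) < y := hy
    have hyc : (y : ℂ) ≠ 0 := Complex.ofReal_ne_zero.2 hy0.ne'
    rw [setIntegral_congr_fun measurableSet_Ioi (hH2 y hy), integral_const_mul,
      setIntegral_indicator measurableSet_Ioc, inter_eq_right.2 Ioc_subset_Ioi_self,
      ← intervalIntegral.integral_of_le (by positivity),
      integral_cpow (Or.inl (by simpa using hw))]
    have e1 : ((1 / y : ℝ) : ℂ) ^ w = (y : ℂ) ^ (-w) := by
      rw [one_div, Complex.ofReal_inv, Complex.inv_cpow _ _ (by
        rw [Complex.arg_ofReal_of_nonneg hy0.le]; exact Real.pi_pos.ne), Complex.cpow_neg]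
    have e2 : ((y ^ (δ - 1) : ℝ) : ℂ) = (y : ℂ) ^ ((δ : ℂ) - 1) := by
      rw [Complex.ofReal_cpow hy0.le]; push_cast; rfl
    have e3 : (y : ℂ) ^ ((δ - w : ℂ) - 1) = (y : ℂ) ^ ((δ : ℂ) - 1) * (y : ℂ) ^ (-w) := by
      rw [← Complex.cpow_add _ _ hyc]; congr 1; ring
    rw [sub_add_cancel, Complex.ofReal_zero, Complex.zero_cpow hw0, sub_zero, e1, e3]
    simp only [g]
    rw [Complex.ofReal_mul, e2]
    ring
  have hint : Integrable (Function.uncurry H)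
      ((volume.restrict (Ioi 0)).prod (volume.restrict (Ioi 0))) := by
    rw [integrable_prod_iff' hHm.aestronglyMeasurable]
    have hIc : ∀ y : ℝ, 0 < y → IntegrableOn (fun z : ℝ => (z : ℂ) ^ (w - 1)) (Ioc 0 (1 / y)) :=
      fun y hy => (intervalIntegrable_iff_integrableOn_Ioc_of_le (by positivity)).1
        (intervalIntegral.intervalIntegrable_cpow' (by simpa using hw))
    constructor
    · filter_upwards [ae_restrict_mem measurableSet_Ioi] with y hy
      have h3 : IntegrableOn ((Ioc 0 (1 / y)).indicator fun z : ℝ => (z : ℂ) ^ (w - 1)) (Ioi 0) :=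
        ((integrable_indicator_iff measurableSet_Ioc).2 (hIc y hy)).integrableOn
      exact IntegrableOn.congr_fun (h3.const_mul (g y : ℂ)) (fun z hz => (hH2 y hy z hz).symm)
        measurableSet_Ioi
    · have h4 : IntegrableOn (fun y : ℝ => 1 / w.re *
          (y ^ ((δ - w.re) - 1) * (1 + y) ^ (-k))) (Ioi 0) :=
        (integrableOn_rpow_mul_one_add_rpow (by linarith) hk).const_mul _
      refine h4.congr_fun (fun y hy => ?_) measurableSet_Ioi
      have hy0 : (0 : ℝ) < y := hy
      simp only [Function.uncurry]
      have e4 : ∀ z ∈ Ioi (0 : ℝ), ‖H z y‖ =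
          g y * (Ioc 0 (1 / y)).indicator (fun z : ℝ => z ^ (w.re - 1)) z := by
        intro z hz
        rw [hH2 y hy z hz, norm_mul, Complex.norm_real,
          Real.norm_of_nonneg (by simp only [g]; positivity), norm_indicator_eq_indicator_norm]
        congr 1
        by_cases h : z ∈ Ioc 0 (1 / y)
        · rw [indicator_of_mem h, indicator_of_mem h, Complex.norm_cpow_eq_rpow_re_of_pos hz]
          simp
        · rw [indicator_of_notMem h, indicator_of_notMem h]
      rw [setIntegral_congr_fun measurableSet_Ioi e4, integral_const_mul,
        setIntegral_indicator measurableSet_Ioc, inter_eq_right.2 Ioc_subset_Ioi_self,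
        ← intervalIntegral.integral_of_le (by positivity),
        integral_rpow (Or.inl (by linarith)), sub_add_cancel, Real.zero_rpow hw.ne', sub_zero,
        one_div y, Real.inv_rpow hy0.le, ← Real.rpow_neg hy0.le]
      simp only [g]
      rw [show δ - w.re - 1 = (δ - 1) + (-w.re) by ring, Real.rpow_add hy0]
      ring
  constructor
  · have := hint.integral_prod_left
    refine IntegrableOn.congr_fun (f := fun z => ∫ y in Ioi (0 : ℝ), H z y) this (fun z hz => ?_)
      measurableSet_Ioi
    rw [smul_eq_mul]
    exact hz1 z hz
  · have hswap := integral_integral_swap hint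
    rw [setIntegral_congr_fun measurableSet_Ioi hz1, setIntegral_congr_fun measurableSet_Ioi hy1,
      integral_const_mul, integral_cpow_mul_one_add_rpow (by simpa using hwδ)
        (by simpa using hk)] at hswap
    unfold mellin
    simp only [smul_eq_mul]
    rw [hswap]
    ring

theorem sq_min_mul_le_norm_mul_norm {a b t : ℝ} (ha : 0 < a) (hb : 0 < b) :
    (min 1 (min a b)) ^ 2 * (1 + t ^ 2) ≤
      ‖(a + t * Complex.I : ℂ)‖ * ‖(b + t * Complex.I : ℂ)‖ := by
  set m := min 1 (min a b) with hm
  have hm0 : 0 < m := by positivity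
  have h1 : m ≤ 1 := min_le_left _ _
  have key : ∀ c, m ≤ c → 0 < c → m * Real.sqrt (1 + t ^ 2) ≤ ‖(c + t * Complex.I : ℂ)‖ := by
    intro c hc hc0
    rw [Complex.norm_add_mul_I]
    refine Real.le_sqrt_of_sq_le ?_
    rw [mul_pow, Real.sq_sqrt (by positivity)]
    nlinarith [sq_nonneg t, mul_le_mul h1 h1 hm0.le zero_le_one,
      mul_le_mul hc hc hm0.le hc0.le]
  have := mul_le_mul (key a ((min_le_right _ _).trans (min_le_left _ _)) ha)
    (key b ((min_le_right _ _).trans (min_le_right _ _)) hb) (by positivity) (norm_nonneg _)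
  refine le_trans (le_of_eq ?_) this
  rw [mul_mul_mul_comm, Real.mul_self_sqrt (by positivity)]
  ring

/-- On the line, `Γ(δ - w)` is bounded, while `Γ(k - δ + w)` and `1 / w` each decay like the inverse
of the distance to a point off the line. The product is dominated by a multiple of `1 / (1 + t²)`.
-/
theorem verticalIntegrable_gamma {δ k c : ℝ} (hc : 0 < c) (hcδ : c < δ) (hk : δ - c < k) :
    Integrable fun t : ℝ => Complex.Gamma (δ - (c + t * Complex.I)) *
      Complex.Gamma (k - (δ - (c + t * Complex.I))) / Complex.Gamma k / (c + t * Complex.I) := by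
  have r1 : ∀ t : ℝ, (δ - (c + t * Complex.I) : ℂ).re = δ - c := fun t => by simp
  have r2 : ∀ t : ℝ, (k - (δ - (c + t * Complex.I)) : ℂ).re = k - (δ - c) := fun t => by simp
  have hk0 : 0 < k := by linarith
  have hΓk : Complex.Gamma k ≠ 0 := Complex.Gamma_ne_zero_of_re_pos (by simpa using hk0)
  have hw : ∀ t : ℝ, (c + t * Complex.I : ℂ) ≠ 0 := by
    intro t h
    have := congrArg Complex.re h
    simp at this
    exact hc.ne' this
  have hcont : Continuous fun t : ℝ => Complex.Gamma (δ - (c + t * Complex.I)) *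
      Complex.Gamma (k - (δ - (c + t * Complex.I))) / Complex.Gamma k / (c + t * Complex.I) := by
    have hG : ∀ {f : ℝ → ℂ}, Continuous f → (∀ t, 0 < (f t).re) →
        Continuous fun t => Complex.Gamma (f t) := by
      intro f hf hpos
      refine continuous_iff_continuousAt.2 fun t => ?_
      refine ContinuousAt.comp (g := Complex.Gamma) ?_ hf.continuousAt
      refine (Complex.differentiableAt_Gamma _ fun m h => ?_).continuousAt
      have h1 := hpos t
      rw [h] at h1
      simp at h1
      have : (0 : ℝ) ≤ m := Nat.cast_nonneg m
      linarith
    refine (((hG (by fun_prop) fun t => ?_).mul (hG (by fun_prop) fun t => ?_)).div_const _).div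
      (by fun_prop) hw
    · rw [r1]; linarith
    · rw [r2]; linarith
  set m := min 1 (min (k - (δ - c)) c) with hm
  have hm0 : 0 < m := lt_min one_pos (lt_min (by linarith) hc)
  have hbd : Integrable fun t : ℝ => Real.Gamma (δ - c) * Real.Gamma (k - (δ - c) + 1) /
      ‖Complex.Gamma k‖ / m ^ 2 * (1 + t ^ 2)⁻¹ := integrable_inv_one_add_sq.const_mul _
  refine hbd.mono' hcont.aestronglyMeasurable (Eventually.of_forall fun t => ?_)
  have h1 := norm_Gamma_le (s := δ - (c + t * Complex.I)) (by rw [r1]; linarith)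
  have h2 := norm_Gamma_le_div (s := k - (δ - (c + t * Complex.I))) (by rw [r2]; linarith)
  have h3 := sq_min_mul_le_norm_mul_norm (a := k - (δ - c)) (b := c) (t := t) (by linarith) hc
  rw [r1] at h1
  rw [r2] at h2
  have e : (k - (δ - (c + t * Complex.I)) : ℂ) = ((k - (δ - c) : ℝ) : ℂ) + t * Complex.I := by
    push_cast; ring
  have hG1 : 0 < Real.Gamma (δ - c) := Real.Gamma_pos_of_pos (by linarith)
  have hG2 : 0 < Real.Gamma (k - (δ - c) + 1) := Real.Gamma_pos_of_pos (by linarith)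
  have hn1 : 0 < ‖Complex.Gamma k‖ := norm_pos_iff.2 hΓk
  have hn2 : 0 < ‖(c + t * Complex.I : ℂ)‖ := norm_pos_iff.2 (hw t)
  rw [← hm] at h3
  have hn3 : 0 < ‖(k - (δ - (c + t * Complex.I)) : ℂ)‖ := by
    rw [e]
    refine norm_pos_iff.2 fun h => ?_
    have := congrArg Complex.re h
    simp at this
    linarith
  rw [norm_div, norm_div, norm_mul]
  calc _ ≤ Real.Gamma (δ - c) * (Real.Gamma (k - (δ - c) + 1) /
        ‖(k - (δ - (c + t * Complex.I)) : ℂ)‖) / ‖Complex.Gamma k‖ / ‖(c + t * Complex.I : ℂ)‖ := by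
        gcongr
    _ = Real.Gamma (δ - c) * Real.Gamma (k - (δ - c) + 1) / ‖Complex.Gamma k‖ /
        (‖(k - (δ - (c + t * Complex.I)) : ℂ)‖ * ‖(c + t * Complex.I : ℂ)‖) := by
        field_simp
    _ ≤ Real.Gamma (δ - c) * Real.Gamma (k - (δ - c) + 1) / ‖Complex.Gamma k‖ /
        (m ^ 2 * (1 + t ^ 2)) := by
        rw [e]
        exact div_le_div_of_nonneg_left (by positivity) (by positivity) h3
    _ = _ := by field_simp

/-- The Meijer function in `φ` is an incomplete Beta function. -/
theorem meijerG2122_eq {δ k z : ℝ} (hδ : 0 < δ) (hk : 0 < k) (hz : 0 < z) :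
    meijerG2122 (1 - δ) 1 0 (k - δ) z = Real.Gamma k * betaTail δ k z := by
  set σ : ℝ := ((1 - δ) - 1 + min 0 (k - δ)) / 2 with hσ
  have hmin1 : min 0 (k - δ) ≤ 0 := min_le_left _ _
  have hmin2 : min 0 (k - δ) ≤ k - δ := min_le_right _ _
  have hmin3 : -δ < min 0 (k - δ) := lt_min (by linarith) (by linarith)
  -- The substitution `s = -w` turns the contour of the Meijer function into the inversion line `Re
  -- w = c`, where `c` is the midpoint between `max 0 (δ - k)` and `δ`.
  obtain ⟨c, hcσ⟩ : ∃ c, c = -σ := ⟨_, rfl⟩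
  have hc : 0 < c := by rw [hcσ, hσ]; linarith
  have hcδ : c < δ := by rw [hcσ, hσ]; linarith
  have hck : δ - c < k := by rw [hcσ, hσ]; linarith
  have hΓk : Complex.Gamma k ≠ 0 := Complex.Gamma_ne_zero_of_re_pos (by simpa using hk)
  have hM : ∀ t : ℝ, mellin (fun z => (betaTail δ k z : ℂ)) (c + t * Complex.I) =
      Complex.Gamma (δ - (c + t * Complex.I)) *
      Complex.Gamma (k - (δ - (c + t * Complex.I))) / Complex.Gamma k / (c + t * Complex.I) :=
    fun t => (hasMellin_betaTail (by simpa using hc) (by simpa using hcδ) (by simpa using hck)).2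
  have hconv : MellinConvergent (fun z => (betaTail δ k z : ℂ)) c :=
    (hasMellin_betaTail (by simpa using hc) (by simpa using hcδ) (by simpa using hck)).1
  have hinv := mellinInv_mellin_eq c (fun z => (betaTail δ k z : ℂ)) hz hconv
    (by
      have := verticalIntegrable_gamma hc hcδ hck
      exact this.congr (Eventually.of_forall fun t => (hM t).symm))
    (Complex.continuous_ofReal.continuousAt.comp (continuousAt_betaTail hδ hk hz))
  unfold mellinInv at hinv
  unfold meijerG2122
  -- Under `s = -w` the line is traversed backwards, which `t ↦ -t` undoes.
  rw [← integral_neg_eq_self]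
  have e : ∀ t : ℝ, (let s : ℂ := (σ : ℂ) + ((-t : ℝ) : ℂ) * Complex.I
      Complex.Gamma ((0 : ℝ) - s) * Complex.Gamma ((k - δ : ℝ) - s) *
        Complex.Gamma (1 - (1 - δ : ℝ) + s) / Complex.Gamma ((1 : ℝ) - s) * (z : ℂ) ^ s) =
      Complex.Gamma k * ((z : ℂ) ^ (-(c + t * Complex.I)) •
        mellin (fun z => (betaTail δ k z : ℂ)) (c + t * Complex.I)) := by
    intro t
    rw [hM]
    have hs : (σ : ℂ) + ((-t : ℝ) : ℂ) * Complex.I = -(c + t * Complex.I) := by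
      rw [hcσ]; push_cast; ring
    have hw : (c + t * Complex.I : ℂ) ≠ 0 := by
      intro h
      have := congrArg Complex.re h
      simp at this
      exact hc.ne' this
    have hΓw : Complex.Gamma (c + t * Complex.I) ≠ 0 :=
      Complex.Gamma_ne_zero_of_re_pos (by simpa using hc)
    simp only [hs, smul_eq_mul]
    have e1 : ((1 : ℝ) : ℂ) - -(c + t * Complex.I) = (c + t * Complex.I) + 1 := by
      push_cast; ring
    have e2 : ((0 : ℝ) : ℂ) - -(c + t * Complex.I) = c + t * Complex.I := by
      push_cast; ring
    have e3 : ((k - δ : ℝ) : ℂ) - -(c + t * Complex.I) = k - (δ - (c + t * Complex.I)) := by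
      push_cast; ring
    have e4 : 1 - ((1 - δ : ℝ) : ℂ) + -(c + t * Complex.I) = δ - (c + t * Complex.I) := by
      push_cast; ring
    -- `Γ(-s) / Γ(1 - s) = Γ(w) / Γ(w + 1) = 1 / w`: two of the Gamma factors collapse into the `1 /
    -- w` of the Mellin transform.
    rw [e1, e2, e3, e4, Complex.Gamma_add_one _ hw]
    field_simp
  have e' := integral_congr_ae (μ := (volume : Measure ℝ)) (Eventually.of_forall e)
  rw [integral_const_mul] at e'
  simp only at e' ⊢
  rw [e']
  have e5 : (1 / (2 * Real.pi) : ℂ) * (Complex.Gamma k * ∫ t : ℝ,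
      (z : ℂ) ^ (-(c + t * Complex.I)) •
        mellin (fun z => (betaTail δ k z : ℂ)) (c + t * Complex.I)) =
      ((Real.Gamma k * betaTail δ k z : ℝ) : ℂ) := by
    rw [Complex.ofReal_mul, ← hinv, Complex.Gamma_ofReal, Complex.real_smul]
    push_cast
    ring
  rw [e5, Complex.ofReal_re]

/-! ### The function `φ` -/

theorem betaTail_nonneg (δ k z : ℝ) : 0 ≤ betaTail δ k z :=
  setIntegral_nonneg measurableSet_Ioc fun y hy => by
    have := hy.1
    positivity

/-- The substitution `y = A x^τ` turns `x dx` into a multiple of `y^{δ-1} dy`, because `τδ = 2`. -/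
theorem integral_mul_one_add_rpow {τ A R k : ℝ} (hτ : 0 < τ) (hA : 0 < A) (hR : 0 < R) :
    ∫ x in Icc 0 R, 2 * x / R ^ 2 * (1 + A * x ^ τ) ^ (-k) =
      2 / τ / R ^ 2 * A ^ (-(2 / τ)) * betaTail (2 / τ) k (1 / (A * R ^ τ)) := by
  set δ := 2 / τ with hδ
  let g : ℝ → ℝ := (Ioc 0 (A * R ^ τ)).indicator fun y => y ^ (δ - 1) * (1 + y) ^ (-k)
  have h1 : betaTail δ k (1 / (A * R ^ τ)) = ∫ y in Ioi (0 : ℝ), g y := by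
    rw [setIntegral_indicator measurableSet_Ioc, inter_eq_right.2 Ioc_subset_Ioi_self, betaTail,
      one_div_one_div]
  have h2 : ∫ y in Ioi (0 : ℝ), g (A * y) = A⁻¹ * ∫ y in Ioi (0 : ℝ), g y := by
    rw [integral_comp_mul_left_Ioi g 0 hA, mul_zero, smul_eq_mul]
  have h3 := integral_comp_rpow_Ioi_of_pos (g := fun y => g (A * y)) hτ
  have h4 : ∀ x ∈ Ioi (0 : ℝ), (τ * x ^ (τ - 1)) • g (A * x ^ τ) =
      (Ioc 0 R).indicator (fun x => A ^ (δ - 1) * τ * R ^ 2 / 2 *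
        (2 * x / R ^ 2 * (1 + A * x ^ τ) ^ (-k))) x := by
    intro x hx
    have hx0 : (0 : ℝ) < x := hx
    have hiff : A * x ^ τ ∈ Ioc 0 (A * R ^ τ) ↔ x ∈ Ioc 0 R := by
      constructor
      · intro h
        refine ⟨hx, ?_⟩
        have := le_of_mul_le_mul_left h.2 hA
        exact (Real.rpow_le_rpow_iff hx0.le hR.le hτ).1 this
      · intro h
        exact ⟨by positivity, mul_le_mul_of_nonneg_left
          (Real.rpow_le_rpow hx0.le h.2 hτ.le) hA.le⟩
    by_cases h : x ∈ Ioc 0 R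
    · simp only [g]
      rw [indicator_of_mem (hiff.2 h), indicator_of_mem h, smul_eq_mul,
        Real.mul_rpow hA.le (by positivity), ← Real.rpow_mul hx0.le]
      have e : x ^ (τ - 1) * x ^ (τ * (δ - 1)) = x := by
        rw [← Real.rpow_add hx0]
        have : τ - 1 + τ * (δ - 1) = 1 := by rw [hδ]; field_simp; ring
        rw [this, Real.rpow_one]
      calc _ = (x ^ (τ - 1) * x ^ (τ * (δ - 1))) * (τ * A ^ (δ - 1) * (1 + A * x ^ τ) ^ (-k)) := by
            ring
        _ = _ := by rw [e]; field_simp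
    · simp only [g]
      rw [indicator_of_notMem (fun h' => h (hiff.1 h')), indicator_of_notMem h, smul_zero]
  rw [setIntegral_congr_fun measurableSet_Ioi h4, setIntegral_indicator measurableSet_Ioc,
    inter_eq_right.2 Ioc_subset_Ioi_self, integral_const_mul, h2, ← h1] at h3
  rw [integral_Icc_eq_integral_Ioc]
  have e2 : A ^ (-δ) * A ^ (δ - 1) = A⁻¹ := by
    rw [← Real.rpow_add hA, show -δ + (δ - 1) = -1 by ring, Real.rpow_neg_one]
  have hAδ : 0 < A ^ (δ - 1) := by positivity
  have h5 : betaTail δ k (1 / (A * R ^ τ)) = A * (A ^ (δ - 1) * τ * R ^ 2 / 2 *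
      ∫ x in Ioc 0 R, 2 * x / R ^ 2 * (1 + A * x ^ τ) ^ (-k)) := by
    rw [h3]; field_simp
  rw [h5, hδ]
  rw [← hδ]
  have e3 : A ^ (-δ) * (A * A ^ (δ - 1)) = 1 := by
    rw [mul_left_comm, e2, mul_inv_cancel₀ hA.ne']
  calc _ = (A ^ (-δ) * (A * A ^ (δ - 1))) *
        ∫ x in Ioc 0 R, 2 * x / R ^ 2 * (1 + A * x ^ τ) ^ (-k) := by rw [e3, one_mul]
    _ = (δ * τ / 2) * (A ^ (-δ) * (A * A ^ (δ - 1))) *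
        ∫ x in Ioc 0 R, 2 * x / R ^ 2 * (1 + A * x ^ τ) ^ (-k) := by
      rw [show δ * τ / 2 = 1 by rw [hδ]; field_simp, one_mul]
    _ = _ := by
      generalize (∫ x in Ioc 0 R, 2 * x / R ^ 2 * (1 + A * x ^ τ) ^ (-k)) = J
      field_simp

theorem lintegral_lenLawC {p : Params} {g : ℝ → ℝ≥0∞} (hg : Measurable g) :
    ∫⁻ x, g x ∂p.lenLawC = ∫⁻ x in Icc 0 p.R, ENNReal.ofReal (2 * x / p.R ^ 2) * g x := by
  rw [Params.lenLawC, lintegral_withDensity_eq_lintegral_mul _ (by fun_prop) hg]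
  rfl

theorem ae_lenLawC_mem (p : Params) : ∀ᵐ x ∂p.lenLawC, x ∈ Icc 0 p.R :=
  (withDensity_absolutelyContinuous _ _).ae_le (ae_restrict_mem measurableSet_Icc)

/-- The argument of the Meijer function in `φ`. -/
def Params.φArg (p : Params) (s r : ℝ) : ℝ :=
  (Real.pi * p.lamB) ^ (1 / (2 / p.τc)) * r ^ p.τc / (p.fadIC.scale * s)

/-- The factor in front of the series in `φ`. -/
def Params.φFactor (p : Params) (s r : ℝ) : ℝ :=
  let δ := 2 / p.τc
  match p.fadIC with
    | .kappaMu κ μ w =>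
        Real.pi * p.lamB * r ^ 2 * δ / Real.exp (μ * κ) * (μ * (1 + κ) / (s * w)) ^ δ
    | .etaMu η μ w =>
        2 * Real.pi ^ (3 / 2 : ℝ) * p.lamB * r ^ 2 * δ / (Real.Gamma μ * hPar η ^ μ) *
          (2 * μ * hPar η / (s * w)) ^ δ

theorem Params.φ_eq (p : Params) (s r : ℝ) : p.φ s r = p.φFactor s r * ∑' n, p.φTerm s r n := rfl

theorem Params.φFactor_pos {p : Params} (hp : p.Valid) {s r : ℝ} (hs : 0 < s) (hr : 0 < r) :
    0 < p.φFactor s r := by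
  have hτ : 0 < p.τc := by linarith [hp.τc_gt]
  have hB := hp.lamB_pos
  have hF := hp.fadIC_valid
  have := Real.pi_pos
  unfold Params.φFactor
  rcases h : p.fadIC with ⟨κ, μ, w⟩ | ⟨η, μ, w⟩ <;> rw [h] at hF
  · obtain ⟨h1, h2, h3⟩ := hF
    simp only
    positivity
  · obtain ⟨h1, h2, h3⟩ := hF
    have h4 := hPar_pos h1
    have h5 := Real.Gamma_pos_of_pos h2
    simp only
    positivity

/-- A form common to both models: the factor `Γ(order n)` of the Meijer function cancels, and what
remains of the coefficient is the weight of the Gamma component. -/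
theorem Params.φFactor_mul_φTerm {p : Params} (hp : p.Valid) {s r : ℝ} (hs : 0 < s) (hr : 0 < r)
    (n : ℕ) : p.φFactor s r * p.φTerm s r n = p.fadIC.weight n *
      (Real.pi * p.lamB * r ^ 2 * (2 / p.τc) * (p.fadIC.scale * s) ^ (-(2 / p.τc)) *
        betaTail (2 / p.τc) (p.fadIC.order n) (p.φArg s r)) := by
  have hτ : 0 < p.τc := by linarith [hp.τc_gt]
  have hB := hp.lamB_pos
  have hF := hp.fadIC_valid
  have hπ := Real.pi_pos
  have hδ : 0 < 2 / p.τc := by positivity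
  unfold Params.φFactor Params.φTerm Params.φArg
  set δ := 2 / p.τc
  rcases h : p.fadIC with ⟨κ, μ, w⟩ | ⟨η, μ, w⟩ <;> rw [h] at hF
  · obtain ⟨h1, h2, h3⟩ := hF
    have hk : 0 < μ + n := by positivity
    have hz : μ * (1 + κ) * (Real.pi * p.lamB) ^ (1 / δ) * r ^ p.τc / (s * w) =
        (Real.pi * p.lamB) ^ (1 / δ) * r ^ p.τc / (w / (μ * (1 + κ)) * s) := by
      field_simp
    have hG := Real.Gamma_pos_of_pos hk
    have hc : (μ * (1 + κ) / (s * w)) ^ δ = (w / (μ * (1 + κ)) * s) ^ (-δ) := by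
      rw [Real.rpow_neg (by positivity), ← Real.inv_rpow (by positivity)]
      congr 1
      field_simp
    simp only [Fading.weight, Fading.order, Fading.scale]
    rw [hz, hc, show (n : ℝ) + μ - δ = (μ + n) - δ by ring,
      meijerG2122_eq hδ hk (by positivity)]
    field_simp
  · obtain ⟨h1, h2, h3⟩ := hF
    have h4 := hPar_pos h1
    have hk : 0 < 2 * μ + 2 * n := by positivity
    have hz : 2 * μ * hPar η * (Real.pi * p.lamB) ^ (1 / δ) * r ^ p.τc / (s * w) =
        (Real.pi * p.lamB) ^ (1 / δ) * r ^ p.τc / (w / (2 * μ * hPar η) * s) := by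
      field_simp
    have hc : (2 * μ * hPar η / (s * w)) ^ δ = (w / (2 * μ * hPar η) * s) ^ (-δ) := by
      rw [Real.rpow_neg (by positivity), ← Real.inv_rpow (by positivity)]
      congr 1
      field_simp
    have hG := Real.Gamma_pos_of_pos hk
    have hG1 := Real.Gamma_pos_of_pos h2
    have hG2 : 0 < Real.Gamma (μ + n + 1 / 2) := Real.Gamma_pos_of_pos (by positivity)
    -- For `η-μ` the cancellation is the duplication formula for `Γ(2μ + 2n)`.
    have hdup := Real.Gamma_mul_Gamma_add_half (μ + n)
    have hdup' : (2 : ℝ) ^ (-2 * (n : ℝ) - 2 * μ) * Real.Gamma (2 * μ + 2 * n) *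
        (2 * Real.sqrt Real.pi) = Real.Gamma (n + μ) * Real.Gamma (μ + n + 1 / 2) := by
      rw [add_comm (n : ℝ) μ, hdup, show 1 - 2 * (μ + (n : ℝ)) = 1 + (-2 * (n : ℝ) - 2 * μ) by ring,
        Real.rpow_add two_pos, Real.rpow_one, mul_add]
      ring
    have hpi : Real.pi ^ (3 / 2 : ℝ) = Real.pi * Real.sqrt Real.pi := by
      rw [Real.sqrt_eq_rpow, show (3 / 2 : ℝ) = 1 + 1 / 2 by norm_num, Real.rpow_add hπ,
        Real.rpow_one]
    rw [Fading.weight_etaMu h1]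
    simp only [Fading.order, Fading.scale]
    rw [hz, hc, show 2 * (n : ℝ) + 2 * μ - δ = (2 * μ + 2 * n) - δ by ring,
      meijerG2122_eq hδ hk (by positivity), hpi, Real.rpow_neg h4.le μ, pow_mul]
    have hfact : (0 : ℝ) < n.factorial := by positivity
    generalize betaTail δ (2 * μ + 2 * n) _ = b
    generalize (w / (2 * μ * hPar η) * s) ^ (-δ) = c
    generalize ((HPar η / hPar η) ^ 2) ^ n = q
    have hh : 0 < hPar η ^ μ := by positivity
    generalize hPar η ^ μ = hh' at hh ⊢
    have key : (2 : ℝ) ^ (-2 * (n : ℝ) - 2 * μ) / (n.factorial * Real.Gamma (μ + n + 1 / 2)) *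
        Real.Gamma (2 * μ + 2 * n) * (2 * Real.sqrt Real.pi) =
        Real.Gamma (n + μ) / n.factorial := by
      rw [eq_div_iff hfact.ne']
      have : Real.Gamma (n + μ) =
          (2 : ℝ) ^ (-2 * (n : ℝ) - 2 * μ) * Real.Gamma (2 * μ + 2 * n) *
            (2 * Real.sqrt Real.pi) / Real.Gamma (μ + n + 1 / 2) := by
        rw [hdup']; field_simp
      rw [this]
      field_simp
    calc _ = ((2 : ℝ) ^ (-2 * (n : ℝ) - 2 * μ) / (n.factorial * Real.Gamma (μ + n + 1 / 2)) *
        Real.Gamma (2 * μ + 2 * n) * (2 * Real.sqrt Real.pi)) * (Real.pi * p.lamB * r ^ 2 * δ *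
          c * b * q / (Real.Gamma μ * hh')) := by ring
      _ = _ := by rw [key]; field_simp

/-- The Laplace transform at `s` of the interference of an active cellular transmitter at distance
`r`. -/
def Params.cellTransform (p : Params) (s r : ℝ) : ℝ≥0∞ :=
  ∫⁻ m, negExp (ENNReal.ofReal (s * (m.1 ^ p.τc * m.2 * r ^ (-p.τc)))) ∂Network.cellMarkLaw p

/-- For a given link length `l`, the fading turns the exponential into the series of `(1 + A
l^τ)^{-order n}`. Averaging each term over `l` produces the incomplete Beta function. -/
theorem Params.cellTransform_eq_tsum {p : Params} (hp : p.Valid) [IsProbabilityMeasure p.fadIC.law]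
    {s r : ℝ} (hs : 0 < s) (hr : 0 < r) :
    p.cellTransform s r = ∑' n, ENNReal.ofReal (p.φFactor s r * p.φTerm s r n) := by
  have hτ : 0 < p.τc := by linarith [hp.τc_gt]
  have hR := Params.R_pos hp
  have hc := hp.fadIC_valid.scale_pos
  have hB := hp.lamB_pos
  have hπ := Real.pi_pos
  have hm : Measurable fun m : ℝ × ℝ =>
      negExp (ENNReal.ofReal (s * (m.1 ^ p.τc * m.2 * r ^ (-p.τc)))) :=
    measurable_negExp.comp (by fun_prop)
  set A := p.fadIC.scale * s * r ^ (-p.τc) with hA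
  have hA0 : 0 < A := by positivity
  have hin : ∀ l ∈ Icc 0 p.R, ∫⁻ g, negExp (ENNReal.ofReal (s * (l ^ p.τc * g * r ^ (-p.τc))))
      ∂p.fadIC.law = ∑' n, ENNReal.ofReal (p.fadIC.weight n *
        (1 + A * l ^ p.τc) ^ (-p.fadIC.order n)) := by
    intro l hl
    have hl0 := hl.1
    have e : ∀ᵐ g ∂p.fadIC.law, negExp (ENNReal.ofReal (s * (l ^ p.τc * g * r ^ (-p.τc)))) =
        ENNReal.ofReal (Real.exp (-((s * l ^ p.τc * r ^ (-p.τc)) * g))) := by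
      filter_upwards [p.fadIC.ae_law_pos] with g hg
      rw [negExp_ofReal (by positivity)]
      congr 3; ring
    rw [lintegral_congr_ae e, hp.fadIC_valid.lintegral_law_exp (by positivity)]
    refine tsum_congr fun n => ?_
    congr 3; rw [hA]; ring
  have hmeas : Measurable fun l : ℝ => ∫⁻ g, negExp (ENNReal.ofReal
      (s * (l ^ p.τc * g * r ^ (-p.τc)))) ∂p.fadIC.law := hm.lintegral_prod_right'
  have hw := hp.fadIC_valid.weight_nonneg
  unfold Params.cellTransform Network.cellMarkLaw
  have : SFinite p.lenLawC := by unfold Params.lenLawC; infer_instance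
  rw [lintegral_prod _ hm.aemeasurable, lintegral_lenLawC hmeas,
    setLIntegral_congr_fun measurableSet_Icc fun l hl => by rw [hin l hl, ← ENNReal.tsum_mul_left],
    lintegral_tsum fun n => Measurable.aemeasurable (by fun_prop)]
  refine tsum_congr fun n => ?_
  have hcont : ContinuousOn (fun x : ℝ => p.fadIC.weight n *
      (2 * x / p.R ^ 2 * (1 + A * x ^ p.τc) ^ (-p.fadIC.order n))) (Icc 0 p.R) := by
    refine continuousOn_const.mul ((by fun_prop : ContinuousOn _ _).mul ?_)
    refine ContinuousOn.rpow_const (continuousOn_const.add (continuousOn_const.mul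
      (Real.continuous_rpow_const hτ.le).continuousOn)) fun x hx => Or.inl ?_
    have := hx.1
    positivity
  have e : ∀ x ∈ Icc 0 p.R, ENNReal.ofReal (2 * x / p.R ^ 2) * ENNReal.ofReal
      (p.fadIC.weight n * (1 + A * x ^ p.τc) ^ (-p.fadIC.order n)) =
      ENNReal.ofReal (p.fadIC.weight n *
        (2 * x / p.R ^ 2 * (1 + A * x ^ p.τc) ^ (-p.fadIC.order n))) := by
    intro x hx
    have := hx.1
    rw [← ENNReal.ofReal_mul (by positivity)]
    congr 1; ring
  rw [setLIntegral_congr_fun measurableSet_Icc e, ← ofReal_integral_eq_lintegral_ofReal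
    hcont.integrableOn_Icc]
  · rw [integral_const_mul, integral_mul_one_add_rpow hτ hA0 hR, Params.φFactor_mul_φTerm hp hs hr]
    -- The constants `πλ_b` and `(πλ_b)^{1/δ}` in `φ` are `R^{-2}` and `R^{-τ}`.
    have e1 : p.R ^ 2 = (Real.pi * p.lamB)⁻¹ := by rw [Params.R_sq hp, one_div]
    have e2 : p.R ^ p.τc = ((Real.pi * p.lamB) ^ (1 / (2 / p.τc)))⁻¹ := by
      rw [← Real.inv_rpow (by positivity), ← e1, ← Real.rpow_natCast, ← Real.rpow_mul hR.le]
      congr 1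
      push_cast
      field_simp
    have e3 : 1 / (A * p.R ^ p.τc) = p.φArg s r := by
      rw [e2, hA, Params.φArg, Real.rpow_neg hr.le]
      have : 0 < r ^ p.τc := by positivity
      field_simp
    have e4 : A ^ (-(2 / p.τc)) = r ^ 2 * (p.fadIC.scale * s) ^ (-(2 / p.τc)) := by
      rw [hA, Real.mul_rpow (by positivity) (by positivity), ← Real.rpow_mul hr.le, mul_comm]
      congr 1
      rw [show -p.τc * -(2 / p.τc) = ((2 : ℕ) : ℝ) by push_cast; field_simp, Real.rpow_natCast]
    rw [e3, e4, e1]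
    congr 1
    field_simp
  · filter_upwards [ae_restrict_mem measurableSet_Icc] with x hx
    have h0 := hx.1
    have h1 := hw n
    simp only [Pi.zero_apply]
    positivity

theorem Params.φFactor_mul_φTerm_nonneg {p : Params} (hp : p.Valid) {s r : ℝ} (hs : 0 < s)
    (hr : 0 < r) (n : ℕ) : 0 ≤ p.φFactor s r * p.φTerm s r n := by
  have hτ : 0 < p.τc := by linarith [hp.τc_gt]
  have hc := hp.fadIC_valid.scale_pos
  have hB := hp.lamB_pos
  have hπ := Real.pi_pos
  have h1 := hp.fadIC_valid.weight_nonneg n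
  rw [Params.φFactor_mul_φTerm hp hs hr]
  have := betaTail_nonneg (2 / p.τc) (p.fadIC.order n) (p.φArg s r)
  positivity

theorem Params.cellTransform_le_one {p : Params} [IsProbabilityMeasure (Network.cellMarkLaw p)]
    (s r : ℝ) : p.cellTransform s r ≤ 1 :=
  (lintegral_mono fun _ => negExp_le_one _).trans (by simp)

theorem Params.measurable_cellTransform (p : Params)
    [IsProbabilityMeasure (Network.cellMarkLaw p)] (s : ℝ) : Measurable (p.cellTransform s) := by
  have hm : Measurable fun z : ℝ × (ℝ × ℝ) =>
      negExp (ENNReal.ofReal (s * (z.2.1 ^ p.τc * z.2.2 * z.1 ^ (-p.τc)))) :=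
    measurable_negExp.comp (by fun_prop)
  exact hm.lintegral_prod_right'

theorem Params.lintegral_one_sub_negExp {p : Params}
    [IsProbabilityMeasure (Network.cellMarkLaw p)] (s r : ℝ) :
    ∫⁻ m, 1 - negExp (ENNReal.ofReal (s * (m.1 ^ p.τc * m.2 * r ^ (-p.τc))))
      ∂Network.cellMarkLaw p = 1 - p.cellTransform s r := by
  have hm : Measurable fun m : ℝ × ℝ =>
      negExp (ENNReal.ofReal (s * (m.1 ^ p.τc * m.2 * r ^ (-p.τc)))) :=
    measurable_negExp.comp (by fun_prop)
  have hfin : p.cellTransform s r ≠ ∞ :=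
    ((Params.cellTransform_le_one s r).trans_lt ENNReal.one_lt_top).ne
  rw [lintegral_sub hm hfin (Eventually.of_forall fun _ => negExp_le_one _)]
  simp [Params.cellTransform]

theorem Params.summable_φTerm {p : Params} (hp : p.Valid) [IsProbabilityMeasure p.fadIC.law]
    [IsProbabilityMeasure (Network.cellMarkLaw p)] {s r : ℝ} (hs : 0 < s) (hr : 0 < r) :
    Summable (p.φTerm s r) := by
  have h := Params.cellTransform_eq_tsum hp hs hr
  have hfin : p.cellTransform s r ≠ ∞ :=
    ((Params.cellTransform_le_one s r).trans_lt ENNReal.one_lt_top).ne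
  rw [h] at hfin
  have h2 := ENNReal.summable_toReal hfin
  have h3 : Summable fun n => p.φFactor s r * p.φTerm s r n :=
    h2.congr fun n => ENNReal.toReal_ofReal (Params.φFactor_mul_φTerm_nonneg hp hs hr n)
  exact (summable_mul_left_iff (Params.φFactor_pos hp hs hr).ne').1 h3

theorem Params.φ_eq_toReal {p : Params} (hp : p.Valid) [IsProbabilityMeasure p.fadIC.law]
    [IsProbabilityMeasure (Network.cellMarkLaw p)] {s r : ℝ} (hs : 0 < s) (hr : 0 < r) :
    p.φ s r = (p.cellTransform s r).toReal := by
  have h3 := (Params.summable_φTerm hp hs hr).mul_left (p.φFactor s r)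
  rw [Params.cellTransform_eq_tsum hp hs hr, ← ENNReal.ofReal_tsum_of_nonneg
    (Params.φFactor_mul_φTerm_nonneg hp hs hr) h3, Params.φ_eq, ← tsum_mul_left,
    ENNReal.toReal_ofReal (tsum_nonneg (Params.φFactor_mul_φTerm_nonneg hp hs hr))]

/-- `1 - e^{-x} ≤ x`, with the link length bounded by `R` and the mean fading finite. The decay
`r^{-τ}` is integrable against `r dr` at infinity since `τ > 2`, and linearity in `s` yields the
limit `s → 0`. -/
theorem Params.exists_one_sub_cellTransform_le {p : Params} (hp : p.Valid)
    [IsProbabilityMeasure p.fadIC.law] [IsProbabilityMeasure (Network.cellMarkLaw p)]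
    [IsProbabilityMeasure p.lenLawC] :
    ∃ C : ℝ, 0 ≤ C ∧ ∀ s r : ℝ, 0 < s → 0 < r →
      1 - p.cellTransform s r ≤ ENNReal.ofReal (s * C * r ^ (-p.τc)) := by
  have hτ : 0 < p.τc := by linarith [hp.τc_gt]
  have hR := Params.R_pos hp
  have hG := hp.fadIC_valid.lintegral_law_id_lt_top
  set EG := ∫⁻ x, ENNReal.ofReal x ∂p.fadIC.law
  refine ⟨p.R ^ p.τc * EG.toReal, by positivity, fun s r hs hr => ?_⟩
  have h2 : ∀ᵐ m ∂Network.cellMarkLaw p, 1 - negExp (ENNReal.ofReal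
      (s * (m.1 ^ p.τc * m.2 * r ^ (-p.τc)))) ≤
        ENNReal.ofReal (s * p.R ^ p.τc * r ^ (-p.τc)) * ENNReal.ofReal m.2 := by
    filter_upwards [Measure.quasiMeasurePreserving_fst.ae (ae_lenLawC_mem p),
      Measure.quasiMeasurePreserving_snd.ae p.fadIC.ae_law_pos] with m h1 h2
    have h0 := h1.1
    rw [negExp_ofReal (by positivity), ← ENNReal.ofReal_one,
      ← ENNReal.ofReal_sub _ (Real.exp_nonneg _), ← ENNReal.ofReal_mul (by positivity)]
    refine ENNReal.ofReal_le_ofReal ?_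
    have h3 := Real.add_one_le_exp (-(s * (m.1 ^ p.τc * m.2 * r ^ (-p.τc))))
    have h4 : m.1 ^ p.τc ≤ p.R ^ p.τc := Real.rpow_le_rpow h0 h1.2 hτ.le
    have h5 : s * (m.1 ^ p.τc * m.2 * r ^ (-p.τc)) ≤ s * p.R ^ p.τc * r ^ (-p.τc) * m.2 := by
      calc _ = m.1 ^ p.τc * (s * m.2 * r ^ (-p.τc)) := by ring
        _ ≤ p.R ^ p.τc * (s * m.2 * r ^ (-p.τc)) := by gcongr
        _ = _ := by ring
    linarith
  rw [← Params.lintegral_one_sub_negExp]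
  refine (lintegral_mono_ae h2).trans (le_of_eq ?_)
  rw [lintegral_const_mul _ (by fun_prop), Network.cellMarkLaw]
  have h3 := lintegral_prod_mul (μ := p.lenLawC) (ν := p.fadIC.law) (f := fun _ => 1)
    (g := fun x => ENNReal.ofReal x) aemeasurable_const (by fun_prop)
  simp only [one_mul, lintegral_one, measure_univ] at h3
  rw [h3]
  change _ * EG = _
  conv_lhs => rw [← ENNReal.ofReal_toReal hG.ne]
  rw [← ENNReal.ofReal_mul (by positivity)]
  congr 1; ring

/-! ### The Laplace transform of the interference at the base station. -/

section

section

variable {p : Params} [IsProbabilityMeasure p.fadIC.law]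
  [IsProbabilityMeasure (Network.cellMarkLaw p)]

theorem Params.φ_le_one (hp : p.Valid) {s r : ℝ} (hs : 0 < s) (hr : 0 < r) : p.φ s r ≤ 1 := by
  rw [Params.φ_eq_toReal hp hs hr]
  exact ENNReal.toReal_le_of_le_ofReal zero_le_one
    (by simpa using Params.cellTransform_le_one s r)

theorem Params.ofReal_one_sub_φ (hp : p.Valid) {s r : ℝ} (hs : 0 < s) (hr : 0 < r) :
    ENNReal.ofReal (1 - p.φ s r) = 1 - p.cellTransform s r := by
  have hfin : p.cellTransform s r ≠ ∞ :=
    ((Params.cellTransform_le_one s r).trans_lt ENNReal.one_lt_top).ne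
  rw [Params.φ_eq_toReal hp hs hr, ENNReal.ofReal_sub _ ENNReal.toReal_nonneg,
    ENNReal.ofReal_toReal hfin, ENNReal.ofReal_one]

theorem Params.integrableOn_rpow_one_sub {p : Params} (hp : p.Valid) :
    IntegrableOn (fun r : ℝ => r ^ (1 - p.τc)) (Ioi p.R) :=
  integrableOn_Ioi_rpow_of_lt (by linarith [hp.τc_gt]) (Params.R_pos hp)

theorem Params.exists_one_sub_φ_le (hp : p.Valid) [IsProbabilityMeasure p.lenLawC] :
    ∃ C : ℝ, 0 ≤ C ∧ ∀ s r : ℝ, 0 < s → 0 < r → (1 - p.φ s r) * r ≤ s * C * r ^ (1 - p.τc) := by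
  obtain ⟨C, hC, h⟩ := Params.exists_one_sub_cellTransform_le hp
  refine ⟨C, hC, fun s r hs hr => ?_⟩
  have h1 := h s r hs hr
  rw [← Params.ofReal_one_sub_φ hp hs hr, ENNReal.ofReal_le_ofReal_iff (by positivity)] at h1
  calc (1 - p.φ s r) * r ≤ s * C * r ^ (-p.τc) * r := by gcongr
    _ = _ := by rw [sub_eq_neg_add, Real.rpow_add hr, Real.rpow_one]; ring

theorem Params.integrableOn_one_sub_φ (hp : p.Valid) [IsProbabilityMeasure p.lenLawC] {s : ℝ}
    (hs : 0 < s) : IntegrableOn (fun r => (1 - p.φ s r) * r) (Ioi p.R) := by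
  have hR := Params.R_pos hp
  obtain ⟨C, hC, h⟩ := Params.exists_one_sub_φ_le hp
  have hm : AEStronglyMeasurable (fun r => (1 - p.φ s r) * r) (volume.restrict (Ioi p.R)) := by
    have h1 : Measurable fun r => (1 - (p.cellTransform s r).toReal) * r :=
      ((p.measurable_cellTransform s).ennreal_toReal.const_sub 1).mul measurable_id
    refine h1.aestronglyMeasurable.congr ?_
    filter_upwards [ae_restrict_mem measurableSet_Ioi] with r hr
    rw [Params.φ_eq_toReal hp hs (hR.trans hr)]
  refine ((Params.integrableOn_rpow_one_sub hp).const_mul (s * C)).mono' hm ?_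
  filter_upwards [ae_restrict_mem measurableSet_Ioi] with r hr
  have hr0 : 0 < r := hR.trans hr
  have := Params.φ_le_one hp hs hr0
  rw [Real.norm_of_nonneg (mul_nonneg (by linarith) hr0.le)]
  exact h s r hs hr0

/-- Averaging over the marks before integrating over the plane leaves the radial function `1 -
φ(‖x‖)` outside the cell, and polar coordinates give the factor `2π r`. -/
theorem Network.lintegral_cellIntf (hp : p.Valid) [IsProbabilityMeasure p.lenLawC] {s : ℝ}
    (hs : 0 < s) :
    ENNReal.ofReal p.lamB * ∫⁻ m, ∫⁻ x, 1 - negExp (ENNReal.ofReal s * cellIntf p (x, m)) ∂volume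
      ∂(cellMarkLaw p) =
        ENNReal.ofReal (2 * Real.pi * p.lamB * ∫ r in Ioi p.R, (1 - p.φ s r) * r) := by
  have hR := Params.R_pos hp
  have hB := hp.lamB_pos
  let f : ℝ → ℝ := (Ici p.R).indicator fun r => 1 - p.φ s r
  have hf0 : ∀ r, 0 ≤ f r := fun r => indicator_nonneg (fun r hr => by
    have := Params.φ_le_one hp hs (hR.trans_le hr)
    linarith) r
  have hF : Measurable fun z : (ℝ × ℝ) × Plane =>
      1 - negExp (ENNReal.ofReal s * cellIntf p (z.2, z.1)) :=
    (measurable_negExp.comp (((measurable_cellIntf p).comp measurable_swap).const_mul _)).const_sub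
      1
  have key : ∀ x : Plane, ∫⁻ m, 1 - negExp (ENNReal.ofReal s * cellIntf p (x, m))
      ∂(cellMarkLaw p) = ENNReal.ofReal (f ‖x‖) := by
    intro x
    by_cases hx : x ∈ Metric.ball (0 : Plane) p.R
    · have h1 : ‖x‖ ∉ Ici p.R := by
        rw [mem_ball_zero_iff] at hx
        exact fun h => absurd hx (not_lt.2 h)
      have h2 : ∀ m, cellIntf p (x, m) = 0 := fun m => if_neg fun h => h hx
      simp only [f]
      rw [indicator_of_notMem h1]
      simp [h2]
    · have h1 : ‖x‖ ∈ Ici p.R := by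
        rw [mem_ball_zero_iff, not_lt] at hx
        exact hx
      have h2 : ∀ m : ℝ × ℝ, ENNReal.ofReal s * cellIntf p (x, m) =
          ENNReal.ofReal (s * (m.1 ^ p.τc * m.2 * ‖x‖ ^ (-p.τc))) := fun m => by
        rw [ENNReal.ofReal_mul hs.le]
        congr 1
        exact if_pos hx
      simp only [f, h2]
      rw [indicator_of_mem h1, Params.ofReal_one_sub_φ hp hs (hR.trans_le h1),
        Params.lintegral_one_sub_negExp]
  have hind : (fun y : ℝ => y ^ (Module.finrank ℝ Plane - 1) • f y) =
      (Ici p.R).indicator fun r => (1 - p.φ s r) * r := by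
    ext y
    have : Module.finrank ℝ Plane - 1 = 1 := by simp
    rw [this, pow_one, smul_eq_mul]
    simp only [f]
    by_cases hy : y ∈ Ici p.R
    · rw [indicator_of_mem hy, indicator_of_mem hy, mul_comm]
    · rw [indicator_of_notMem hy, indicator_of_notMem hy, mul_zero]
  have hint : Integrable fun x : Plane => f ‖x‖ := by
    rw [integrable_fun_norm_addHaar (volume : Measure Plane) (f := f), hind]
    refine Integrable.integrableOn ?_
    -- The boundary circle belongs to the exterior of the open cell but has measure zero.
    rw [integrable_indicator_iff measurableSet_Ici, integrableOn_Ici_iff_integrableOn_Ioi]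
    exact Params.integrableOn_one_sub_φ hp hs
  have hvol : (volume : Measure Plane).real (Metric.ball 0 1) = Real.pi := by
    rw [Measure.real, EuclideanSpace.volume_ball_fin_two]
    simp [Real.pi_pos.le]
  have hval : ∫ x : Plane, f ‖x‖ = 2 * Real.pi * ∫ r in Ioi p.R, (1 - p.φ s r) * r := by
    rw [integral_fun_norm_addHaar (volume : Measure Plane) f, hind, hvol,
      setIntegral_indicator measurableSet_Ici,
      inter_eq_right.2 (Ici_subset_Ioi.2 hR), integral_Ici_eq_integral_Ioi]
    simp [mul_assoc]
  rw [lintegral_lintegral_swap hF.aemeasurable]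
  simp only [key]
  rw [← ofReal_integral_eq_lintegral_ofReal hint (Eventually.of_forall fun x => hf0 _), hval,
    ← ENNReal.ofReal_mul hB.le]
  congr 1; ring

theorem Params.tendsto_integral_one_sub_φ (hp : p.Valid) [IsProbabilityMeasure p.lenLawC] :
    Tendsto (fun s => 2 * Real.pi * p.lamB * ∫ r in Ioi p.R, (1 - p.φ s r) * r) (𝓝[>] 0)
      (𝓝 0) := by
  have hR := Params.R_pos hp
  obtain ⟨C, hC, h⟩ := Params.exists_one_sub_φ_le hp
  have h0 : Tendsto (fun s : ℝ => s * C * ∫ r in Ioi p.R, r ^ (1 - p.τc)) (𝓝[>] 0) (𝓝 0) := by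
    have : Continuous fun s : ℝ => s * C * ∫ r in Ioi p.R, r ^ (1 - p.τc) := by fun_prop
    have h1 := this.tendsto 0
    simp only [zero_mul] at h1
    exact h1.mono_left nhdsWithin_le_nhds
  have h2 : Tendsto (fun s => ∫ r in Ioi p.R, (1 - p.φ s r) * r) (𝓝[>] 0) (𝓝 0) := by
    refine tendsto_of_tendsto_of_tendsto_of_le_of_le' tendsto_const_nhds h0 ?_ ?_
    · refine eventually_nhdsWithin_of_forall fun s hs => ?_
      refine setIntegral_nonneg measurableSet_Ioi fun r hr => ?_
      have hr0 : 0 < r := hR.trans hr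
      have := Params.φ_le_one hp hs hr0
      exact mul_nonneg (by linarith) hr0.le
    · refine eventually_nhdsWithin_of_forall fun s hs => ?_
      rw [← integral_const_mul]
      exact setIntegral_mono_on (Params.integrableOn_one_sub_φ hp hs)
        ((Params.integrableOn_rpow_one_sub hp).const_mul _) measurableSet_Ioi
        fun r hr => h s r hs (hR.trans hr)
  simpa using h2.const_mul (2 * Real.pi * p.lamB)

end

namespace Network

variable {Ω : Type*} [MeasurableSpace Ω] {S : Network Ω} {P : Measure Ω} {p : Params}

theorem IsModel.isProbabilityMeasure_lenLawC [IsProbabilityMeasure P] (hS : S.IsModel P p) :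
    IsProbabilityMeasure p.lenLawC := (hS.cellLen_law 0).isProbabilityMeasure_iff.1 inferInstance

theorem IsModel.isProbabilityMeasure_fadIC [IsProbabilityMeasure P] (hS : S.IsModel P p) :
    IsProbabilityMeasure p.fadIC.law :=
  (hS.cellFad_law 0).isProbabilityMeasure_iff.1 inferInstance

theorem IsModel.isProbabilityMeasure_cellMarkLaw [IsProbabilityMeasure P]
    (hS : S.IsModel P p) : IsProbabilityMeasure (cellMarkLaw p) :=
  (hS.hasLaw_cellMark 0).isProbabilityMeasure_iff.1 inferInstance

theorem IsModel.interfC_lt_top_and_laplace [IsProbabilityMeasure P] (hp : p.Valid)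
    (hS : S.IsModel P p) : (∀ᵐ ω ∂P, S.interfC p ω < ∞) ∧ ∀ s, 0 < s →
      laplace P (S.interfC p) s =
        Real.exp (-(2 * Real.pi * p.lamB * ∫ r in Ioi p.R, (1 - p.φ s r) * r)) := by
  have := hS.isProbabilityMeasure_lenLawC
  have := hS.isProbabilityMeasure_fadIC
  have := hS.isProbabilityMeasure_cellMarkLaw
  have hR := Params.R_pos hp
  refine ae_lt_top_and_laplace_eq
    ((S.measurable_interfC_sig p (subset_univ _)).mono (hS.sig_le _) le_rfl) (fun s hs => ?_)
    (Params.tendsto_integral_one_sub_φ hp)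
  have h0 : 0 ≤ 2 * Real.pi * p.lamB * ∫ r in Ioi p.R, (1 - p.φ s r) * r := by
    have hB := hp.lamB_pos
    refine mul_nonneg (by positivity) (setIntegral_nonneg measurableSet_Ioi fun r hr => ?_)
    have hr0 : 0 < r := hR.trans hr
    have := Params.φ_le_one hp hs hr0
    exact mul_nonneg (by linarith) hr0.le
  rw [← negExp_ofReal h0, ← lintegral_cellIntf hp hs,
    ← hS.lintegral_negExp_tsum_cell hp (f := fun z => ENNReal.ofReal s * cellIntf p z)
      ((measurable_cellIntf p).const_mul _)]
  simp only [ENNReal.tsum_mul_left, interfC_eq_tsum]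

end Network

end

end D2D

end

theorem theorem3 {Ω : Type*} [MeasurableSpace Ω] (P : Measure Ω) [IsProbabilityMeasure P]
    (p : D2D.Params) (hp : p.Valid) (S : D2D.Network Ω) (hS : S.IsModel P p) :
    -- the interferences and the number of UEs in cellular mode in the cell are finite
    (∀ᵐ ω ∂P, S.interfC p ω < ∞ ∧ S.interfD p ω < ∞ ∧ (S.rivals p ω).Finite) ∧
    -- the average rates
    Integrable (S.rateC p) P ∧ Integrable (S.rateDHat p) P ∧ Integrable (S.rateD p) P ∧
    (∫ ω, S.rateC p ω ∂P) =
      (1 - p.β) * (p.lamB / p.lamC) * (1 - Real.exp (-(p.lamC / p.lamB))) *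
        (∫ ω, Real.log (1 + S.W_c ω / ((S.interfC p ω).toReal + p.N₀)) ∂P) ∧
    (∫ ω, S.rateDHat p ω ∂P) =
      p.β * p.ε * (∫ ω, Real.log (1 + S.W_d ω / ((S.interfD p ω).toReal + p.N₀)) ∂P) ∧
    (∫ ω, S.rateD p ω ∂P) =
      (∫ ω, S.rateC p ω ∂P) * P.real {ω | p.θ < S.len0 ω} +
        (∫ ω, S.rateDHat p ω ∂P) * P.real {ω | S.len0 ω ≤ p.θ} ∧
    P.real {ω | S.len0 ω ≤ p.θ} = 1 - Real.exp (-(p.ξ * Real.pi * p.θ ^ 2)) ∧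
    -- the evaluation of the means of the logarithm
    D2D.EvaluatesLogMean P S.W_c (S.interfC p) p.N₀ p.fadC ∧
    D2D.EvaluatesLogMean P S.W_d (S.interfD p) p.N₀ p.fadD ∧
    -- the kernels are the scaled derivatives
    (∀ k : ℕ, 1 ≤ k → ∀ z : ℝ, 0 < z →
      1 / Real.Gamma k * iteratedDeriv k (fun y : ℝ => y ^ (k - 1) * Real.log (1 + y)) z =
        D2D.gKer k z) ∧
    -- the Laplace transforms of the interferences
    (∀ s : ℝ, 0 < s →
      D2D.laplace P (S.interfD p) s = Real.exp (-(p.cD * s ^ (2 / p.τd)))) ∧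
    (∀ s : ℝ, 0 < s →
      (∀ r : ℝ, p.R < r → Summable (p.φTerm s r)) ∧
      IntegrableOn (fun r => (1 - p.φ s r) * r) (Ioi p.R) ∧
      D2D.laplace P (S.interfC p) s =
        Real.exp (-(2 * Real.pi * p.lamB * ∫ r in Ioi p.R, (1 - p.φ s r) * r))) := by
  have hD := hS.interfD_lt_top_and_laplace hp
  have hR := hS.rivals_lt_top_and_laplace hp
  have hC := hS.interfC_lt_top_and_laplace hp
  have := hS.isProbabilityMeasure_lenLawC
  have := hS.isProbabilityMeasure_fadIC
  have := hS.isProbabilityMeasure_cellMarkLaw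
  refine ⟨?_, hS.integrable_rateC hp, hS.integrable_rateDHat hp, hS.integrable_rateD hp,
    hS.integral_rateC hp, hS.integral_rateDHat hp, hS.integral_rateD hp, hS.real_len0_le hp,
    hS.evaluatesLogMean_C hp, hS.evaluatesLogMean_D hp,
    fun k hk z hz => D2D.gKer_eq_iteratedDeriv hk hz, hD.2, fun s hs =>
      ⟨fun r hr => D2D.Params.summable_φTerm hp hs ((D2D.Params.R_pos hp).trans hr),
        D2D.Params.integrableOn_one_sub_φ hp hs, hC.2 s hs⟩⟩
  filter_upwards [hC.1, hD.1, hR.1] with ω h1 h2 h3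
  exact ⟨h1, h2, Set.encard_lt_top_iff.1 (by simpa using h3)⟩
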